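/- Let $G$ be a finite connected directed plane (multi)graph with source $s$ and sink $t$ such that: no directed cycle of $G$ is clockwise; $s$ has no incoming arc and exactly one outgoing arc; every vertex other than $s,t$ has degree (indegree plus outdegree) three; $t$ lies on the unbounded face. A set of arcs, or a path, is *useful* if it is contained in a simple $s,t$-path. Let $C$ be a strongly connected component of $G$ with $s,t\notin V(C)$ such that $s$ is enclosed in a bounded face of $C$. A vertex $z\in V(C)$ is an *exit* of $C$ if there is a $z,t$-path that meets $C$ only in $z$ (an *exit path*). The *lowest floor* $F^*$ is the simple path from $s$ that follows the right-most $s,t$-path (the one found by right-first search) up to its last vertex in $C$, and then goes along boundary arcs of $C$ so that it contains all exits of $C$ and ends at an exit $z$. Left and right of $F^*$ are understood with respect to $F^*$ prolonged by an exit path from $z$ to $t$. The *top-most ceiling* $U^*$ is the left-most path from $s$ to $z$ after all arcs that leave or enter $F^*$ on its right have been removed. The *primary strip* is the region enclosed by $U^*$ and $F^*$; its *inner arcs* are the arcs enclosed by, but not lying on, $U^*\cup F^*$. The *open strip* $\hat C$ consists of all arcs of $C$ that are not inner arcs of the primary strip. A *hump* $H$ is a strip (vertices on or enclosed by its boundary)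 bounded by a subpath of $F^*$ and a subpath of $U^*$ which have the same first vertex and the same, different, last vertex, and which have no other vertex and no arc in common; these are the strips that remain when the arcs of $F^*\cap U^*$ are removed from the primary strip. The *first vertex of $H$* is the common first vertex of the two subpaths. Let $P\subseteq C$ be a backward flipped path with respect to $F^*$ from $u\in V(F^*)$ to $v\in V(F^*)$: a simple path which meets $F^*$ only in $u$ and $v$, which leaves $F^*$ at $u$ to the left and enters $F^*$ at $v$ from the right, and where $v$ comes before $u$ on $F^*$. Then $\hat P=P\cap\hat C$, the part of $P$ in the open strip, is useful if and only if there is a hump $H$ containing $v$ such that either 1. $u$ is also in $H$, and $v$ is not the first vertex of $H$; or 2. $u$ is not in $H$, and $H$ contains an exit of $C$ that comes after $v$ on $F^*$. -/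

import Mathlib

/-- The vertex at which a dart sits. The dart `(a, true)` is the end of the arc `a` at its tail,
the dart `(a, false)` is the end of `a` at its head. -/
def dartVertex {V A : Type*} (src tgt : A → V) (d : A × Bool) : V :=
  if d.2 then src d.1 else tgt d.1

/-- The other end of the same arc. -/
def dartFlip (A : Type*) : Equiv.Perm (A × Bool) :=
  Equiv.prodCongr (Equiv.refl A) Equiv.boolNot

/-- If `rot` sends every dart to the counterclockwise next one around its vertex, then the orbits
of this permutation are the faces: the orbit of `d` is the walk around the face lying
on the left when one moves along the arc of `d`, away from the vertex of `d`. -/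
def dartFace {A : Type*} (rot : Equiv.Perm (A × Bool)) : Equiv.Perm (A × Bool) :=
  rot⁻¹ * dartFlip A

/-- A connected directed plane multigraph, given by the counterclockwise order of the arc ends
around each vertex. Planarity is Euler's formula; `outer` is a dart whose left face is the
unbounded face. -/
structure PlaneDigraph (V A : Type*) where
  src : A → V
  tgt : A → V
  /-- the counterclockwise next dart at the same vertex -/
  rot : Equiv.Perm (A × Bool)
  rot_sameCycle : ∀ d e, rot.SameCycle d e ↔ dartVertex src tgt d = dartVertex src tgt e
  connected : ∀ x y : V, Relation.EqvGen (fun x y => ∃ a, src a = x ∧ tgt a = y) x y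
  euler : Nat.card V + Nat.card (Quotient (Equiv.Perm.SameCycle.setoid (dartFace rot)))
    = Nat.card A + 2
  outer : A × Bool

namespace PlaneDigraph

variable {V A : Type*} (G : PlaneDigraph V A)

/-- The vertex of a dart. -/
def vert (d : A × Bool) : V := dartVertex G.src G.tgt d

/-! Walks, paths, useful sets of arcs -/

/-- `L` is the list of arcs of a directed walk from `x` to `y`. -/
def IsWalk (x : V) : List A → V → Prop
  | [], y => x = y
  | a :: L, y => G.src a = x ∧ IsWalk (G.tgt a) L y

/-- The vertices of a walk that starts at `x`, in order. -/
def verts (x : V) (L : List A) : List V := x :: L.map G.tgt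

/-- A simple directed path from `x` to `y`. -/
def IsPath (x : V) (L : List A) (y : V) : Prop := G.IsWalk x L y ∧ (G.verts x L).Nodup

/-- A directed cycle. -/
def IsCycle (Z : List A) : Prop := Z ≠ [] ∧ (∃ x, G.IsWalk x Z x) ∧ (Z.map G.tgt).Nodup

/-- The set `S` of arcs (the arcs of a path, say) is contained in a simple `s,t`-path. -/
def IsUseful (s t : V) (S : Set A) : Prop := ∃ Q, G.IsPath s Q t ∧ ∀ a ∈ S, a ∈ Q

def Reaches (x y : V) : Prop := ∃ L, G.IsWalk x L y

/-- `C` is the vertex set of a strongly connected component. -/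
def IsSCC (C : Set V) : Prop := ∃ c, C = {v | G.Reaches c v ∧ G.Reaches v c}

/-- The arcs of the subgraph induced by `C`. -/
def arcsOf (C : Set V) : Set A := {a | G.src a ∈ C ∧ G.tgt a ∈ C}

/-! Regions of the plane -/

/-- The faces on the left of the darts `d` and `e` lie in the same region of
the plane minus the drawing of the arcs in `S`. -/
def SameRegion (S : Set A) (d e : A × Bool) : Prop :=
  Relation.EqvGen (fun d e => (dartFace G.rot).SameCycle d e ∨ (e = dartFlip A d ∧ d.1 ∉ S)) d e

/-- The face on the left of `d` lies in the unbounded region of the plane minus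
the drawing of the arcs in `S`. -/
def Outside (S : Set A) (d : A × Bool) : Prop := G.SameRegion S d G.outer

/-- A cycle whose left side is the unbounded side. -/
def IsClockwise (Z : List A) : Prop := G.IsCycle Z ∧ ∃ a ∈ Z, G.Outside {b | b ∈ Z} (a, true)

/-- `x` lies on the unbounded face. -/
def OnOuterFace (x : V) : Prop := ∃ d, G.vert d = x ∧ (dartFace G.rot).SameCycle d G.outer

/-- The properties of the preprocessed network with source `s` and sink `t`. -/
structure IsNetwork (s t : V) : Prop where
  no_clockwise : ∀ Z, ¬ G.IsClockwise Z
  source_in : ∀ a, G.tgt a ≠ s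
  source_out : ∃! a, G.src a = s
  degree_three : ∀ x, x ≠ s → x ≠ t → Nat.card {d : A × Bool // G.vert d = x} = 3
  sink_outer : G.OnOuterFace t

/-- The inside case: `s` is enclosed by the component `C`, that is, `s` lies in a bounded face
of the plane graph induced by `C`. -/
def IsInsideCase (C : Set V) (s t : V) : Prop :=
  s ∉ C ∧ t ∉ C ∧ ∀ d, G.vert d = s → ¬ G.Outside (G.arcsOf C) d

/-- `X` is a path from `z` to `t` that meets the component `C` only in `z`. -/
def IsExitPath (C : Set V) (t z : V) (X : List A) : Prop :=
  z ∈ C ∧ G.IsPath z X t ∧ ∀ y ∈ X.map G.tgt, y ∉ C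

def IsExit (C : Set V) (t z : V) : Prop := ∃ X, G.IsExitPath C t z X

/-- The boundary arcs of `C`: those on the unbounded face of the plane graph induced by `C`. -/
def boundaryArcs (C : Set V) : Set A :=
  {a ∈ G.arcsOf C | G.Outside (G.arcsOf C) (a, true) ∨ G.Outside (G.arcsOf C) (a, false)}

/-! Left and right -/

/-- Turning counterclockwise around their vertex from the dart `p`, one meets `e` and then `q`
before returning to `p`. -/
def Ccw (p e q : A × Bool) : Prop :=
  ∃ i j : ℕ, 0 < i ∧ i < j ∧ (G.rot ^ i) p = e ∧ (G.rot ^ j) p = q ∧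
    ∀ k, 0 < k → k ≤ j → (G.rot ^ k) p ≠ p

/-- The dart `d` sits at an inner vertex of the path `W` and points to the right of `W`. -/
def RightOf (W : List A) (d : A × Bool) : Prop :=
  ∃ p q, [p, q] <:+: W ∧ G.Ccw (p, false) d (q, true)

/-- The dart `d` sits at an inner vertex of the path `W` and points to the left of `W`. -/
def LeftOf (W : List A) (d : A × Bool) : Prop :=
  ∃ p q, [p, q] <:+: W ∧ G.Ccw (q, true) d (p, false)

/-- `R` is the right-most path from `x` to `y`, as found by right-first search: whenever another
simple path from `x` to `y` separates from `R` after a common arc `a`, it does so to the left of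
`R`, i.e. the arc of `R` comes first in the counterclockwise order starting at `a`. -/
def IsRightmostPath (x : V) (R : List A) (y : V) : Prop :=
  G.IsPath x R y ∧ ∀ L a b b' M M', R = L ++ a :: b :: M → G.IsPath x (L ++ a :: b' :: M') y →
    b ≠ b' → G.Ccw (a, false) (b, true) (b', true)

/-- `U` is the left-most path from `x` to `y` among the paths with all arcs in `S`, as found by
left-first search. -/
def IsLeftmostPath (S : Set A) (x : V) (U : List A) (y : V) : Prop :=
  (G.IsPath x U y ∧ ∀ a ∈ U, a ∈ S) ∧
    ∀ L a b b' M M', U = L ++ a :: b :: M → G.IsPath x (L ++ a :: b' :: M') y →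
      (∀ c ∈ L ++ a :: b' :: M', c ∈ S) → b ≠ b' → G.Ccw (a, false) (b', true) (b, true)

/-! Floor, ceiling, strips, humps -/

/-- `F` is the lowest floor of `C`, and `z` is its end vertex: `F` follows the right-most
`s,t`-path until that path leaves `C` for good (at an exit `y`), and then goes along the boundary
of `C` so as to include all the exits of `C`; it ends at the last exit `z`. -/
def IsLowestFloor (s t : V) (C : Set V) (F : List A) (z : V) : Prop :=
  ∃ y F₁ X D, G.IsRightmostPath s (F₁ ++ X) t ∧ G.IsWalk s F₁ y ∧ G.IsExitPath C t y X ∧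
    F = F₁ ++ D ∧ (∀ a ∈ D, a ∈ G.boundaryArcs C) ∧ G.IsPath s F z ∧ G.IsExit C t z ∧
    ∀ e, G.IsExit C t e → e ∈ G.verts s F

/-- `U` is the top-most ceiling: the left-most path from `s` to the end `z` of the floor, after
removal of the arcs that leave or enter the floor on its right. Here `W` is the floor prolonged
by an exit path, so that right and left make sense at `z` too. -/
def IsTopmostCeiling (s : V) (W : List A) (U : List A) (z : V) : Prop :=
  G.IsLeftmostPath {a | ¬ G.RightOf W (a, true) ∧ ¬ G.RightOf W (a, false)} s U z

/-- The inner arcs of the strip with floor `F` and ceiling `U`. -/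
def innerArcs (F U : List A) : Set A :=
  {a | a ∉ F ∧ a ∉ U ∧ ¬ G.Outside {b | b ∈ F ∨ b ∈ U} (a, true)}

/-- The open strip: everything in `C` that is not in the inner part of the primary strip. -/
def openStrip (C : Set V) (F U : List A) : Set A := G.arcsOf C \ G.innerArcs F U

/-- The vertices of the (proper) strip with floor `L` and ceiling `K`, both starting at `h`:
those on `L` or `K` and those enclosed by `L` and `K`. -/
def stripVerts (h : V) (L K : List A) : Set V :=
  {y | y ∈ G.verts h L ∨ y ∈ G.verts h K ∨
    ∀ d, G.vert d = y → ¬ G.Outside {b | b ∈ L ∨ b ∈ K} d}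

/-- A hump of the primary strip with floor `F` and ceiling `U` (both starting at `s`): a proper
strip from `h` to `x` whose floor `L` and ceiling `K` are subpaths of `F` and `U` without common
arcs, and with no common vertices except the first, `h`, and the last, `x`. -/
structure IsHump (s : V) (F U : List A) (h x : V) (L K : List A) : Prop where
  floor_sub : ∃ F₁ F₂, F = F₁ ++ L ++ F₂ ∧ G.IsWalk s F₁ h
  ceiling_sub : ∃ U₁ U₂, U = U₁ ++ K ++ U₂ ∧ G.IsWalk s U₁ h
  floor_walk : G.IsWalk h L x
  ceiling_walk : G.IsWalk h K x
  ends_ne : h ≠ x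
  arc_disjoint : ∀ a ∈ L, a ∉ K
  inner_disjoint : ∀ y ∈ G.verts h L, y ∈ G.verts h K → y = h ∨ y = x

/-! Forward, backward and flipped paths -/

/-- `x` comes strictly before `y` in the (repetition-free) list `l`. -/
def Precedes (l : List V) (x y : V) : Prop := [x, y].Sublist l

/-- The common vertices of the path `P` from `u` and the floor (with vertex list `VF`) appear on
`P` in the same order as on the floor. -/
def IsForward (VF : List V) (u : V) (P : List A) : Prop :=
  ∀ x y, x ∈ VF → y ∈ VF → x ∈ G.verts u P → y ∈ G.verts u P →
    Precedes VF x y → Precedes (G.verts u P) x y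

/-- `P` is a (minimal) backward flipped path of `C` from `u` to `v` with respect to the floor `F`
from `s`: it leaves the floor to the left, enters it from the right, and is not a forward path.
`W` is the floor prolonged by an exit path. -/
structure IsBackwardFlipped (s : V) (C : Set V) (F W : List A) (u : V) (P : List A) (v : V) :
    Prop where
  isPath : G.IsPath u P v
  arcs_mem : ∀ a ∈ P, a ∈ G.arcsOf C
  start_mem : u ∈ G.verts s F
  end_mem : v ∈ G.verts s F
  minimal : ∀ y ∈ G.verts u P, y ∈ G.verts s F → y = u ∨ y = v
  backward : ¬ G.IsForward (G.verts s F) u P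
  start_left : ∃ a M, P = a :: M ∧ G.LeftOf W (a, true)
  end_right : ∃ a M, P = M ++ [a] ∧ G.RightOf W (a, false)

end PlaneDigraph

namespace PlaneDigraph

variable {V A : Type*} {G : PlaneDigraph V A}

/-! Walks and paths -/

/-! Topology enters through potentials. If `l` and `m` are walks with the same ends and no repeated
arcs, Euler's formula yields a function on faces that vanishes on the unbounded face, is larger by
one on the left of an arc of `l` than on its right, smaller by one for `m`, and does not change
across other arcs (`exists_pot`). Each separation argument compares two values of such a function,
transported along a walk that avoids `l` and `m`. Two facts supply values. A directed cycle has
value 1 on its left and 0 on its right, since none is clockwise (`IsNetwork.cycle_pot`). The right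
bank of the prolonged floor has value 0, provided `l` and `m` use no arc attached to it on the right
and avoid the sink (`IsNetwork.pot_right_bank`). Since an inner vertex of an `s,t`-path has only one
further arc end, sides are decided by a single third dart.

The potential of floor against ceiling is 1 just above the floor and just below the ceiling, and 0
above the ceiling (`Setup.exists_stripPot`). The flipped path `P` leaves the floor to the left and
ends on its right bank, where the value is 0, so before its end it departs from the ceiling for a
last time, at some `k`, and to the left (`FlipSetup.exists_departure`). Before `k` it stays in the
strip (`DepartSetup.strip_of_left`) and never meets the ceiling beyond `k` (`DepartSetup.pos_le`).
Hence the part of `P` in the open strip consists of the tail of `P` from `k` to `v` and, at most,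
some arcs of the ceiling before `k`.

Sufficiency: follow the ceiling to `k`, the tail to `v`, and the floor from `v` either to an exit in
the hump and out, or to the end `x` of the hump and then along the ceiling. The second route is
simple if `k` precedes `x` on the ceiling, which follows from `u` preceding `x` on the floor
(`DepartSetup.lt_pos_of_floor`).

Necessity: let `x` be the first ceiling vertex on the floor from `v` on. If `k` precedes `x` on the
ceiling, then `u` precedes `x` on the floor (`DepartSetup.pos_le_of_floor`), and `u` is in the hump
of `v`. Otherwise the floor from `v` to `x`, the ceiling from `x` to `k` and the tail form a
directed cycle. As `P` enters `v` from the right, `s` lies inside this cycle, while `t` lies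
outside. A useful path reaches `k` from `s` only through `x` (`ReturnCycle.turn_mem_left`). After
`v` it can then use neither `x` nor the ceiling part, so it escapes through the right side of the
floor part, and an arc that leaves the floor on the right and leads to `t` starts at an exit
(`Setup.exit_of_rightOf`). -/

theorem isWalk_append {x y : V} {L M : List A} :
    G.IsWalk x (L ++ M) y ↔ ∃ w, G.IsWalk x L w ∧ G.IsWalk w M y := by
  induction L generalizing x with
  | nil => simp [IsWalk]
  | cons a L ih => simp [IsWalk, ih, and_assoc]

theorem IsWalk.append {x w y : V} {L M : List A} (h : G.IsWalk x L w) (h' : G.IsWalk w M y) :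
    G.IsWalk x (L ++ M) y := isWalk_append.2 ⟨w, h, h'⟩

theorem IsWalk.unique {x y y' : V} {L : List A} (h : G.IsWalk x L y) (h' : G.IsWalk x L y') :
    y = y' := by
  induction L generalizing x with
  | nil => exact h.symm.trans h'
  | cons a L ih => exact ih h.2 h'.2

theorem IsWalk.of_append {x w y : V} {L M : List A} (h : G.IsWalk x (L ++ M) y)
    (h' : G.IsWalk x L w) : G.IsWalk w M y := by
  obtain ⟨w', h1, h2⟩ := isWalk_append.1 h
  rwa [h'.unique h1]

theorem isWalk_concat {x y : V} {L : List A} {a : A} :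
    G.IsWalk x (L ++ [a]) y ↔ G.IsWalk x L (G.src a) ∧ G.tgt a = y := by
  rw [isWalk_append]
  constructor
  · rintro ⟨w, h, rfl, h'⟩
    exact ⟨h, h'⟩
  · rintro ⟨h, h'⟩
    exact ⟨_, h, rfl, h'⟩

theorem verts_append {x : V} {L M : List A} :
    G.verts x (L ++ M) = G.verts x L ++ M.map G.tgt := by
  simp [verts]

theorem start_mem_verts (x : V) (L : List A) : x ∈ G.verts x L := by simp [verts]

theorem mem_verts {x w : V} {L : List A} : w ∈ G.verts x L ↔ w = x ∨ w ∈ L.map G.tgt := by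
  simp [verts]

theorem tgt_mem_verts {x : V} {L : List A} {a : A} (h : a ∈ L) : G.tgt a ∈ G.verts x L :=
  mem_verts.2 (.inr (List.mem_map_of_mem h))

theorem IsWalk.verts_eq {x y : V} {L : List A} (h : G.IsWalk x L y) :
    G.verts x L = L.map G.src ++ [y] := by
  induction L generalizing x with
  | nil => simp [verts, show x = y from h]
  | cons a L ih =>
    have := ih h.2
    simp only [verts, List.map_cons] at this ⊢
    rw [this, h.1]
    simp

theorem IsWalk.end_mem {x y : V} {L : List A} (h : G.IsWalk x L y) : y ∈ G.verts x L := by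
  simp [h.verts_eq]

theorem IsWalk.src_mem {x y : V} {L : List A} {a : A} (h : G.IsWalk x L y) (ha : a ∈ L) :
    G.src a ∈ G.verts x L := by
  rw [h.verts_eq]
  exact List.mem_append_left _ (List.mem_map_of_mem ha)

theorem IsWalk.exists_split {x y w : V} {L : List A} (h : G.IsWalk x L y)
    (hw : w ∈ G.verts x L) :
    ∃ L₁ L₂, L = L₁ ++ L₂ ∧ G.IsWalk x L₁ w ∧ G.IsWalk w L₂ y := by
  induction L generalizing x with
  | nil =>
    have hw' : w = x := by simpa [verts] using hw
    exact ⟨[], [], rfl, hw'.symm, hw' ▸ h⟩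
  | cons a L ih =>
    by_cases hx : w = x
    · subst hx
      exact ⟨[], a :: L, rfl, rfl, h⟩
    · have : w ∈ G.verts (G.tgt a) L := by
        simpa [verts, hx] using hw
      obtain ⟨L₁, L₂, rfl, h1, h2⟩ := ih h.2 this
      exact ⟨a :: L₁, L₂, rfl, ⟨h.1, h1⟩, h2⟩

theorem IsWalk.reaches_end {x y w : V} {L : List A} (h : G.IsWalk x L y)
    (hw : w ∈ G.verts x L) : G.Reaches w y := by
  obtain ⟨_, L₂, _, _, h2⟩ := h.exists_split hw
  exact ⟨L₂, h2⟩

theorem IsWalk.reaches_of_mem {x y w : V} {L : List A} (h : G.IsWalk x L y)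
    (hw : w ∈ G.verts x L) : G.Reaches x w := by
  obtain ⟨L₁, _, _, h1, _⟩ := h.exists_split hw
  exact ⟨L₁, h1⟩

theorem Reaches.refl (x : V) : G.Reaches x x := ⟨[], rfl⟩

theorem Reaches.trans {x y w : V} (h : G.Reaches x y) (h' : G.Reaches y w) : G.Reaches x w := by
  obtain ⟨L, hL⟩ := h
  obtain ⟨M, hM⟩ := h'
  exact ⟨_, hL.append hM⟩

theorem reaches_of_arc (a : A) : G.Reaches (G.src a) (G.tgt a) := ⟨[a], rfl, rfl⟩

theorem IsPath.left {x y w : V} {L M : List A} (h : G.IsPath x (L ++ M) y)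
    (hL : G.IsWalk x L w) : G.IsPath x L w := by
  refine ⟨hL, ?_⟩
  have := h.2
  rw [verts_append] at this
  exact this.of_append_left

theorem IsPath.right {x y w : V} {L M : List A} (h : G.IsPath x (L ++ M) y)
    (hL : G.IsWalk x L w) : G.IsPath w M y := by
  refine ⟨h.1.of_append hL, ?_⟩
  have := h.2
  rw [verts_append, hL.verts_eq, List.append_assoc] at this
  simpa [verts] using this.of_append_right

theorem IsPath.disjoint {x y : V} {L M : List A} (h : G.IsPath x (L ++ M) y) {w : V}
    (h1 : w ∈ G.verts x L) (h2 : w ∈ M.map G.tgt) : False := by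
  have := h.2
  rw [verts_append, List.nodup_append] at this
  exact this.2.2 w h1 w h2 rfl

theorem IsPath.append {x y w : V} {L M : List A} (h : G.IsPath x L w) (h' : G.IsPath w M y)
    (hd : ∀ v ∈ G.verts x L, v ∈ M.map G.tgt → False) : G.IsPath x (L ++ M) y := by
  refine ⟨h.1.append h'.1, ?_⟩
  rw [verts_append, List.nodup_append]
  have := h'.2
  refine ⟨h.2, ?_, fun a ha b hb hab => hd a ha (hab ▸ hb)⟩
  simp only [verts, List.nodup_cons] at this
  exact this.2

theorem IsPath.start_notMem {x y : V} {L : List A} (h : G.IsPath x L y) : x ∉ L.map G.tgt := by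
  have := h.2
  simp only [verts, List.nodup_cons] at this
  exact this.1

theorem IsPath.end_notMem {x y : V} {L : List A} (h : G.IsPath x L y) : y ∉ L.map G.src := by
  have := h.2
  rw [h.1.verts_eq, List.nodup_append] at this
  exact fun hy => this.2.2 y hy y (by simp) rfl

theorem IsPath.tgt_nodup {x y : V} {L : List A} (h : G.IsPath x L y) : (L.map G.tgt).Nodup := by
  have := h.2
  simp only [verts, List.nodup_cons] at this
  exact this.2

theorem IsPath.src_nodup {x y : V} {L : List A} (h : G.IsPath x L y) : (L.map G.src).Nodup := by
  have := h.2
  rw [h.1.verts_eq] at this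
  exact this.of_append_left

theorem IsPath.nodup {x y : V} {L : List A} (h : G.IsPath x L y) : L.Nodup :=
  h.tgt_nodup.of_map _

theorem IsPath.eq_of_src_eq {x y : V} {L : List A} (h : G.IsPath x L y) {a b : A} (ha : a ∈ L)
    (hb : b ∈ L) (hab : G.src a = G.src b) : a = b :=
  List.inj_on_of_nodup_map h.src_nodup ha hb hab

theorem IsPath.eq_of_tgt_eq {x y : V} {L : List A} (h : G.IsPath x L y) {a b : A} (ha : a ∈ L)
    (hb : b ∈ L) (hab : G.tgt a = G.tgt b) : a = b :=
  List.inj_on_of_nodup_map h.tgt_nodup ha hb hab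

theorem IsPath.eq_nil {x : V} {L : List A} (h : G.IsPath x L x) : L = [] := by
  cases L with
  | nil => rfl
  | cons a L =>
    exact absurd h.1.end_mem (by
      intro
      have h1 : x ∈ (a :: L).map G.src := by simp [h.1.1]
      exact h.end_notMem h1)

/-- The first vertex of a walk with a given property. -/
theorem IsWalk.exists_first {x y : V} {L : List A} (h : G.IsWalk x L y) (p : V → Prop)
    (hp : ∃ w ∈ G.verts x L, p w) :
    ∃ L₁ L₂ w, L = L₁ ++ L₂ ∧ G.IsWalk x L₁ w ∧ G.IsWalk w L₂ y ∧ p w ∧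
      ∀ e ∈ L₁, ¬ p (G.src e) := by
  induction L generalizing x with
  | nil =>
    obtain ⟨w, hw, hpw⟩ := hp
    have hw' : w = x := by simpa [verts] using hw
    exact ⟨[], [], w, rfl, hw'.symm, hw' ▸ h, hpw, by simp⟩
  | cons a L ih =>
    by_cases hx : p x
    · exact ⟨[], a :: L, x, rfl, rfl, h, hx, by simp⟩
    · have : ∃ w ∈ G.verts (G.tgt a) L, p w := by
        obtain ⟨w, hw, hpw⟩ := hp
        refine ⟨w, ?_, hpw⟩
        rcases mem_verts.1 hw with rfl | hw
        · exact absurd hpw hx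
        · simpa [verts] using hw
      obtain ⟨L₁, L₂, w, rfl, h1, h2, h3, h4⟩ := ih h.2 this
      refine ⟨a :: L₁, L₂, w, rfl, ⟨h.1, h1⟩, h2, h3, ?_⟩
      intro e he
      rcases List.mem_cons.1 he with rfl | he
      · rwa [h.1]
      · exact h4 e he

/-- The last vertex of a walk with a given property. -/
theorem IsWalk.exists_last {x y : V} {L : List A} (h : G.IsWalk x L y) (p : V → Prop)
    (hp : ∃ w ∈ G.verts x L, p w) :
    ∃ L₁ L₂ w, L = L₁ ++ L₂ ∧ G.IsWalk x L₁ w ∧ G.IsWalk w L₂ y ∧ p w ∧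
      ∀ e ∈ L₂, ¬ p (G.tgt e) := by
  induction L generalizing x with
  | nil =>
    obtain ⟨w, hw, hpw⟩ := hp
    have hw' : w = x := by simpa [verts] using hw
    exact ⟨[], [], w, rfl, hw'.symm, hw' ▸ h, hpw, by simp⟩
  | cons a L ih =>
    by_cases hx : ∃ w ∈ G.verts (G.tgt a) L, p w
    · obtain ⟨L₁, L₂, w, rfl, h1, h2, h3, h4⟩ := ih h.2 hx
      exact ⟨a :: L₁, L₂, w, rfl, ⟨h.1, h1⟩, h2, h3, h4⟩
    · push Not at hx
      obtain ⟨w, hw, hpw⟩ := hp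
      have hwx : w = x := by
        rcases mem_verts.1 hw with rfl | hw
        · rfl
        · exact absurd hpw (hx w (by simpa [verts] using hw))
      subst hwx
      refine ⟨[], a :: L, w, rfl, rfl, h, hpw, ?_⟩
      intro e he
      apply hx
      rcases List.mem_cons.1 he with rfl | he
      · exact start_mem_verts _ _
      · exact tgt_mem_verts he

theorem Reaches.exists_path {x y : V} (h : G.Reaches x y) : ∃ L, G.IsPath x L y := by
  obtain ⟨L, hL⟩ := h
  induction L generalizing x with
  | nil => exact ⟨[], hL, by simp [verts]⟩
  | cons a L ih =>
    obtain ⟨M, hM⟩ := ih hL.2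
    by_cases hx : x ∈ G.verts (G.tgt a) M
    · obtain ⟨M₁, M₂, rfl, h1, h2⟩ := hM.1.exists_split hx
      exact ⟨M₂, hM.right h1⟩
    · refine ⟨a :: M, ⟨hL.1, hM.1⟩, ?_⟩
      have : G.verts x (a :: M) = x :: G.verts (G.tgt a) M := by simp [verts]
      rw [this, List.nodup_cons]
      exact ⟨hx, hM.2⟩

/-! Consecutive arcs -/

theorem IsWalk.src_eq_of_infix {x y : V} {L : List A} (h : G.IsWalk x L y) {p q : A}
    (hpq : [p, q] <:+: L) : G.src q = G.tgt p := by
  obtain ⟨L₁, L₂, rfl⟩ := hpq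
  rw [List.append_assoc] at h
  obtain ⟨w, _, h2⟩ := isWalk_append.1 h
  exact h2.2.1

theorem mem_of_infix_left {L : List A} {p q : A} (hpq : [p, q] <:+: L) : p ∈ L :=
  hpq.subset (by simp)

theorem mem_of_infix_right {L : List A} {p q : A} (hpq : [p, q] <:+: L) : q ∈ L :=
  hpq.subset (by simp)

theorem infix_of_split {L M : List A} {p q : A} : [p, q] <:+: (L ++ [p]) ++ q :: M :=
  ⟨L, M, by simp⟩

/-- A walk which does not start at `w` but passes through it has a last arc before `w`. -/
theorem IsWalk.exists_concat {x w : V} {L : List A} (h : G.IsWalk x L w) (hne : L ≠ []) :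
    ∃ L' p, L = L' ++ [p] ∧ G.IsWalk x L' (G.src p) ∧ G.tgt p = w := by
  refine ⟨L.dropLast, L.getLast hne, (List.dropLast_append_getLast hne).symm, ?_⟩
  rw [← List.dropLast_append_getLast hne] at h
  exact isWalk_concat.1 h

theorem IsWalk.ne_nil {x y : V} {L : List A} (h : G.IsWalk x L y) (hxy : x ≠ y) : L ≠ [] := by
  rintro rfl
  exact hxy h

theorem IsWalk.exists_cons {x y : V} {L : List A} (h : G.IsWalk x L y) (hne : L ≠ []) :
    ∃ a M, L = a :: M ∧ G.src a = x ∧ G.IsWalk (G.tgt a) M y := by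
  cases L with
  | nil => exact absurd rfl hne
  | cons a M => exact ⟨a, M, rfl, h⟩

/-- The arcs of a path before and after an inner vertex. -/
theorem IsWalk.exists_infix {x y w : V} {L : List A} (h : G.IsWalk x L y)
    (hw : w ∈ G.verts x L) (hx : w ≠ x) (hy : w ≠ y) :
    ∃ p q, [p, q] <:+: L ∧ G.tgt p = w ∧ G.src q = w := by
  obtain ⟨L₁, L₂, rfl, h1, h2⟩ := h.exists_split hw
  obtain ⟨L₁', p, rfl, -, hp⟩ := h1.exists_concat (h1.ne_nil hx.symm)
  obtain ⟨q, L₂', rfl, hq, -⟩ := h2.exists_cons (h2.ne_nil hy)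
  exact ⟨p, q, infix_of_split, hp, hq⟩

theorem IsPath.infix_unique {x y : V} {L : List A} (h : G.IsPath x L y) {p q p' q' : A}
    (h1 : [p, q] <:+: L) (h2 : [p', q'] <:+: L) (ht : G.tgt p = G.tgt p') : p = p' ∧ q = q' := by
  refine ⟨h.eq_of_tgt_eq (mem_of_infix_left h1) (mem_of_infix_left h2) ht, ?_⟩
  refine h.eq_of_src_eq (mem_of_infix_right h1) (mem_of_infix_right h2) ?_
  rw [h.1.src_eq_of_infix h1, h.1.src_eq_of_infix h2, ht]

/-! Positions on a path -/

open Classical in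
/-- The position of the vertex `w` on the walk `L` from `x`. -/
noncomputable def pos (G : PlaneDigraph V A) (x : V) (L : List A) (w : V) : ℕ :=
  (G.verts x L).idxOf w

theorem IsWalk.length_verts (x : V) (L : List A) : (G.verts x L).length = L.length + 1 := by
  simp [verts]

theorem IsPath.pos_eq {x y w : V} {L M : List A} (h : G.IsPath x (L ++ M) y)
    (hL : G.IsWalk x L w) : G.pos x (L ++ M) w = L.length := by
  classical
  have hv : G.verts x (L ++ M) = L.map G.src ++ w :: M.map G.tgt := by
    rw [verts_append, hL.verts_eq]; simp
  have hn := h.2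
  rw [hv, List.nodup_append] at hn
  have hw : w ∉ L.map G.src := fun hw => hn.2.2 w hw w (by simp) rfl
  unfold pos
  rw [hv, List.idxOf_append_of_notMem hw]
  simp

theorem IsPath.mem_left_iff {x y w a : V} {L M : List A} (h : G.IsPath x (L ++ M) y)
    (hL : G.IsWalk x L w) :
    a ∈ G.verts x L ↔ G.pos x (L ++ M) a ≤ G.pos x (L ++ M) w := by
  classical
  rw [h.pos_eq hL]
  have hlen : (G.verts x L).length = L.length + 1 := by simp [verts]
  unfold pos
  rw [verts_append]
  constructor
  · intro haL
    rw [List.idxOf_append_of_mem haL]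
    have := List.idxOf_lt_length_of_mem haL
    omega
  · intro hle
    by_contra haL
    rw [List.idxOf_append_of_notMem haL] at hle
    omega

theorem IsPath.mem_right_iff {x y w a : V} {L M : List A} (h : G.IsPath x (L ++ M) y)
    (hL : G.IsWalk x L w) (ha : a ∈ G.verts x (L ++ M)) :
    a ∈ M.map G.tgt ↔ G.pos x (L ++ M) w < G.pos x (L ++ M) a := by
  rw [← not_le, ← h.mem_left_iff hL]
  constructor
  · exact fun h1 h2 => h.disjoint h2 h1
  · intro h1
    rw [verts_append, List.mem_append] at ha
    exact ha.resolve_left h1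

theorem pos_inj {x a b : V} {L : List A} (ha : a ∈ G.verts x L)
    (hab : G.pos x L a = G.pos x L b) : a = b := by
  classical
  exact (List.idxOf_inj ha).1 hab

/-- The part of a path between two of its vertices. -/
theorem IsPath.exists_between {x y a b : V} {L : List A} (h : G.IsPath x L y)
    (ha : a ∈ G.verts x L) (hb : b ∈ G.verts x L) (hab : G.pos x L a < G.pos x L b) :
    ∃ L₁ L₂ L₃, L = L₁ ++ (L₂ ++ L₃) ∧ G.IsWalk x L₁ a ∧ G.IsWalk a L₂ b ∧ G.IsWalk b L₃ y ∧
      L₂ ≠ [] := by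
  obtain ⟨L₁, M, rfl, h1, h2⟩ := h.1.exists_split ha
  have hbM := (h.mem_right_iff h1 hb).2 hab
  obtain ⟨L₂, L₃, rfl, h3, h4⟩ := h2.exists_split (mem_verts.2 (.inr hbM))
  refine ⟨L₁, L₂, L₃, rfl, h1, h3, h4, h3.ne_nil ?_⟩
  rintro rfl
  exact lt_irrefl _ hab

theorem pos_start {x : V} {L : List A} : G.pos x L x = 0 := by
  classical
  simp [pos, verts]

theorem pos_le_length {x w : V} {L : List A} (hw : w ∈ G.verts x L) :
    G.pos x L w ≤ L.length := by
  classical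
  have := List.idxOf_lt_length_of_mem hw
  rw [IsWalk.length_verts] at this
  unfold pos
  omega

theorem IsPath.pos_end {x y : V} {L : List A} (h : G.IsPath x L y) :
    G.pos x L y = L.length := by
  have h' : G.IsPath x (L ++ []) y := by simpa using h
  have := h'.pos_eq h.1
  simpa using this

theorem pos_append {x w : V} {L M : List A} (hw : w ∈ G.verts x L) :
    G.pos x (L ++ M) w = G.pos x L w := by
  classical
  unfold pos
  rw [verts_append, List.idxOf_append_of_mem hw]

/-- Positions increase by one along an arc of a path. -/
theorem IsPath.pos_tgt {x y : V} {L : List A} (h : G.IsPath x L y) {a : A} (ha : a ∈ L) :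
    G.pos x L (G.tgt a) = G.pos x L (G.src a) + 1 := by
  obtain ⟨L₁, L₂, rfl⟩ := List.append_of_mem ha
  obtain ⟨w, h1, h2⟩ := isWalk_append.1 h.1
  have hw : G.src a = w := h2.1
  subst hw
  rw [h.pos_eq h1]
  have h' : G.IsPath x ((L₁ ++ [a]) ++ L₂) y := by simpa using h
  have := h'.pos_eq (w := G.tgt a) (isWalk_concat.2 ⟨h1, rfl⟩)
  simpa using this

theorem precedes_iff {x y a b : V} {L : List A} (h : G.IsPath x L y) (ha : a ∈ G.verts x L)
    (hb : b ∈ G.verts x L) :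
    Precedes (G.verts x L) a b ↔ G.pos x L a < G.pos x L b := by
  obtain ⟨L₁, M, rfl, h1, h2⟩ := h.1.exists_split ha
  rw [← h.mem_right_iff h1 hb]
  have hn := h.2
  have hv : G.verts x (L₁ ++ M) = L₁.map G.src ++ a :: M.map G.tgt := by
    rw [verts_append, h1.verts_eq]; simp
  rw [hv, List.nodup_append] at hn
  have haL : a ∉ L₁.map G.src := fun hw => hn.2.2 a hw a (by simp) rfl
  unfold Precedes
  rw [hv]
  constructor
  · intro hs
    generalize L₁.map G.src = l at hs haL
    induction l with
    | nil =>
      have := List.cons_sublist_cons.1 hs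
      simpa using this
    | cons c l ih =>
      simp only [List.mem_cons, not_or] at haL
      rw [List.cons_append] at hs
      cases hs with
      | cons _ hs => exact ih hs haL.2
      | cons_cons _ hs => exact absurd rfl haL.1
  · intro hb
    refine List.Sublist.trans ?_ (List.sublist_append_right _ _)
    exact List.Sublist.cons_cons _ (List.singleton_sublist.2 hb)

/-- A walk made of arcs of a path is a part of it. -/
theorem IsPath.exists_of_subset {x y w w' : V} {L O : List A} (h : G.IsPath x L y)
    (hO : G.IsWalk w O w') (hne : O ≠ []) (hsub : ∀ a ∈ O, a ∈ L) :
    ∃ L₁ L₂, L = L₁ ++ (O ++ L₂) ∧ G.IsWalk x L₁ w ∧ G.IsWalk w' L₂ y := by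
  induction O generalizing w with
  | nil => exact absurd rfl hne
  | cons a O ih =>
    by_cases hO' : O = []
    · subst hO'
      obtain ⟨L₁, L₂, rfl⟩ := List.append_of_mem (hsub a (by simp))
      obtain ⟨w1, h1, h2⟩ := isWalk_append.1 h.1
      have e1 := h2.1
      have e2 := hO.1
      have e3 : G.tgt a = w' := hO.2
      refine ⟨L₁, L₂, rfl, ?_, ?_⟩
      · rw [← e2, e1]; exact h1
      · rw [← e3]; exact h2.2
    · obtain ⟨M₁, M₂, hL, h1, h2⟩ := ih hO.2 hO' (fun b hb => hsub b (by simp [hb]))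
      have hL1 : M₁ ≠ [] := by
        rintro rfl
        have : x = G.tgt a := h1
        exact h.start_notMem (this ▸ List.mem_map_of_mem (hsub a (by simp)))
      obtain ⟨M, b, rfl, h3, h4⟩ := h1.exists_concat hL1
      have hab : a = b := h.eq_of_tgt_eq (hsub a (by simp)) (by rw [hL]; simp) h4.symm
      subst hab
      refine ⟨M, M₂, by rw [hL]; simp, ?_, h2⟩
      rw [← hO.1]
      exact h3

/-! Darts and faces -/

@[simp]
theorem dartFlip_mk (a : A) (b : Bool) : dartFlip A (a, b) = (a, !b) := rfl

@[simp]
theorem dartFlip_dartFlip (d : A × Bool) : dartFlip A (dartFlip A d) = d := by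
  rcases d with ⟨a, b⟩
  simp

theorem vert_true (a : A) : G.vert (a, true) = G.src a := rfl

theorem vert_false (a : A) : G.vert (a, false) = G.tgt a := rfl

theorem vert_rot (d : A × Bool) : G.vert (G.rot d) = G.vert d :=
  (G.rot_sameCycle _ _).1 (Equiv.Perm.SameCycle.rfl.apply_left)

theorem sameCycle_of_vert_eq {d e : A × Bool} (h : G.vert d = G.vert e) : G.rot.SameCycle d e :=
  (G.rot_sameCycle d e).2 h

theorem face_flip_rot (d : A × Bool) : dartFace G.rot (dartFlip A (G.rot d)) = d := by
  simp [dartFace]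

/-- A property of darts which is invariant under turning around a face and under reversing
an arc is constant. -/
theorem dart_const {β : Type*} (f : A × Bool → β) (hface : ∀ d, f (dartFlip A (G.rot d)) = f d)
    (hflip : ∀ d, f (dartFlip A d) = f d) (d e : A × Bool) : f d = f e := by
  classical
  have hrot : ∀ d, f (G.rot d) = f d := fun d => by rw [← hflip, hface]
  have hv : ∀ d e, G.vert d = G.vert e → f d = f e := by
    intro d e h
    obtain ⟨i, rfl⟩ := sameCycle_of_vert_eq h
    have key : ∀ (n : ℕ) (d : A × Bool), f ((G.rot ^ n) d) = f d := by
      intro n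
      induction n with
      | zero => intro d; rfl
      | succ n ih =>
        intro d
        rw [pow_succ', Equiv.Perm.mul_apply, hrot, ih]
    rcases Int.eq_nat_or_neg i with ⟨n, rfl | rfl⟩
    · rw [zpow_natCast, key]
    · rw [← key n ((G.rot ^ (-(n : ℤ))) d), zpow_neg, zpow_natCast]
      simp
  -- The default only concerns vertices without darts; `hg` evaluates `g` at vertices of darts.
  let g : V → β := fun x => if h : ∃ d, G.vert d = x then f h.choose else f d
  have hg : ∀ d, g (G.vert d) = f d := by
    intro d
    have h : ∃ e, G.vert e = G.vert d := ⟨d, rfl⟩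
    simp only [g, dif_pos h]
    exact hv _ _ h.choose_spec
  have hcon : ∀ x y, Relation.EqvGen (fun x y => ∃ a, G.src a = x ∧ G.tgt a = y) x y →
      g x = g y := by
    intro x y h
    induction h with
    | rel x y h =>
      obtain ⟨a, rfl, rfl⟩ := h
      rw [← vert_true, ← vert_false, hg, hg, ← hflip]
      rfl
    | refl => rfl
    | symm _ _ _ ih => exact ih.symm
    | trans _ _ _ _ _ ih ih' => exact ih.trans ih'
  rw [← hg d, ← hg e]
  exact hcon _ _ (G.connected _ _)

/-! Potentials: functions on the faces with prescribed differences along the arcs -/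

open Classical in
/-- The formal difference of two sets of arcs, given as lists. -/
noncomputable def chain (l m : List A) (a : A) : ℝ :=
  (if a ∈ l then 1 else 0) - (if a ∈ m then 1 else 0)

/-- A telescoping sum. As no arc repeats, the indicator of `l` counts each arc of the walk once. -/
theorem sum_chain_walk [Fintype A] {x y : V} {l : List A} (g : V → ℝ) (h : G.IsWalk x l y)
    (hn : l.Nodup) :
    ∑ a, chain l [] a * (g (G.tgt a) - g (G.src a)) = g y - g x := by
  classical
  have h1 : ∑ a, chain l [] a * (g (G.tgt a) - g (G.src a)) =
      (l.map fun a => g (G.tgt a) - g (G.src a)).sum := by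
    rw [← List.sum_toFinset _ hn, ← Finset.sum_filter_add_sum_filter_not Finset.univ (· ∈ l)]
    rw [Finset.sum_congr (s₂ := l.toFinset) (g := fun a => g (G.tgt a) - g (G.src a)),
      Finset.sum_eq_zero (s := Finset.univ.filter fun a => a ∉ l), add_zero]
    · intro a ha
      have : a ∉ l := by simpa using ha
      simp [chain, this]
    · ext a; simp
    · intro a ha
      have : a ∈ l := by simpa using ha
      simp [chain, this]
  rw [h1]
  clear h1 hn
  induction l generalizing x with
  | nil => simp [show x = y from h]
  | cons a l ih =>
    rw [List.map_cons, List.sum_cons, ih h.2, h.1]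
    ring

/-- Rank-nullity: the kernel contains only constants, so its dimension is at most one. -/
theorem card_le_finrank_range {ι E : Type*} [Fintype ι] [AddCommGroup E] [Module ℝ E]
    (D : (ι → ℝ) →ₗ[ℝ] E) (h : ∀ f, D f = 0 → ∀ i j, f i = f j) :
    Fintype.card ι ≤ Module.finrank ℝ (LinearMap.range D) + 1 := by
  have h1 := LinearMap.finrank_range_add_finrank_ker D
  rw [Module.finrank_fintype_fun_eq_card] at h1
  rcases isEmpty_or_nonempty ι with hι | ⟨⟨i⟩⟩
  · rw [Fintype.card_eq_zero]
    exact Nat.zero_le _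
  have h2 : Module.finrank ℝ (LinearMap.ker D) ≤ 1 := by
    apply finrank_le_one_iff.2
    by_cases hd : (fun _ => 1 : ι → ℝ) ∈ LinearMap.ker D
    · refine ⟨⟨_, hd⟩, fun w => ⟨w.1 i, ?_⟩⟩
      ext j
      simpa using h w.1 w.2 i j
    · refine ⟨0, fun w => ⟨0, ?_⟩⟩
      have hw : w.1 = w.1 i • (fun _ => 1 : ι → ℝ) := by
        ext j
        simpa using h w.1 w.2 j i
      by_cases h0 : w.1 i = 0
      · rw [h0, zero_smul] at hw
        ext j
        simp [hw]
      · exfalso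
        apply hd
        have := w.2
        rw [hw] at this
        exact (Submodule.smul_mem_iff _ h0).1 this
  omega

section Euler

variable [Finite V] [Finite A]

/-- In a plane graph, a function on the arcs which is orthogonal to all differences of functions on
the vertices is the difference of a function on the faces. -/
theorem exists_potential (c : A → ℝ)
    (hc : ∀ [Fintype A] (g : V → ℝ), ∑ a, c a * (g (G.tgt a) - g (G.src a)) = 0) :
    ∃ φ : A × Bool → ℝ, (∀ d, φ (dartFlip A (G.rot d)) = φ d) ∧
      (∀ a, φ (a, true) - φ (a, false) = c a) ∧ φ G.outer = 0 := by
  classical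
  have := Fintype.ofFinite A
  have := Fintype.ofFinite V
  let Q := Quotient (Equiv.Perm.SameCycle.setoid (dartFace G.rot))
  have : Fintype Q := Fintype.ofFinite Q
  let q : A × Bool → Q := Quotient.mk _
  have hq : ∀ d, q (dartFlip A (G.rot d)) = q d := by
    intro d
    apply Quotient.sound
    change (dartFace G.rot).SameCycle _ _
    exact ⟨1, by rw [zpow_one, face_flip_rot]⟩
  -- `D2` and `D1` are the coboundary maps from functions on faces and on vertices to functions on
  -- arcs. The goal is that the range of `D2` is the full orthogonal complement of the range of
  -- `D1`.
  let D2 : (Q → ℝ) →ₗ[ℝ] EuclideanSpace ℝ A :=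
    { toFun := fun f => WithLp.toLp 2 fun a => f (q (a, true)) - f (q (a, false))
      map_add' := fun f g => by ext a; simp; ring
      map_smul' := fun r f => by ext a; simp; ring }
  let D1 : (V → ℝ) →ₗ[ℝ] EuclideanSpace ℝ A :=
    { toFun := fun g => WithLp.toLp 2 fun a => g (G.tgt a) - g (G.src a)
      map_add' := fun f g => by ext a; simp; ring
      map_smul' := fun r f => by ext a; simp; ring }
  have hk2 := card_le_finrank_range D2 (by
    intro f hf i j
    have hf' : ∀ a, f (q (a, true)) - f (q (a, false)) = 0 := fun a => by
      have := congrArg (fun v : EuclideanSpace ℝ A => v a) hf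
      exact this
    induction i using Quotient.inductionOn with | _ d => ?_
    induction j using Quotient.inductionOn with | _ e => ?_
    refine dart_const (G := G) (fun d => f (q d)) (fun d => by simp only [hq]) ?_ d e
    rintro ⟨a, b⟩
    have := hf' a
    cases b <;> simp only [dartFlip_mk, Bool.not_true, Bool.not_false] <;> linarith)
  have hk1 := card_le_finrank_range D1 (by
    intro f hf i j
    have hf' : ∀ a, f (G.tgt a) - f (G.src a) = 0 := fun a => by
      have := congrArg (fun v : EuclideanSpace ℝ A => v a) hf
      exact this
    have := G.connected i j
    induction this with
    | rel x y h =>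
      obtain ⟨a, rfl, rfl⟩ := h
      linarith [hf' a]
    | refl => rfl
    | symm _ _ _ ih => exact ih.symm
    | trans _ _ _ _ _ ih ih' => exact ih.trans ih')
  have horth : LinearMap.range D1 ≤ (LinearMap.range D2)ᗮ := by
    rintro _ ⟨g, rfl⟩
    rw [Submodule.mem_orthogonal]
    rintro _ ⟨f, rfl⟩
    have h1 : inner ℝ (D2 f) (D1 g) =
        ∑ a, (f (q (a, true)) - f (q (a, false))) * (g (G.tgt a) - g (G.src a)) := by
      rw [PiLp.inner_apply]
      refine Finset.sum_congr rfl fun a _ => ?_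
      simp [D1, D2, mul_comm]
    rw [h1]
    -- Reindexing along the face walk `d ↦ dartFlip A (G.rot d)` keeps the face and turns the far
    -- end of one dart into the near end of another.
    have h2 : ∑ d : A × Bool, f (q d) * g (G.vert (dartFlip A d)) =
        ∑ d : A × Bool, f (q d) * g (G.vert d) := by
      rw [← (G.rot.trans (dartFlip A)).sum_comp (fun d => f (q d) * g (G.vert (dartFlip A d)))]
      refine Finset.sum_congr rfl fun d _ => ?_
      simp only [Equiv.trans_apply, hq, dartFlip_dartFlip, vert_rot]
    rw [Fintype.sum_prod_type, Fintype.sum_prod_type] at h2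
    simp only [Fintype.sum_bool, dartFlip_mk, Bool.not_true, Bool.not_false, vert_true,
      vert_false] at h2
    rw [← sub_eq_zero, ← Finset.sum_sub_distrib] at h2
    rw [← h2]
    exact Finset.sum_congr rfl fun a _ => by ring
  have hdim := Submodule.finrank_add_finrank_orthogonal (LinearMap.range D2)
  have hE : Module.finrank ℝ (EuclideanSpace ℝ A) = Fintype.card A := finrank_euclideanSpace
  have heul := G.euler
  rw [Nat.card_eq_fintype_card, Nat.card_eq_fintype_card, Nat.card_eq_fintype_card] at heul
  -- The ranks of `D2` and `D1` are at least the numbers of faces and of vertices, each minus one.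
  -- By Euler's formula these bounds add up to the number of arcs, so the orthogonal ranges fill the
  -- space.
  have heq : LinearMap.range D1 = (LinearMap.range D2)ᗮ := by
    apply Submodule.eq_of_le_of_finrank_le horth
    have : Fintype.card Q = Fintype.card
      (Quotient (Equiv.Perm.SameCycle.setoid (dartFace G.rot))) := Fintype.card_congr (.refl _)
    omega
  have hcm : (WithLp.toLp 2 c : EuclideanSpace ℝ A) ∈ LinearMap.range D2 := by
    rw [← Submodule.orthogonal_orthogonal (LinearMap.range D2), ← heq, Submodule.mem_orthogonal]
    rintro _ ⟨g, rfl⟩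
    rw [PiLp.inner_apply, ← hc g]
    refine Finset.sum_congr rfl fun a _ => ?_
    simp [D1]
  obtain ⟨f, hf⟩ := hcm
  -- Subtracting a constant normalizes the value on the unbounded face to zero without changing
  -- differences.
  refine ⟨fun d => f (q d) - f (q G.outer), fun d => by simp only [hq], fun a => ?_, by simp⟩
  have := congrArg (fun v : EuclideanSpace ℝ A => v a) hf
  simp only [D2, LinearMap.coe_mk, AddHom.coe_mk] at this
  rw [← this]
  ring

end Euler

/-- `φ` is the winding number function of the closed curve which goes along `l` and
back along `m`. -/
structure Pot (G : PlaneDigraph V A) (l m : List A) (φ : A × Bool → ℝ) : Prop where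
  face : ∀ d, φ (dartFlip A (G.rot d)) = φ d
  jump : ∀ a, φ (a, true) - φ (a, false) = chain l m a
  outer : φ G.outer = 0

/-- Both walks telescope to the same end difference, so `chain l m` is orthogonal to all differences
of vertex functions. -/
theorem exists_pot [Finite V] [Finite A] {x y : V} {l m : List A} (hl : G.IsWalk x l y)
    (hm : G.IsWalk x m y) (hln : l.Nodup) (hmn : m.Nodup) : ∃ φ, G.Pot l m φ := by
  obtain ⟨φ, h1, h2, h3⟩ := exists_potential (G := G) (chain l m) (by
    intro _ g
    have e1 := sum_chain_walk g hl hln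
    have e2 := sum_chain_walk g hm hmn
    have e3 : ∀ a, chain l m a = chain l [] a - chain m [] a := by
      intro a; simp [chain]
    simp only [e3, sub_mul, Finset.sum_sub_distrib, e1, e2]
    ring)
  exact ⟨φ, h1, h2, h3⟩

namespace Pot

variable {l m : List A} {φ : A × Bool → ℝ}

theorem jump_left (h : G.Pot l m φ) {a : A} (hl : a ∈ l) (hm : a ∉ m) :
    φ (a, true) = φ (a, false) + 1 := by
  have := h.jump a
  simp only [chain, hl, hm, if_true, if_false] at this
  linarith

theorem jump_right (h : G.Pot l m φ) {a : A} (hl : a ∉ l) (hm : a ∈ m) :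
    φ (a, true) = φ (a, false) - 1 := by
  have := h.jump a
  simp only [chain, hl, hm, if_true, if_false] at this
  linarith

theorem jump_both (h : G.Pot l m φ) {a : A} (hl : a ∈ l) (hm : a ∈ m) :
    φ (a, true) = φ (a, false) := by
  have := h.jump a
  simp only [chain, hl, hm, if_true] at this
  linarith

theorem jump_none (h : G.Pot l m φ) {a : A} (hl : a ∉ l) (hm : a ∉ m) :
    φ (a, true) = φ (a, false) := by
  have := h.jump a
  simp only [chain, hl, hm, if_false] at this
  linarith

theorem flip_none (h : G.Pot l m φ) {d : A × Bool} (hl : d.1 ∉ l) (hm : d.1 ∉ m) :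
    φ (dartFlip A d) = φ d := by
  rcases d with ⟨a, b⟩
  have := h.jump_none hl hm
  cases b
  · exact this
  · exact this.symm

/-- A potential jumps only across arcs of `l` and `m`, and a move inside a region of the complement
of `S` crosses none of them. -/
theorem eq_of_sameRegion (h : G.Pot l m φ) {S : Set A} (hl : ∀ a ∈ l, a ∈ S) (hm : ∀ a ∈ m, a ∈ S)
    {d e : A × Bool} (hde : G.SameRegion S d e) : φ d = φ e := by
  have hf : ∀ d, φ (dartFace G.rot d) = φ d := by
    intro d
    have := h.face (dartFace G.rot d)
    rw [← this]
    simp [dartFace]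
  have key : ∀ (n : ℕ) (d : A × Bool), φ (((dartFace G.rot) ^ n) d) = φ d := by
    intro n
    induction n with
    | zero => intro d; rfl
    | succ n ih =>
      intro d
      rw [pow_succ', Equiv.Perm.mul_apply, hf, ih]
  induction hde with
  | rel d e hde =>
    rcases hde with ⟨i, rfl⟩ | ⟨rfl, hd⟩
    · rcases Int.eq_nat_or_neg i with ⟨n, rfl | rfl⟩
      · rw [zpow_natCast, key]
      · rw [← key n ((dartFace G.rot ^ (-(n : ℤ))) d), zpow_neg, zpow_natCast]
        simp
    · exact (h.flip_none (fun h' => hd (hl _ h')) (fun h' => hd (hm _ h'))).symm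
  | refl => rfl
  | symm _ _ _ ih => exact ih.symm
  | trans _ _ _ _ _ ih ih' => exact ih.trans ih'

theorem eq_zero_of_outside (h : G.Pot l m φ) {S : Set A} (hl : ∀ a ∈ l, a ∈ S)
    (hm : ∀ a ∈ m, a ∈ S) {d : A × Bool} (hd : G.Outside S d) : φ d = 0 :=
  (h.eq_of_sameRegion hl hm hd).trans h.outer

end Pot

/-! Regions -/

theorem SameRegion.refl (S : Set A) (d : A × Bool) : G.SameRegion S d d :=
  Relation.EqvGen.refl d

theorem SameRegion.symm {S : Set A} {d e : A × Bool} (h : G.SameRegion S d e) :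
    G.SameRegion S e d := Relation.EqvGen.symm _ _ h

theorem SameRegion.trans {S : Set A} {d e f : A × Bool} (h : G.SameRegion S d e)
    (h' : G.SameRegion S e f) : G.SameRegion S d f := Relation.EqvGen.trans _ _ _ h h'

theorem sameRegion_face (S : Set A) (d : A × Bool) :
    G.SameRegion S (dartFlip A (G.rot d)) d :=
  Relation.EqvGen.rel _ _ (.inl ⟨1, by rw [zpow_one, face_flip_rot]⟩)

theorem sameRegion_flip {S : Set A} {d : A × Bool} (h : d.1 ∉ S) :
    G.SameRegion S d (dartFlip A d) := Relation.EqvGen.rel _ _ (.inr ⟨rfl, h⟩)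

/-- No arc of `S` is incident with `w`. -/
def Free (G : PlaneDigraph V A) (S : Set A) (w : V) : Prop := ∀ a ∈ S, G.src a ≠ w ∧ G.tgt a ≠ w

theorem Free.notMem {S : Set A} {d : A × Bool} (h : G.Free S (G.vert d)) : d.1 ∉ S := by
  intro hd
  rcases d with ⟨a, _ | _⟩
  · exact (h a hd).2 rfl
  · exact (h a hd).1 rfl

/-- Turning around the vertex crosses only arcs outside `S`. -/
theorem Free.sameRegion {S : Set A} {d e : A × Bool} (h : G.Free S (G.vert d))
    (hde : G.vert e = G.vert d) : G.SameRegion S d e := by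
  have hrot : ∀ e, G.vert e = G.vert d → G.SameRegion S (G.rot e) e := fun e he =>
    (sameRegion_flip (Free.notMem (by rwa [vert_rot, he]))).trans (sameRegion_face S e)
  have key : ∀ (n : ℕ) (e : A × Bool), G.vert e = G.vert d →
      G.SameRegion S ((G.rot ^ n) e) e := by
    intro n
    induction n with
    | zero => intro e _; exact .refl _ _
    | succ n ih =>
      intro e he
      have h1 := ih (G.rot e) (by rw [vert_rot, he])
      rw [← Equiv.Perm.mul_apply, ← pow_succ] at h1
      exact h1.trans (hrot e he)
  obtain ⟨i, hi⟩ := sameCycle_of_vert_eq hde.symm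
  rcases Int.eq_nat_or_neg i with ⟨n, rfl | rfl⟩
  · rw [zpow_natCast] at hi
    rw [← hi]
    exact (key n d rfl).symm
  · have : d = (G.rot ^ n) e := by rw [← hi]; simp
    rw [this]
    exact key n e hde

/-- The faces along a walk which meets `S` only at its ends lie in the same region. -/
theorem IsWalk.sameRegion {S : Set A} {x y : V} {a : A} {M : List A} (h : G.IsWalk x (a :: M) y)
    (ha : a ∉ S) (hM : ∀ e ∈ M, G.Free S (G.src e)) :
    ∀ e ∈ a :: M, ∀ i j, G.SameRegion S (a, i) (e, j) := by
  have flip : ∀ e, e ∉ S → ∀ i j, G.SameRegion S (e, i) (e, j) := by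
    intro e he i j
    cases i <;> cases j
    · exact .refl _ _
    · exact sameRegion_flip (d := (e, false)) he
    · exact sameRegion_flip (d := (e, true)) he
    · exact .refl _ _
  induction M generalizing x a with
  | nil =>
    intro e he i j
    rw [List.mem_singleton.1 he]
    exact flip a ha i j
  | cons b M ih =>
    intro e he i j
    rcases List.mem_cons.1 he with rfl | he
    · exact flip e ha i j
    · have hb := hM b (by simp)
      have hb' : b ∉ S := Free.notMem (d := (b, true)) hb
      refine ((flip a ha i false).trans ?_).trans
        (ih h.2 hb' (fun e he => hM e (by simp [he])) e he true j)
      have hv : G.vert (b, true) = G.vert (a, false) := h.2.1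
      exact (Free.sameRegion (d := (b, true)) hb hv.symm).symm

/-! Vertices of degree three -/

/-- The path arcs `p` and `q` and the dart `d`, on the right, meet in a vertex of
degree three. -/
def RightAt (G : PlaneDigraph V A) (p q : A) (d : A × Bool) : Prop :=
  G.rot (p, false) = d ∧ G.rot d = (q, true) ∧ G.rot (q, true) = (p, false)

/-- The path arcs `p` and `q` and the dart `d`, on the left, meet in a vertex of
degree three. -/
def LeftAt (G : PlaneDigraph V A) (p q : A) (d : A × Bool) : Prop :=
  G.rot (q, true) = d ∧ G.rot d = (p, false) ∧ G.rot (p, false) = (q, true)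

theorem RightAt.not_leftAt {p q : A} {d : A × Bool} (h : G.RightAt p q d) : ¬ G.LeftAt p q d := by
  intro h'
  have h1 : d = (p, false) := h'.1.symm.trans h.2.2
  have h2 : d = (q, true) := h.1.symm.trans h'.2.2
  simpa using h1.symm.trans h2

theorem RightAt.vert_eq {p q : A} {d : A × Bool} (h : G.RightAt p q d) :
    G.vert d = G.tgt p := by
  rw [← h.1, vert_rot]
  rfl

theorem LeftAt.vert_eq {p q : A} {d : A × Bool} (h : G.LeftAt p q d) :
    G.vert d = G.tgt p := by
  rw [← vert_rot, h.2.1]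
  rfl

theorem RightAt.ccw {p q : A} {d : A × Bool} (h : G.RightAt p q d) :
    G.Ccw (p, false) d (q, true) := by
  refine ⟨1, 2, by norm_num, by norm_num, by simpa using h.1, by simp [pow_two, h.1, h.2.1], ?_⟩
  intro k h1 h2
  interval_cases k
  · rw [pow_one, h.1]
    rintro rfl
    have := h.1.symm.trans h.2.1
    simp at this
  · simp [pow_two, h.1, h.2.1]

theorem LeftAt.ccw {p q : A} {d : A × Bool} (h : G.LeftAt p q d) :
    G.Ccw (q, true) d (p, false) := by
  refine ⟨1, 2, by norm_num, by norm_num, by simpa using h.1, by simp [pow_two, h.1, h.2.1], ?_⟩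
  intro k h1 h2
  interval_cases k
  · rw [pow_one, h.1]
    rintro rfl
    have := h.1.symm.trans h.2.1
    simp at this
  · simp [pow_two, h.1, h.2.1]

theorem RightAt.ne_left {p q : A} {d : A × Bool} (h : G.RightAt p q d) : d ≠ (p, false) := by
  rintro rfl
  simpa using h.1.symm.trans h.2.1

theorem RightAt.ne_right {p q : A} {d : A × Bool} (h : G.RightAt p q d) : d ≠ (q, true) := by
  rintro rfl
  simpa using h.2.1.symm.trans h.2.2

theorem LeftAt.ne_left {p q : A} {d : A × Bool} (h : G.LeftAt p q d) : d ≠ (p, false) := by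
  rintro rfl
  simpa using h.2.2.symm.trans h.2.1

theorem LeftAt.ne_right {p q : A} {d : A × Bool} (h : G.LeftAt p q d) : d ≠ (q, true) := by
  rintro rfl
  simpa using h.2.1.symm.trans h.1

/-- The third dart at an inner vertex of a path does not belong to an arc of the path. -/
theorem IsPath.third_notMem {x y : V} {W : List A} (hW : G.IsPath x W y) {p q : A}
    (hpq : [p, q] <:+: W) {d : A × Bool} (hd : G.RightAt p q d ∨ G.LeftAt p q d) : d.1 ∉ W := by
  have hv : G.vert d = G.tgt p := hd.elim RightAt.vert_eq LeftAt.vert_eq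
  have h1 : d ≠ (p, false) := hd.elim RightAt.ne_left LeftAt.ne_left
  have h2 : d ≠ (q, true) := hd.elim RightAt.ne_right LeftAt.ne_right
  rcases d with ⟨a, _ | _⟩
  · intro ha
    obtain rfl : a = p := hW.eq_of_tgt_eq ha (mem_of_infix_left hpq) hv
    exact h1 rfl
  · intro ha
    obtain rfl : a = q := hW.eq_of_src_eq ha (mem_of_infix_right hpq)
      ((show G.src a = G.tgt p from hv).trans (hW.1.src_eq_of_infix hpq).symm)
    exact h2 rfl

section Network

variable {s t : V} (hG : G.IsNetwork s t)
include hG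

/-- The darts at a vertex form one orbit of `rot`, and here the orbit has three elements. -/
theorem IsNetwork.rot_cube [Finite A] {d : A × Bool} (hs : G.vert d ≠ s) (ht : G.vert d ≠ t) :
    G.rot (G.rot (G.rot d)) = d ∧
      ∀ e, G.vert e = G.vert d → e = d ∨ e = G.rot d ∨ e = G.rot (G.rot d) := by
  classical
  have hcard := hG.degree_three _ hs ht
  have := Fintype.ofFinite A
  rw [Nat.card_eq_fintype_card, Fintype.card_subtype] at hcard
  have hmem : ∀ e, e ∈ Finset.univ.filter (fun e => G.vert e = G.vert d) ↔
      G.vert e = G.vert d := by simp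
  -- If `n` rotations fix `d`, the first `n` iterates exhaust the vertex; applied with `n = 1, 2`
  -- this would contradict degree three.
  have hpow : ∀ n : ℕ, 0 < n → (G.rot ^ n) d = d → ∀ e, G.vert e = G.vert d →
      ∃ k < n, e = (G.rot ^ k) d := by
    intro n hn hd e he
    obtain ⟨i, -, hi⟩ := (sameCycle_of_vert_eq he.symm).exists_pow_eq'
    refine ⟨i % n, Nat.mod_lt _ hn, ?_⟩
    have hd' : ∀ m : ℕ, ((G.rot ^ n) ^ m) d = d := by
      intro m
      induction m with
      | zero => rfl
      | succ m ih => rw [pow_succ, Equiv.Perm.mul_apply, hd, ih]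
    rw [← hi]
    conv_lhs => rw [← Nat.mod_add_div i n, pow_add, pow_mul, Equiv.Perm.mul_apply, hd']
  have h1 : G.rot d ≠ d := by
    intro h
    have hsub : Finset.univ.filter (fun e => G.vert e = G.vert d) ⊆ {d} := by
      intro e he
      obtain ⟨k, hk, rfl⟩ := hpow 1 (by norm_num) (by simpa using h) e ((hmem e).1 he)
      interval_cases k
      simp
    have := Finset.card_le_card hsub
    simp at this
    omega
  have h2 : G.rot (G.rot d) ≠ d := by
    intro h
    have hsub : Finset.univ.filter (fun e => G.vert e = G.vert d) ⊆ {d, G.rot d} := by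
      intro e he
      obtain ⟨k, hk, rfl⟩ := hpow 2 (by norm_num) (by simpa [pow_two] using h) e ((hmem e).1 he)
      interval_cases k <;> simp
    have := (Finset.card_le_card hsub).trans Finset.card_le_two
    omega
  have h3 : G.rot (G.rot d) ≠ G.rot d := fun h => h1 (G.rot.injective h)
  have hsub : {d, G.rot d, G.rot (G.rot d)} ⊆
      Finset.univ.filter (fun e => G.vert e = G.vert d) := by
    intro e he
    rw [hmem]
    simp only [Finset.mem_insert, Finset.mem_singleton] at he
    rcases he with rfl | rfl | rfl <;> simp [vert_rot]
  have hc : ({d, G.rot d, G.rot (G.rot d)} : Finset (A × Bool)).card = 3 :=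
    Finset.card_eq_three.2 ⟨_, _, _, h1.symm, h2.symm, h3.symm, rfl⟩
  have heq := Finset.eq_of_subset_of_card_le hsub (by omega)
  have hall : ∀ e, G.vert e = G.vert d → e = d ∨ e = G.rot d ∨ e = G.rot (G.rot d) := by
    intro e he
    have := (hmem e).2 he
    rw [← heq] at this
    simpa using this
  refine ⟨?_, hall⟩
  rcases hall (G.rot (G.rot (G.rot d))) (by simp [vert_rot]) with h | h | h
  · exact h
  · exact absurd (G.rot.injective h) h2
  · exact absurd (G.rot.injective (G.rot.injective h)) h1

variable [Finite A]

theorem IsNetwork.dart_cases {p q : A} (hpq : G.src q = G.tgt p) (hs : G.tgt p ≠ s)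
    (ht : G.tgt p ≠ t) {e : A × Bool} (he : G.vert e = G.tgt p) :
    e = (p, false) ∨ e = (q, true) ∨ G.RightAt p q e ∨ G.LeftAt p q e := by
  obtain ⟨h1, h2⟩ := hG.rot_cube (d := (p, false)) hs ht
  rcases h2 e he with h | h | h
  · exact .inl h
  · rcases h2 (q, true) hpq with h' | h' | h'
    · simp at h'
    · exact .inr (.inl (h.trans h'.symm))
    · refine .inr (.inr (.inl ⟨h.symm, ?_, ?_⟩))
      · rw [h, h']
      · rw [h', h1]
  · rcases h2 (q, true) hpq with h' | h' | h'
    · simp at h'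
    · refine .inr (.inr (.inr ⟨?_, ?_, h'.symm⟩))
      · rw [h, h']
      · rw [h, h1]
    · exact .inr (.inl (h.trans h'.symm))

theorem IsNetwork.exists_third {p q : A} (hpq : G.src q = G.tgt p) (hs : G.tgt p ≠ s)
    (ht : G.tgt p ≠ t) : ∃ d, G.RightAt p q d ∨ G.LeftAt p q d := by
  obtain ⟨h1, h2⟩ := hG.rot_cube (d := (p, false)) hs ht
  rcases h2 (q, true) hpq with h' | h' | h'
  · simp at h'
  · exact ⟨G.rot (q, true), .inr ⟨rfl, by rw [h', h1], h'.symm⟩⟩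
  · exact ⟨G.rot (p, false), .inl ⟨rfl, h'.symm, by rw [h', h1]⟩⟩

/-- The vertex of `p`, `q` has no fourth dart. -/
theorem IsNetwork.third_unique {p q : A} (hpq : G.src q = G.tgt p) (hs : G.tgt p ≠ s)
    (ht : G.tgt p ≠ t) {d e : A × Bool} (hd : G.vert d = G.tgt p) (he : G.vert e = G.tgt p)
    (hdp : d ≠ (p, false)) (hdq : d ≠ (q, true)) (hep : e ≠ (p, false)) (heq : e ≠ (q, true)) :
    d = e := by
  have h1 := (hG.dart_cases hpq hs ht hd).resolve_left hdp |>.resolve_left hdq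
  have h2 := (hG.dart_cases hpq hs ht he).resolve_left hep |>.resolve_left heq
  rcases h1 with h1 | h1 <;> rcases h2 with h2 | h2
  · exact h1.1.symm.trans h2.1
  · have := h1.2.2.symm.trans h2.1
    exact absurd this.symm hep
  · have := h2.2.2.symm.trans h1.1
    exact absurd this.symm hdp
  · exact h1.1.symm.trans h2.1

omit [Finite A] in
theorem IsNetwork.inner_ne {W : List A} (hW : G.IsPath s W t) {p q : A} (hpq : [p, q] <:+: W) :
    G.tgt p ≠ s ∧ G.tgt p ≠ t := by
  refine ⟨hG.source_in p, ?_⟩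
  intro h
  apply hW.end_notMem
  rw [← h, ← hW.1.src_eq_of_infix hpq]
  exact List.mem_map_of_mem (mem_of_infix_right hpq)

/-- Three rotations return to the start, so the exponents in `Ccw` can only be 1 and 2. -/
theorem IsNetwork.rightOf_iff {W : List A} (hW : G.IsPath s W t) {d : A × Bool} :
    G.RightOf W d ↔ ∃ p q, [p, q] <:+: W ∧ G.RightAt p q d := by
  constructor
  · rintro ⟨p, q, hpq, i, j, hi, hij, h1, h2, h3⟩
    refine ⟨p, q, hpq, ?_⟩
    obtain ⟨hs, ht⟩ := hG.inner_ne hW hpq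
    obtain ⟨h4, -⟩ := hG.rot_cube (d := (p, false)) hs ht
    have : j < 3 := by
      by_contra hj
      exact h3 3 (by norm_num) (by omega) (by simpa [pow_succ] using h4)
    obtain rfl : i = 1 := by omega
    obtain rfl : j = 2 := by omega
    rw [pow_one] at h1
    rw [pow_two, Equiv.Perm.mul_apply] at h2
    refine ⟨h1, by rw [← h1, h2], by rw [← h2, h4]⟩
  · rintro ⟨p, q, hpq, h⟩
    exact ⟨p, q, hpq, h.ccw⟩

theorem IsNetwork.leftOf_iff {W : List A} (hW : G.IsPath s W t) {d : A × Bool} :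
    G.LeftOf W d ↔ ∃ p q, [p, q] <:+: W ∧ G.LeftAt p q d := by
  constructor
  · rintro ⟨p, q, hpq, i, j, hi, hij, h1, h2, h3⟩
    refine ⟨p, q, hpq, ?_⟩
    obtain ⟨hs, ht⟩ := hG.inner_ne hW hpq
    have hv := hW.1.src_eq_of_infix hpq
    obtain ⟨h4, -⟩ := hG.rot_cube (d := (q, true)) (by rwa [vert_true, hv])
      (by rwa [vert_true, hv])
    have : j < 3 := by
      by_contra hj
      exact h3 3 (by norm_num) (by omega) (by simpa [pow_succ] using h4)
    obtain rfl : i = 1 := by omega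
    obtain rfl : j = 2 := by omega
    rw [pow_one] at h1
    rw [pow_two, Equiv.Perm.mul_apply] at h2
    refine ⟨h1, by rw [← h1, h2], by rw [← h2, h4]⟩
  · rintro ⟨p, q, hpq, h⟩
    exact ⟨p, q, hpq, h.ccw⟩

theorem IsNetwork.rightAt_of_rightOf {W : List A} (hW : G.IsPath s W t) {d : A × Bool}
    (hd : G.RightOf W d) {p q : A} (hpq : [p, q] <:+: W) (hv : G.vert d = G.tgt p) :
    G.RightAt p q d := by
  obtain ⟨p', q', hpq', h⟩ := (hG.rightOf_iff hW).1 hd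
  obtain ⟨rfl, rfl⟩ := hW.infix_unique hpq hpq' (hv.symm.trans h.vert_eq)
  exact h

theorem IsNetwork.leftAt_of_leftOf {W : List A} (hW : G.IsPath s W t) {d : A × Bool}
    (hd : G.LeftOf W d) {p q : A} (hpq : [p, q] <:+: W) (hv : G.vert d = G.tgt p) :
    G.LeftAt p q d := by
  obtain ⟨p', q', hpq', h⟩ := (hG.leftOf_iff hW).1 hd
  obtain ⟨rfl, rfl⟩ := hW.infix_unique hpq hpq' (hv.symm.trans h.vert_eq)
  exact h

end Network

/-! ### Values of potentials at vertices of degree three and along free walks -/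

namespace Pot

variable {l m : List A} {φ : A × Bool → ℝ}

/-- Three faces meet at the vertex: one on the left shared by `p` and `q`, and two on the right
separated by `d`. -/
theorem rightAt (h : G.Pot l m φ) {p q : A} {d : A × Bool} (hd : G.RightAt p q d) :
    φ (q, true) = φ (p, true) ∧ φ (dartFlip A d) = φ (p, false) ∧ φ d = φ (q, false) := by
  have h1 := h.face (p, false)
  have h2 := h.face d
  have h3 := h.face (q, true)
  rw [hd.1] at h1
  rw [hd.2.1] at h2
  rw [hd.2.2] at h3
  exact ⟨h3.symm, h1, h2.symm⟩

/-- The mirror image: the right face is common to `p` and `q`, and `d` separates the two left faces.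
-/
theorem leftAt (h : G.Pot l m φ) {p q : A} {d : A × Bool} (hd : G.LeftAt p q d) :
    φ (q, false) = φ (p, false) ∧ φ d = φ (p, true) ∧ φ (dartFlip A d) = φ (q, true) := by
  have h1 := h.face (q, true)
  have h2 := h.face d
  have h3 := h.face (p, false)
  rw [hd.1] at h1
  rw [hd.2.1] at h2
  rw [hd.2.2] at h3
  exact ⟨h3, h2.symm, h1⟩

theorem const_vertex (h : G.Pot l m φ) {w : V} (hw : G.Free {b | b ∈ l ∨ b ∈ m} w)
    {d e : A × Bool} (hd : G.vert d = w) (he : G.vert e = w) : φ d = φ e := by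
  subst hd
  exact h.eq_of_sameRegion (fun a ha => .inl ha) (fun a ha => .inr ha) (hw.sameRegion he)

theorem const_walk (h : G.Pot l m φ) {x y : V} {a : A} {M : List A} (hw : G.IsWalk x (a :: M) y)
    (hl : a ∉ l) (hm : a ∉ m) (hM : ∀ e ∈ M, G.Free {b | b ∈ l ∨ b ∈ m} (G.src e)) :
    ∀ e ∈ a :: M, ∀ i j, φ (e, j) = φ (a, i) := by
  intro e he i j
  exact h.eq_of_sameRegion (fun a ha => .inl ha) (fun a ha => .inr ha)
    (hw.sameRegion (S := {b | b ∈ l ∨ b ∈ m}) (fun h' => h'.elim hl hm) hM e he i j).symm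

end Pot

theorem free_of_notMem {x y x' y' w : V} {l m : List A} (hl : G.IsWalk x l y)
    (hm : G.IsWalk x' m y') (hwl : w ∉ G.verts x l) (hwm : w ∉ G.verts x' m) :
    G.Free {b | b ∈ l ∨ b ∈ m} w := by
  rintro a (ha | ha)
  · exact ⟨fun h => hwl (h ▸ hl.src_mem ha), fun h => hwl (h ▸ tgt_mem_verts ha)⟩
  · exact ⟨fun h => hwm (h ▸ hm.src_mem ha), fun h => hwm (h ▸ tgt_mem_verts ha)⟩

/-! ### The unbounded region, the right bank of a path, and directed cycles -/

section Network

variable {s t : V} (hG : G.IsNetwork s t)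
include hG

/-- One dart at the sink borders the unbounded face, and all darts at a free vertex lie in one
region. -/
theorem IsNetwork.outside_of_vert_sink {S : Set A} (ht : G.Free S t) {d : A × Bool}
    (hd : G.vert d = t) : G.Outside S d := by
  obtain ⟨e, he, he'⟩ := hG.sink_outer
  refine SameRegion.trans (Free.sameRegion (d := d) (hd ▸ ht) (he.trans hd.symm)) ?_
  exact Relation.EqvGen.rel _ _ (.inl he')

theorem IsNetwork.outside_of_walk {S : Set A} (ht : G.Free S t) {x : V} {a : A} {M : List A}
    (h : G.IsWalk x (a :: M) t) (ha : a ∉ S) (hM : ∀ e ∈ M, G.Free S (G.src e)) :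
    ∀ e ∈ a :: M, ∀ j, G.Outside S (e, j) := by
  have key := h.sameRegion ha hM
  obtain ⟨L, b, hL, -, hb⟩ := h.exists_concat (by simp)
  intro e he j
  have h1 := key e he true j
  have h2 := key b (by rw [hL]; simp) true false
  exact (h1.symm.trans h2).trans (hG.outside_of_vert_sink ht (d := (b, false)) hb)

theorem IsNetwork.pot_eq_zero_of_walk {l m : List A} {φ : A × Bool → ℝ} (h : G.Pot l m φ)
    (ht : G.Free {b | b ∈ l ∨ b ∈ m} t) {x : V} {a : A} {M : List A}
    (hw : G.IsWalk x (a :: M) t) (hl : a ∉ l) (hm : a ∉ m)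
    (hM : ∀ e ∈ M, G.Free {b | b ∈ l ∨ b ∈ m} (G.src e)) :
    ∀ e ∈ a :: M, ∀ j, φ (e, j) = 0 := fun e he j =>
  h.eq_zero_of_outside (fun _ h => .inl h) (fun _ h => .inr h)
    (hG.outside_of_walk (S := {b | b ∈ l ∨ b ∈ m}) ht hw (fun h' => h'.elim hl hm) hM e he j)

variable [Finite A]

/-- The right bank of an `s,t`-path is connected to the unbounded face. -/
theorem IsNetwork.right_bank {W : List A} (hW : G.IsPath s W t) {S : Set A}
    (hS : ∀ a ∈ S, ¬ G.RightOf W (a, true) ∧ ¬ G.RightOf W (a, false)) (ht : G.Free S t) :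
    (∀ q ∈ W, G.Outside S (q, false)) ∧
      ∀ d, G.RightOf W d → G.Outside S d ∧ G.Outside S (dartFlip A d) := by
  have hS' : ∀ d : A × Bool, G.RightOf W d → d.1 ∉ S := by
    rintro ⟨a, _ | _⟩ hd ha
    · exact (hS a ha).2 hd
    · exact (hS a ha).1 hd
  -- Induction backwards from the sink. At an inner vertex the third dart is either on the left, so
  -- that the right face is shared, or on the right, where by `hS` it may be crossed.
  have key : ∀ M L, W = L ++ M → ∀ q ∈ M, G.Outside S (q, false) := by
    intro M
    induction M with
    | nil => simp
    | cons q M ih =>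
      intro L hL e he
      have ih' := ih (L ++ [q]) (by rw [hL]; simp)
      rcases List.mem_cons.1 he with rfl | he
      · cases M with
        | nil =>
          have := hW.1
          rw [hL] at this
          exact hG.outside_of_vert_sink ht (isWalk_concat.1 this).2
        | cons q' M =>
          have hpq : [e, q'] <:+: W := ⟨L, M, by rw [hL]; simp⟩
          obtain ⟨hs, ht⟩ := hG.inner_ne hW hpq
          obtain ⟨d, hd | hd⟩ := hG.exists_third (hW.1.src_eq_of_infix hpq) hs ht
          · have h1 := sameRegion_face (G := G) S (e, false)
            have h2 := sameRegion_face (G := G) S d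
            rw [hd.1] at h1
            rw [hd.2.1] at h2
            have h3 := sameRegion_flip (G := G) (hS' d ((hG.rightOf_iff hW).2 ⟨_, _, hpq, hd⟩))
            exact ((h1.symm.trans h3.symm).trans h2.symm).trans (ih' q' (by simp))
          · have h1 := sameRegion_face (G := G) S (e, false)
            rw [hd.2.2] at h1
            exact h1.symm.trans (ih' q' (by simp))
      · exact ih' e he
  have h1 : ∀ q ∈ W, G.Outside S (q, false) := key W [] rfl
  refine ⟨h1, fun d hd => ?_⟩
  obtain ⟨p, q, hpq, hd'⟩ := (hG.rightOf_iff hW).1 hd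
  have h2 := sameRegion_face (G := G) S (p, false)
  rw [hd'.1] at h2
  have h3 := h2.trans (h1 p (mem_of_infix_left hpq))
  exact ⟨(sameRegion_flip (hS' d hd)).trans h3, h3⟩

theorem IsNetwork.pot_right_bank {W : List A} (hW : G.IsPath s W t) {l m : List A}
    {φ : A × Bool → ℝ} (h : G.Pot l m φ)
    (hl : ∀ a ∈ l, ¬ G.RightOf W (a, true) ∧ ¬ G.RightOf W (a, false))
    (hm : ∀ a ∈ m, ¬ G.RightOf W (a, true) ∧ ¬ G.RightOf W (a, false))
    (ht : G.Free {b | b ∈ l ∨ b ∈ m} t) :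
    (∀ q ∈ W, φ (q, false) = 0) ∧ ∀ d, G.RightOf W d → φ d = 0 ∧ φ (dartFlip A d) = 0 := by
  have key := hG.right_bank hW (S := {b | b ∈ l ∨ b ∈ m}) (fun a ha => ha.elim (hl a) (hm a)) ht
  have h0 : ∀ d, G.Outside {b | b ∈ l ∨ b ∈ m} d → φ d = 0 := fun d hd =>
    h.eq_zero_of_outside (fun _ h => .inl h) (fun _ h => .inr h) hd
  exact ⟨fun q hq => h0 _ (key.1 q hq), fun d hd => ⟨h0 _ (key.2 d hd).1, h0 _ (key.2 d hd).2⟩⟩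

variable [Finite V]

/-- A directed cycle has the unbounded face on its right. -/
theorem IsNetwork.cycle_pot {x : V} {Z : List A} (hZ : G.IsWalk x Z x) (hne : Z ≠ [])
    (hn : (Z.map G.tgt).Nodup) (ht : t ∉ Z.map G.tgt) :
    ∃ φ, G.Pot Z [] φ ∧ ∀ b ∈ Z, φ (b, true) = 1 ∧ φ (b, false) = 0 := by
  obtain ⟨φ, hφ⟩ := exists_pot (m := []) hZ rfl (hn.of_map _) List.nodup_nil
  refine ⟨φ, hφ, ?_⟩
  have hcyc : G.IsCycle Z := ⟨hne, ⟨x, hZ⟩, hn⟩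
  have hsrc : (Z.map G.src).Nodup := by
    have h1 : G.verts x Z = Z.map G.src ++ [x] := hZ.verts_eq
    have h2 : (x :: Z.map G.tgt).Perm (x :: Z.map G.src) := by
      rw [show x :: Z.map G.tgt = G.verts x Z from rfl, h1]
      exact List.perm_append_singleton _ _
    exact (List.perm_cons _ |>.1 h2).nodup_iff.1 hn
  -- every face is connected to one of the banks
  have hbank : ∃ b ∈ Z, ∃ i, G.Outside {b | b ∈ Z} (b, i) := by
    let f : A × Bool → Prop := fun d => ∃ b ∈ Z, ∃ i, G.SameRegion {b | b ∈ Z} (b, i) d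
    obtain ⟨b, M, rfl⟩ := List.exists_cons_of_ne_nil hne
    have h1 : f (b, true) := ⟨b, by simp, true, .refl _ _⟩
    have h2 : f (b, true) = f G.outer := by
      have hstep : ∀ d, f d → f (dartFlip A d) := by
        intro d ⟨c, hc, i, h⟩
        by_cases hd : d.1 ∈ b :: M
        · exact ⟨d.1, hd, !d.2, .refl _ _⟩
        · exact ⟨c, hc, i, h.trans (sameRegion_flip hd)⟩
      refine dart_const (G := G) f (fun d => ?_) (fun d => ?_) _ _
      · refine propext ⟨?_, ?_⟩
        · rintro ⟨c, hc, i, h⟩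
          exact ⟨c, hc, i, h.trans (sameRegion_face _ _)⟩
        · rintro ⟨c, hc, i, h⟩
          exact ⟨c, hc, i, h.trans (sameRegion_face _ _).symm⟩
      · refine propext ⟨fun h => ?_, hstep d⟩
        have := hstep _ h
        rwa [dartFlip_dartFlip] at this
    rw [h2] at h1
    exact h1
  obtain ⟨b, hb, i, hbi⟩ := hbank
  -- A left side in the unbounded region would make the cycle clockwise.
  have hi : i = false := by
    cases i
    · rfl
    · exact absurd ⟨hcyc, b, hb, hbi⟩ (hG.no_clockwise Z)
  subst hi
  have hb0 : φ (b, false) = 0 :=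
    hφ.eq_zero_of_outside (S := {b | b ∈ Z}) (fun _ h => h) (by simp) hbi
  -- The third arc at a vertex of the cycle is not on the cycle, so the value on the right bank
  -- passes through the vertex.
  have hpair : ∀ p q, [p, q] <:+: Z → φ (p, false) = φ (q, false) := by
    intro p q hpq
    have hv := hZ.src_eq_of_infix hpq
    have htp : G.tgt p ≠ t := fun h => ht (h ▸ List.mem_map_of_mem (mem_of_infix_left hpq))
    obtain ⟨d, hd⟩ := hG.exists_third hv (hG.source_in p) htp
    have hdZ : d.1 ∉ Z := by
      have hvd : G.vert d = G.tgt p := hd.elim RightAt.vert_eq LeftAt.vert_eq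
      have h1 : d ≠ (p, false) := hd.elim RightAt.ne_left LeftAt.ne_left
      have h2 : d ≠ (q, true) := hd.elim RightAt.ne_right LeftAt.ne_right
      rcases d with ⟨a, _ | _⟩
      · intro ha
        obtain rfl : a = p := List.inj_on_of_nodup_map hn ha (mem_of_infix_left hpq) hvd
        exact h1 rfl
      · intro ha
        obtain rfl : a = q := List.inj_on_of_nodup_map hsrc ha (mem_of_infix_right hpq)
          ((show G.src a = G.tgt p from hvd).trans hv.symm)
        exact h2 rfl
    rcases hd with hd | hd
    · have := hφ.rightAt hd
      rw [← this.2.1, ← this.2.2, hφ.flip_none hdZ (by simp)]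
    · exact (hφ.leftAt hd).1.symm
  have hall : ∀ M L a, Z = L ++ a :: M → ∀ e ∈ M, φ (e, false) = φ (a, false) := by
    intro M
    induction M with
    | nil => simp
    | cons c M ih =>
      intro L a hL e he
      have h1 := hpair a c ⟨L, M, by rw [hL]; simp⟩
      rcases List.mem_cons.1 he with rfl | he
      · exact h1.symm
      · rw [ih (L ++ [a]) c (by rw [hL]; simp) e he, h1]
  obtain ⟨c, M, rfl⟩ := List.exists_cons_of_ne_nil hne
  have hc : ∀ e ∈ c :: M, φ (e, false) = φ (c, false) := by
    intro e he
    rcases List.mem_cons.1 he with rfl | he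
    · rfl
    · exact hall M [] c rfl e he
  intro e he
  have h1 : φ (e, false) = 0 := by rw [hc e he, ← hc b hb, hb0]
  exact ⟨by rw [hφ.jump_left he (by simp), h1, zero_add], h1⟩

/-- A path which leaves a path `Y` to the sink on its right cannot return to it earlier. -/
theorem IsNetwork.no_right_return {x j m : V} {Y₁ Y₂ Y₃ R : List A} {p a q : A}
    (hY : G.IsPath x (Y₁ ++ ((Y₂ ++ [p]) ++ q :: Y₃)) t) (h1 : G.IsWalk x Y₁ m)
    (h2 : G.IsWalk m (Y₂ ++ [p]) j) (hR : G.IsPath j (a :: R) m)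
    (hint : ∀ e ∈ R, G.src e ∉ G.verts x (Y₁ ++ ((Y₂ ++ [p]) ++ q :: Y₃)))
    (hright : G.RightAt p q (a, true)) : False := by
  have hY2 := hY.right h1
  have hP := hY2.left h2
  have hY3 := hY2.right h2
  have hpq : [p, q] <:+: Y₁ ++ ((Y₂ ++ [p]) ++ q :: Y₃) := ⟨Y₁ ++ Y₂, Y₃, by simp⟩
  have hRt : ∀ w ∈ R.map G.src, w ∉ G.verts x (Y₁ ++ ((Y₂ ++ [p]) ++ q :: Y₃)) := by
    intro w hw
    obtain ⟨e, he, rfl⟩ := List.mem_map.1 hw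
    exact hint e he
  have hRv : ∀ w ∈ (a :: R).map G.tgt, w ≠ m → w ∉ G.verts x (Y₁ ++ ((Y₂ ++ [p]) ++ q :: Y₃)) := by
    intro w hw hwm
    apply hRt
    have h3 : G.verts (G.tgt a) R = R.map G.src ++ [m] := hR.1.2.verts_eq
    have h4 : w ∈ G.verts (G.tgt a) R := by simpa [verts] using hw
    rw [h3] at h4
    simpa [hwm] using h4
  have hsub : ∀ w ∈ G.verts m (Y₂ ++ [p]), w ∈ G.verts x (Y₁ ++ ((Y₂ ++ [p]) ++ q :: Y₃)) := by
    intro w hw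
    rcases mem_verts.1 hw with rfl | hw
    · rw [verts_append]
      exact List.mem_append_left _ h1.end_mem
    · rw [verts_append, List.map_append]
      exact List.mem_append_right _ (List.mem_append_left _ hw)
  have hsub3 : ∀ w ∈ (q :: Y₃).map G.tgt, w ∈ G.verts x (Y₁ ++ ((Y₂ ++ [p]) ++ q :: Y₃)) := by
    intro w hw
    rw [verts_append, List.map_append]
    exact List.mem_append_right _ (List.mem_append_right _ hw)
  have hdis : ∀ w ∈ (q :: Y₃).map G.tgt, w ∉ G.verts m (Y₂ ++ [p]) := fun w hw hw' =>
    hY2.disjoint hw' hw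
  have htY : t ∈ (q :: Y₃).map G.tgt := by
    obtain ⟨L, b, hL, -, hb⟩ := hY3.1.exists_concat (by simp)
    rw [hL, ← hb]
    simp
  have hoff : ∀ w ∈ (q :: Y₃).map G.tgt, w ∉ ((Y₂ ++ [p]) ++ a :: R).map G.tgt := by
    intro w hw hw'
    rw [List.map_append, List.mem_append] at hw'
    rcases hw' with hw' | hw'
    · exact hdis w hw (mem_verts.2 (.inr hw'))
    · by_cases hwm : w = m
      · exact hdis w hw (hwm ▸ start_mem_verts _ _)
      · exact hRv w hw' hwm (hsub3 w hw)
  -- The path from `m` to `j` and the return `R` form a directed cycle. Since `a` is on the right,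
  -- `p` and `q` share their left face, which has value 1 because `p` is on the cycle. But `q`
  -- begins a walk to the sink that avoids the cycle after `j`, so its value is 0.
  have hZ : G.IsWalk m ((Y₂ ++ [p]) ++ a :: R) m := h2.append hR.1
  have hZv : G.verts m ((Y₂ ++ [p]) ++ a :: R) = m :: ((Y₂ ++ [p]) ++ a :: R).map G.tgt := rfl
  have hm : m ∈ ((Y₂ ++ [p]) ++ a :: R).map G.tgt := by
    obtain ⟨L, b, hL, -, hb⟩ := hZ.exists_concat (by simp)
    rw [hL, ← hb]
    simp
  have hnd : (((Y₂ ++ [p]) ++ a :: R).map G.tgt).Nodup := by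
    rw [List.map_append, List.nodup_append]
    refine ⟨hP.tgt_nodup, hR.tgt_nodup, ?_⟩
    rintro w hw w' hw' rfl
    by_cases hwm : w = m
    · exact hP.start_notMem (hwm ▸ hw)
    · exact hRv w hw' hwm (hsub w (mem_verts.2 (.inr hw)))
  obtain ⟨φ, hφ, hb⟩ := hG.cycle_pot hZ (by simp) hnd (hoff t htY)
  have hfree : ∀ w ∈ (q :: Y₃).map G.tgt,
      G.Free {b | b ∈ (Y₂ ++ [p]) ++ a :: R ∨ b ∈ ([] : List A)} w := by
    intro w hw
    refine free_of_notMem (x' := m) (y' := m) hZ rfl ?_ ?_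
    · rw [hZv, List.mem_cons, not_or]
      exact ⟨fun h => hoff w hw (h ▸ hm), hoff w hw⟩
    · simp only [verts, List.map_nil, List.mem_singleton]
      exact fun h => hoff w hw (h ▸ hm)
  have hq0 := hG.pot_eq_zero_of_walk hφ (hfree t htY) hY3.1 (by
      intro hq
      rcases List.mem_append.1 hq with hq | hq
      · exact (hdis (G.tgt q) (by simp)) (tgt_mem_verts hq)
      · have h5 := hR.eq_of_src_eq hq (by simp) (hY3.1.1.trans hR.1.1.symm)
        exact hright.ne_right (by rw [h5])) (by simp) (by
      intro e he
      apply hfree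
      have h3 : G.verts (G.tgt q) Y₃ = Y₃.map G.src ++ [t] := hY3.1.2.verts_eq
      have h4 : G.src e ∈ G.verts (G.tgt q) Y₃ := by
        rw [h3]
        exact List.mem_append_left _ (List.mem_map_of_mem he)
      simpa [verts] using h4) q (by simp) true
  have h5 := (hφ.rightAt hright).1
  rw [hq0, (hb p (by simp)).1] at h5
  norm_num at h5

end Network

/-- Part of a path may be replaced by a path which avoids the rest. -/
theorem IsPath.reroute {x y j m : V} {Y₁ Y₂ Y₃ N : List A}
    (h : G.IsPath x (Y₁ ++ (Y₂ ++ Y₃)) y) (h1 : G.IsWalk x Y₁ j) (h2 : G.IsWalk j Y₂ m)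
    (hN : G.IsPath j N m) (hjm : j ≠ m)
    (hint : ∀ w ∈ N.map G.tgt, w ∈ G.verts x (Y₁ ++ (Y₂ ++ Y₃)) → w = m) :
    G.IsPath x (Y₁ ++ (N ++ Y₃)) y := by
  have h23 := h.right h1
  have h3 := h23.right h2
  have hm : m ∈ Y₂.map G.tgt := by
    rcases mem_verts.1 h2.end_mem with hm | hm
    · exact absurd hm.symm hjm
    · exact hm
  have hN3 : G.IsPath j (N ++ Y₃) y := by
    refine hN.append h3 ?_
    intro v hv hv'
    have hvm : v ≠ m := by
      rintro rfl
      exact h3.start_notMem hv'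
    rcases mem_verts.1 hv with rfl | hv
    · exact h23.start_notMem (by rw [List.map_append]; exact List.mem_append_right _ hv')
    · refine hvm (hint v hv ?_)
      rw [verts_append, List.map_append]
      exact List.mem_append_right _ (List.mem_append_right _ hv')
  refine (h.left h1).append hN3 ?_
  intro v hv hv'
  rw [List.map_append, List.mem_append] at hv'
  rcases hv' with hv' | hv'
  · have : v = m := hint v hv' (by rw [verts_append]; exact List.mem_append_left _ hv)
    subst this
    exact h.disjoint hv (by rw [List.map_append]; exact List.mem_append_left _ hm)
  · exact h.disjoint hv (by rw [List.map_append]; exact List.mem_append_right _ hv')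

/-- The inner vertices of a path are the starts of its arcs other than the first. -/
theorem IsPath.tgt_cases {x y : V} {a : A} {M : List A} (h : G.IsPath x (a :: M) y) {w : V}
    (hw : w ∈ (a :: M).map G.tgt) : w = y ∨ w ∈ M.map G.src := by
  have h3 : G.verts (G.tgt a) M = M.map G.src ++ [y] := h.1.2.verts_eq
  have h4 : w ∈ G.verts (G.tgt a) M := by simpa [verts] using hw
  rw [h3] at h4
  simpa [or_comm] using h4

theorem verts_subset_append {x w : V} {L M : List A} (h : w ∈ G.verts x L) :
    w ∈ G.verts x (L ++ M) := by
  rw [verts_append]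
  exact List.mem_append_left _ h

/-- The arcs before and after a vertex of the first part of a path. -/
theorem IsWalk.exists_infix_append {s z t w : V} {L X : List A} (hL : G.IsWalk s L z)
    (hX : G.IsWalk z X t) (hne : X ≠ []) (hw : w ∈ G.verts s L) (hws : w ≠ s) :
    ∃ p q, [p, q] <:+: L ++ X ∧ p ∈ L ∧ G.tgt p = w ∧ G.src q = w ∧ (w ≠ z → q ∈ L) ∧
      (w = z → q ∈ X) := by
  by_cases hz : w = z
  · subst hz
    obtain ⟨L', p, rfl, -, hp⟩ := hL.exists_concat (hL.ne_nil hws.symm)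
    obtain ⟨q, X', rfl, hq, -⟩ := hX.exists_cons hne
    exact ⟨p, q, infix_of_split, by simp, hp, hq, fun h => absurd rfl h, fun _ => by simp⟩
  · obtain ⟨p, q, hpq, hp, hq⟩ := hL.exists_infix hw hws hz
    exact ⟨p, q, hpq.trans (List.prefix_append L X).isInfix, mem_of_infix_left hpq, hp, hq, fun _ => mem_of_infix_right hpq,
      fun h => absurd h hz⟩

/-! Strongly connected components -/

theorem IsSCC.reaches {C : Set V} (hC : G.IsSCC C) {x y : V} (hx : x ∈ C) (hy : y ∈ C) :
    G.Reaches x y := by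
  obtain ⟨c, rfl⟩ := hC
  exact hx.2.trans hy.1

theorem IsSCC.mem_of_reaches {C : Set V} (hC : G.IsSCC C) {x y w : V} (hx : x ∈ C) (hy : y ∈ C)
    (h : G.Reaches x w) (h' : G.Reaches w y) : w ∈ C := by
  obtain ⟨c, rfl⟩ := hC
  exact ⟨hx.1.trans h, h'.trans hy.2⟩

/-! ### Jumps to the right of an `s,t`-path -/

section Network

variable {s t : V} (hG : G.IsNetwork s t) [Finite A]
include hG

theorem IsNetwork.ccw_eq_rot {d e f : A × Bool} (hs : G.vert d ≠ s) (ht : G.vert d ≠ t)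
    (h : G.Ccw d e f) : G.rot d = e ∧ G.rot e = f := by
  obtain ⟨i, j, hi, hij, h1, h2, h3⟩ := h
  obtain ⟨h4, -⟩ := hG.rot_cube hs ht
  have : j < 3 := by
    by_contra hj
    exact h3 3 (by norm_num) (by omega) (by simpa [pow_succ] using h4)
  obtain rfl : i = 1 := by omega
  obtain rfl : j = 2 := by omega
  rw [pow_one] at h1
  rw [pow_two, Equiv.Perm.mul_apply, h1] at h2
  exact ⟨h1, h2⟩

variable [Finite V]

/-- A return at an earlier vertex is excluded by `no_right_return`, and a return at the same vertex
by simplicity of the jump. -/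
theorem IsNetwork.pos_lt_of_right_jump {Y : List A} (hY : G.IsPath s Y t) {p q a : A}
    (hpq : [p, q] <:+: Y) (hr : G.RightAt p q (a, true)) {j m : V} {R : List A}
    (hR : G.IsPath j (a :: R) m) (hint : ∀ e ∈ R, G.src e ∉ G.verts s Y)
    (hm : m ∈ G.verts s Y) : G.pos s Y j < G.pos s Y m := by
  have hj : G.tgt p = j := hr.vert_eq.symm.trans hR.1.1
  have hjY : j ∈ G.verts s Y := hj ▸ tgt_mem_verts (mem_of_infix_left hpq)
  by_contra hlt
  rcases Nat.lt_or_ge (G.pos s Y m) (G.pos s Y j) with hlt' | hge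
  · obtain ⟨Y₁, Y₂, Y₃, rfl, h1, h2, h3, hne⟩ := hY.exists_between hm hjY hlt'
    obtain ⟨Y₂, p', rfl, h4, h5⟩ := h2.exists_concat hne
    have hjt : j ≠ t := hj ▸ (hG.inner_ne hY hpq).2
    obtain ⟨q', Y₃, rfl, h6, h7⟩ := h3.exists_cons (h3.ne_nil hjt)
    obtain ⟨rfl, rfl⟩ := hY.infix_unique (p' := p') (q' := q') hpq ⟨Y₁ ++ Y₂, Y₃, by simp⟩
      (hj.trans h5.symm)
    exact hG.no_right_return hY h1 h2 hR hint hr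
  · have : j = m := pos_inj hjY (by omega)
    subst this
    have := hR.eq_nil
    simp at this

/-- A walk that leaves an `s,t`-path on its right and returns to it, returns
at a later vertex. -/
theorem IsNetwork.exists_right_jump {Y : List A} (hY : G.IsPath s Y t) {p q a : A}
    (hpq : [p, q] <:+: Y) (hr : G.RightAt p q (a, true)) {y : V} (hy : y ∈ G.verts s Y)
    (hay : G.Reaches (G.tgt a) y) :
    ∃ R m, G.IsPath (G.src a) (a :: R) m ∧ (∀ e ∈ R, G.src e ∉ G.verts s Y) ∧
      m ∈ G.verts s Y ∧ G.pos s Y (G.src a) < G.pos s Y m ∧ G.Reaches m y := by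
  obtain ⟨L, hL⟩ := hay.exists_path
  obtain ⟨R, R', m, rfl, h1, h2, hm, hint⟩ :=
    hL.1.exists_first (fun w => w ∈ G.verts s Y) ⟨y, hL.1.end_mem, hy⟩
  have hj : G.src a = G.tgt p := hr.vert_eq
  have hjY : G.src a ∈ G.verts s Y := hj ▸ tgt_mem_verts (mem_of_infix_left hpq)
  have hR := hL.left h1
  have haY : a ∉ Y := hY.third_notMem (d := (a, true)) hpq (.inl hr)
  -- If the walk came back to its own start, its last arc would be a fourth dart there unless it
  -- were `p`, and then the walk would have met `Y` before.
  have hjm : G.src a ≠ m := by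
    intro hjm
    have hw : G.IsWalk (G.src a) (a :: R) m := ⟨rfl, h1⟩
    obtain ⟨L', b, hL', -, hb⟩ := hw.exists_concat (by simp)
    have hbp : b = p := by
      by_contra hbp
      have hv := hY.1.src_eq_of_infix hpq
      obtain ⟨hs, ht⟩ := hG.inner_ne hY hpq
      have := hG.third_unique hv hs ht (d := (b, false)) (e := (a, true))
        (by rw [← hj, hjm]; exact hb) hj (by simpa using hbp) (by simp) hr.ne_left hr.ne_right
      simp at this
    have hbR : b ∈ a :: R := by rw [hL']; simp
    have hpY := mem_of_infix_left hpq
    rcases List.mem_cons.1 hbR with rfl | hbR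
    · exact haY (hbp ▸ hpY)
    · exact hint b hbR (hbp ▸ hY.1.src_mem hpY)
  have hpath : G.IsPath (G.src a) (a :: R) m := by
    refine ⟨⟨rfl, h1⟩, ?_⟩
    have : G.verts (G.src a) (a :: R) = G.src a :: G.verts (G.tgt a) R := by simp [verts]
    rw [this, List.nodup_cons]
    refine ⟨?_, hR.2⟩
    rw [h1.verts_eq, List.mem_append, not_or]
    refine ⟨?_, by simpa using hjm⟩
    intro h
    obtain ⟨e, he, he'⟩ := List.mem_map.1 h
    exact hint e he (he' ▸ hjY)
  exact ⟨R, m, hpath, hint, hm, hG.pos_lt_of_right_jump hY hpq hr hpath hint hm, R', h2⟩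

/-- Strong connectivity completes `a` to a directed cycle in `C`, which has value 1 on its left. So
a boundary arc has the unbounded region on its right. -/
theorem IsNetwork.not_outside_left {C : Set V} (hC : G.IsSCC C) (ht : t ∉ C) {a : A}
    (ha : a ∈ G.arcsOf C) : ¬ G.Outside (G.arcsOf C) (a, true) := by
  intro ho
  obtain ⟨T, hT⟩ := (hC.reaches ha.2 ha.1).exists_path
  have hTC : ∀ w ∈ G.verts (G.tgt a) T, w ∈ C := fun w hw =>
    hC.mem_of_reaches ha.2 ha.1 (hT.1.reaches_of_mem hw) (hT.1.reaches_end hw)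
  have hv : (a :: T).map G.tgt = G.verts (G.tgt a) T := rfl
  obtain ⟨φ, hφ, hb⟩ := hG.cycle_pot (x := G.src a) (Z := a :: T) ⟨rfl, hT.1⟩ (by simp)
    (by rw [hv]; exact hT.2) (by rw [hv]; exact fun h => ht (hTC t h))
  have h1 := hφ.eq_zero_of_outside (S := G.arcsOf C) (by
    intro e he
    rcases List.mem_cons.1 he with rfl | he
    · exact ha
    · exact ⟨hTC _ (hT.1.src_mem he), hTC _ (tgt_mem_verts he)⟩) (by simp) ho
  rw [(hb a (by simp)).1] at h1
  norm_num at h1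

end Network

/-- The floor, the ceiling and an exit path of a component of a network. -/
structure Setup (G : PlaneDigraph V A) (s t : V) (C : Set V) (F : List A) (z : V) (X U : List A) :
    Prop where
  net : G.IsNetwork s t
  scc : G.IsSCC C
  inside : G.IsInsideCase C s t
  floor : G.IsLowestFloor s t C F z
  exit : G.IsExitPath C t z X
  ceil : G.IsTopmostCeiling s (F ++ X) U z

/-! ### Floor, ceiling and exit path of a component -/

namespace Setup

variable {s t z : V} {C : Set V} {F X U : List A} (h : G.Setup s t C F z X U)
include h

theorem floor_path : G.IsPath s F z := by
  obtain ⟨y, F₁, X₁, D, -, -, -, -, -, h1, -⟩ := h.floor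
  exact h1

theorem ceil_path : G.IsPath s U z := h.ceil.1.1

theorem exit_path : G.IsPath z X t := h.exit.2.1

theorem exit_mem : z ∈ C := h.exit.1

theorem exit_ne_nil : X ≠ [] := by
  refine h.exit_path.1.ne_nil ?_
  rintro rfl
  exact h.inside.2.1 h.exit_mem

theorem sink_mem : t ∈ X.map G.tgt := by
  obtain ⟨L, b, hL, -, hb⟩ := h.exit_path.1.exists_concat h.exit_ne_nil
  rw [hL, ← hb]
  simp

/-- Such a vertex would belong to the component. This keeps the exit path disjoint from everything
that leads to `z`. -/
theorem not_reaches {w : V} (hw : w ∈ X.map G.tgt) : ¬ G.Reaches w z := by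
  intro hr
  refine h.exit.2.2 w hw (h.scc.mem_of_reaches h.exit_mem h.exit_mem ?_ hr)
  exact h.exit_path.1.reaches_of_mem (mem_verts.2 (.inr hw))

theorem path_append {L : List A} (hL : G.IsPath s L z) : G.IsPath s (L ++ X) t :=
  hL.append h.exit_path fun _ hv hv' => h.not_reaches hv' (hL.1.reaches_end hv)

theorem floor_exit : G.IsPath s (F ++ X) t := h.path_append h.floor_path

theorem ceil_exit : G.IsPath s (U ++ X) t := h.path_append h.ceil_path

theorem mem_of_reaches {L : List A} {w : V} (hw : w ∈ G.verts s (L ++ X))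
    (hr : G.Reaches w z) : w ∈ G.verts s L := by
  rw [verts_append, List.mem_append] at hw
  exact hw.resolve_right fun h' => h.not_reaches h' hr

theorem ne_sink_of_reaches {w : V} (hr : G.Reaches w z) : w ≠ t := by
  rintro rfl
  exact h.not_reaches h.sink_mem hr

theorem floor_reaches {w : V} (hw : w ∈ G.verts s F) : G.Reaches w z :=
  h.floor_path.1.reaches_end hw

theorem ceil_reaches {w : V} (hw : w ∈ G.verts s U) : G.Reaches w z :=
  h.ceil_path.1.reaches_end hw

theorem exit_reaches : G.Reaches z t := ⟨X, h.exit_path.1⟩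

theorem source_ne : s ≠ z := by
  rintro rfl
  exact h.inside.1 h.exit_mem

theorem mem_of_src_eq {L : List A} (hL : G.IsPath s L z) {a : A} (ha : G.src a = s) : a ∈ L := by
  obtain ⟨b, M, rfl, hb, -⟩ := hL.1.exists_cons (hL.1.ne_nil h.source_ne)
  rw [h.net.source_out.unique ha hb]
  simp

theorem exists_turn {L : List A} (hL : G.IsPath s L z) {w : V} (hw : w ∈ G.verts s L)
    (hws : w ≠ s) : ∃ p q, [p, q] <:+: L ++ X ∧ p ∈ L ∧ G.tgt p = w ∧ G.src q = w ∧
      (w ≠ z → q ∈ L) ∧ (w = z → q ∈ X) :=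
  hL.1.exists_infix_append h.exit_path.1 h.exit_ne_nil hw hws

theorem ceil_allowed {a : A} (ha : a ∈ U) :
    ¬ G.RightOf (F ++ X) (a, true) ∧ ¬ G.RightOf (F ++ X) (a, false) := h.ceil.1.2 a ha

variable [Finite A]

theorem floor_exit_allowed {a : A} (ha : a ∈ F ++ X) :
    ¬ G.RightOf (F ++ X) (a, true) ∧ ¬ G.RightOf (F ++ X) (a, false) := by
  refine ⟨fun hr => ?_, fun hr => ?_⟩
  · obtain ⟨p, q, hpq, hd⟩ := (h.net.rightOf_iff h.floor_exit).1 hr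
    exact h.floor_exit.third_notMem hpq (.inl hd) ha
  · obtain ⟨p, q, hpq, hd⟩ := (h.net.rightOf_iff h.floor_exit).1 hr
    exact h.floor_exit.third_notMem hpq (.inl hd) ha

theorem floor_allowed {a : A} (ha : a ∈ F) :
    ¬ G.RightOf (F ++ X) (a, true) ∧ ¬ G.RightOf (F ++ X) (a, false) :=
  h.floor_exit_allowed (List.mem_append_left _ ha)

omit [Finite A] in
theorem free_sink {l m : List A} {x y x' y' : V} (hl : G.IsWalk x l y) (hm : G.IsWalk x' m y')
    (hy : G.Reaches y z) (hy' : G.Reaches y' z) : G.Free {b | b ∈ l ∨ b ∈ m} t :=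
  free_of_notMem hl hm (fun ht => h.ne_sink_of_reaches ((hl.reaches_end ht).trans hy) rfl)
    (fun ht => h.ne_sink_of_reaches ((hm.reaches_end ht).trans hy') rfl)

variable [Finite V]

/-- An arc that leaves the floor on its right leaves the component at an exit, or does not
lead to the sink. -/
theorem exit_of_rightOf {a : A} (hr : G.RightOf (F ++ X) (a, true))
    (hF : G.src a ∈ G.verts s F) (hat : G.Reaches (G.tgt a) t) :
    G.IsExit C t (G.src a) ∧ a ∉ G.arcsOf C := by
  have hW := h.floor_exit
  obtain ⟨p, q, hpq, hR⟩ := (h.net.rightOf_iff hW).1 hr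
  have hv : G.src q = G.tgt p := hW.1.src_eq_of_infix hpq
  have hj : G.src a = G.tgt p := hR.vert_eq
  obtain ⟨hs, ht⟩ := h.net.inner_ne hW hpq
  obtain ⟨y, F₁, X₁, D, hrm, hF₁, hX₁, hFD, hD, hFp, -, -⟩ := h.floor
  have hyD : G.IsWalk y D z := by
    have := hFp.1
    rw [hFD] at this
    exact this.of_append hF₁
  -- On the part common with the right-most path, a jump to the right returns later. Rerouting `F ++
  -- X` along it gives an `s,t`-path that separates from the right-most path to its right, which is
  -- impossible.
  by_cases hcase : G.src a ∈ G.verts s F₁ ∧ G.src a ≠ y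
  · exfalso
    obtain ⟨R, m, hRp, hint, hm, hlt, -⟩ := h.net.exists_right_jump hW hpq hR
      (y := t) hW.1.end_mem hat
    obtain ⟨p', q', hpq', hp', hq'⟩ := hF₁.exists_infix hcase.1 (hj ▸ hs) hcase.2
    have hpq'' : [p', q'] <:+: F ++ X := hpq'.trans ⟨[], D ++ X, by rw [hFD]; simp⟩
    obtain ⟨rfl, rfl⟩ := hW.infix_unique hpq hpq'' (hj.symm.trans hp'.symm)
    obtain ⟨L, M, hLM⟩ := hpq'
    have hWL : F ++ X = (L ++ [p]) ++ (q :: (M ++ (D ++ X))) := by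
      rw [hFD, ← hLM]; simp
    have hWp := hW
    rw [hWL] at hWp hm hlt hint
    obtain ⟨j, hLj, hqj⟩ := isWalk_append.1 hWp.1
    obtain rfl : G.src a = j := by rw [hj]; exact (isWalk_concat.1 hLj).2
    have hm' := (hWp.mem_right_iff hLj hm).2 hlt
    obtain ⟨S₁, S₂, hS, hS₁, hS₂⟩ := hqj.exists_split (mem_verts.2 (.inr hm'))
    rw [hS] at hWp hint
    have hjm : G.src a ≠ m := by
      rintro rfl
      exact lt_irrefl _ hlt
    have hnew := hWp.reroute hLj hS₁ hRp hjm (by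
      intro w hw hw'
      rcases hRp.tgt_cases hw with hw | hw
      · exact hw
      · obtain ⟨e, he, rfl⟩ := List.mem_map.1 hw
        exact absurd hw' (hint e he))
    have hqa : q ≠ a := fun hqa => hR.ne_right (by rw [hqa])
    have hccw := hrm.2 L p q a (M ++ X₁) (R ++ S₂) (by rw [← hLM]; simp) (by simpa using hnew) hqa
    obtain ⟨h1, -⟩ := h.net.ccw_eq_rot (d := (p, false)) hs ht hccw
    exact hR.ne_right (hR.1.symm.trans h1)
  have hjD : G.src a ∈ G.verts y D := by
    rw [hFD, verts_append, List.mem_append] at hF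
    rcases hF with hF | hF
    · have : G.src a = y := by
        by_contra hne
        exact hcase ⟨hF, hne⟩
      rw [this]
      exact start_mem_verts _ _
    · exact mem_verts.2 (.inr hF)
  have hyC : y ∈ C := hX₁.1
  have hjC : G.src a ∈ C := by
    rcases mem_verts.1 hjD with h1 | h1
    · rwa [h1]
    · obtain ⟨e, he, he'⟩ := List.mem_map.1 h1
      rw [← he']
      exact (hD e he).1.2
  -- The start is now on the boundary part `D`. An arc of `C` leaving `z` would jump back to a floor
  -- vertex after `z`; at `y` the third dart is already taken by the exit path `X₁`, which leaves
  -- `C`.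
  have haC : a ∉ G.arcsOf C := by
    intro haC
    by_cases hjz : G.src a = z
    · obtain ⟨R, m, -, -, hm, hlt, hmz⟩ := h.net.exists_right_jump hW hpq hR (y := z)
        (verts_subset_append h.floor_path.1.end_mem) (h.scc.reaches haC.2 h.exit_mem)
      have hmF := h.mem_of_reaches hm hmz
      have := (hW.mem_left_iff h.floor_path.1).1 hmF
      rw [hjz] at hlt
      omega
    by_cases hjy : G.src a = y
    · obtain ⟨q', D', rfl, hq', -⟩ := hyD.exists_cons (hyD.ne_nil (by rw [← hjy]; exact hjz))
      have hqq : q = q' := hW.eq_of_src_eq (mem_of_infix_right hpq) (by rw [hFD]; simp)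
        (by rw [hv, ← hj, hjy, hq'])
      have hX₁ne : X₁ ≠ [] := hX₁.2.1.1.ne_nil (by
        rintro rfl
        exact h.inside.2.1 hyC)
      obtain ⟨x₁, X₁', rfl, hx₁, -⟩ := hX₁.2.1.1.exists_cons hX₁ne
      have hx₁C : G.tgt x₁ ∉ C := hX₁.2.2 _ (by simp)
      have := h.net.third_unique hv hs ht (d := (x₁, true)) (e := (a, true))
        (by rw [← hj, hjy]; exact hx₁) hj (by simp) (by
          intro he
          simp only [Prod.mk.injEq, and_true] at he
          rw [he, hqq] at hx₁C
          exact hx₁C (hD q' (by simp)).1.2) hR.ne_left hR.ne_right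
      simp only [Prod.mk.injEq, and_true] at this
      exact hx₁C (this ▸ haC.2)
    · obtain ⟨p', q', hpq', hp', hq'⟩ := hyD.exists_infix hjD hjy hjz
      have hpq'' : [p', q'] <:+: F ++ X := hpq'.trans ⟨F₁, X, by rw [hFD]⟩
      obtain ⟨rfl, rfl⟩ := hW.infix_unique hpq hpq'' (hj.symm.trans hp'.symm)
      have hqD := hD q (mem_of_infix_right hpq')
      -- The face on the right of the boundary arc `q` is the face on the left of `a`, and an arc of
      -- `C` cannot have the unbounded region there.
      have hqo : G.Outside (G.arcsOf C) (q, false) :=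
        hqD.2.resolve_left (h.net.not_outside_left h.scc h.inside.2.1 hqD.1)
      have hface := sameRegion_face (G := G) (G.arcsOf C) (a, true)
      rw [hR.2.1] at hface
      exact h.net.not_outside_left h.scc h.inside.2.1 haC (hface.symm.trans hqo)
  refine ⟨?_, haC⟩
  have hta : G.tgt a ∉ C := fun hta => haC ⟨hjC, hta⟩
  obtain ⟨T, hT⟩ := hat.exists_path
  have hTC : ∀ w ∈ G.verts (G.tgt a) T, w ∉ C := fun w hw hwC =>
    hta (h.scc.mem_of_reaches hjC hwC (reaches_of_arc a) (hT.1.reaches_of_mem hw))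
  refine ⟨a :: T, hjC, ⟨⟨rfl, hT.1⟩, ?_⟩, hTC⟩
  have : G.verts (G.src a) (a :: T) = G.src a :: G.verts (G.tgt a) T := by simp [verts]
  rw [this, List.nodup_cons]
  exact ⟨fun hw => hTC _ hw hjC, hT.2⟩

/-- Reaching `z` would put the head of `a` back into the component, although `a` leaves it. -/
theorem not_reaches_of_rightOf {a : A} (hr : G.RightOf (F ++ X) (a, true))
    (hF : G.src a ∈ G.verts s F) : ¬ G.Reaches (G.tgt a) z := by
  intro haz
  obtain ⟨⟨X', hX'⟩, ha⟩ := h.exit_of_rightOf hr hF (haz.trans h.exit_reaches)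
  exact ha ⟨hX'.1, h.scc.mem_of_reaches hX'.1 h.exit_mem (reaches_of_arc a) haz⟩

end Setup

theorem IsWalk.src_mem_tgt {x y : V} {a : A} {M : List A} (h : G.IsWalk x (a :: M) y) {e : A}
    (he : e ∈ M) : G.src e ∈ (a :: M).map G.tgt := by
  have := h.2.src_mem he
  simpa [verts] using this

theorem IsPath.last_mem {x w : V} {L : List A} (h : G.IsPath x L w) (hw : w ≠ x) {y : V}
    {L' : List A} (h' : G.IsPath x (L ++ L') y) {p : A} (hp : p ∈ L ++ L') (hpw : G.tgt p = w) :
    p ∈ L := by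
  obtain ⟨M, b, rfl, -, hb⟩ := h.1.exists_concat (h.1.ne_nil hw.symm)
  rw [h'.eq_of_tgt_eq hp (b := b) (by simp) (hpw.trans hb.symm)]
  simp

/-- The winding number function of the closed curve formed by floor and ceiling, with its values
along the two paths. -/
structure StripPot (G : PlaneDigraph V A) (F X U : List A) (ψ : A × Bool → ℝ) : Prop where
  pot : G.Pot F U ψ
  right : ∀ d, G.RightOf (F ++ X) d → ψ d = 0 ∧ ψ (dartFlip A d) = 0
  floor_left : ∀ b ∈ F, b ∉ U → ψ (b, true) = 1
  ceil_left : ∀ b ∈ U, ψ (b, true) = 0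
  ceil_right : ∀ b ∈ U, b ∉ F → ψ (b, false) = 1

/-! ### The potential of the primary strip and the common order of floor and ceiling -/

namespace Setup

variable {s t z : V} {C : Set V} {F X U : List A} (h : G.Setup s t C F z X U)
variable [Finite A] [Finite V]
include h

omit [Finite V] in
theorem floor_third {w : V} {p q : A}
    (hpq : [p, q] <:+: F ++ X) (hp : G.tgt p = w) {d : A × Bool} (hd : G.vert d = w)
    (hdp : d ≠ (p, false)) (hdq : d ≠ (q, true)) (hr : ¬ G.RightOf (F ++ X) d) :
    G.LeftAt p q d := by
  obtain ⟨hs, ht⟩ := h.net.inner_ne h.floor_exit hpq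
  have := (h.net.dart_cases (h.floor_exit.1.src_eq_of_infix hpq) hs ht (hd.trans hp.symm))
  rcases this with h1 | h1 | h1 | h1
  · exact absurd h1 hdp
  · exact absurd h1 hdq
  · exact absurd ((h.net.rightOf_iff h.floor_exit).2 ⟨p, q, hpq, h1⟩) hr
  · exact h1

/-- The right bank of the floor has value 0 because the ceiling uses no arc on that side. The left
bank of the ceiling is connected to it, starting from the arc at `s` which both paths share. The
remaining values follow from the jumps. -/
theorem exists_stripPot : ∃ ψ, G.StripPot F X U ψ := by
  obtain ⟨ψ, hψ⟩ := exists_pot h.floor_path.1 h.ceil_path.1 h.floor_path.nodup h.ceil_path.nodup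
  have hb := h.net.pot_right_bank h.floor_exit hψ (fun a ha => h.floor_allowed ha)
    (fun a ha => h.ceil_allowed ha)
    (h.free_sink h.floor_path.1 h.ceil_path.1 (.refl z) (.refl z))
  have hbank : ∀ q ∈ F, ψ (q, false) = 0 := fun q hq => hb.1 q (List.mem_append_left _ hq)
  have hFU : ∀ b ∈ F, b ∈ U → ψ (b, true) = 0 := fun b hF hU => by
    rw [hψ.jump_both hF hU, hbank b hF]
  -- Induction along the ceiling. Where it leaves the floor it goes to the left and its previous arc
  -- is the floor arc, so both have the same left face; off the floor, the third arc at the vertex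
  -- carries no jump.
  have key : ∀ L b M, U = L ++ b :: M → ψ (b, true) = 0 := by
    intro L
    induction L using List.reverseRecOn with
    | nil =>
      intro b M hU
      have hbs : G.src b = s := by
        have := h.ceil_path.1
        rw [hU] at this
        exact this.1
      exact hFU b (h.mem_of_src_eq h.floor_path hbs) (by rw [hU]; simp)
    | append_singleton L p ih =>
      intro b M hU
      have hp0 := ih p (b :: M) (by rw [hU]; simp)
      by_cases hbF : b ∈ F
      · exact hFU b hbF (by rw [hU]; simp)
      have hpb : [p, b] <:+: U := by rw [hU]; exact infix_of_split
      have hpb' : [p, b] <:+: U ++ X := hpb.trans (List.prefix_append _ _).isInfix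
      have hv := h.ceil_path.1.src_eq_of_infix hpb
      obtain ⟨hs, ht⟩ := h.net.inner_ne h.ceil_exit hpb'
      by_cases hw : G.tgt p ∈ G.verts s F
      · obtain ⟨p', q', hpq', hp', htp', hsq', hq', -⟩ := h.exists_turn h.floor_path hw hs
        have hwz : G.tgt p ≠ z := by
          intro hwz
          apply h.ceil_path.end_notMem
          rw [← hwz, ← hv]
          exact List.mem_map_of_mem (mem_of_infix_right hpb)
        have hbq : (b, true) ≠ (q', true) := by
          rintro hbq
          simp only [Prod.mk.injEq, and_true] at hbq
          exact hbF (hbq ▸ hq' hwz)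
        have hl := h.floor_third hpq' htp' (d := (b, true)) hv (by simp) hbq
          (h.ceil_allowed (mem_of_infix_right hpb)).1
        have hpp : p = p' := by
          by_contra hne
          have := h.net.third_unique (p := p') (q := q') (by rw [hsq', htp']) (htp' ▸ hs)
            (htp' ▸ ht) (d := (p, false)) (e := (b, true)) htp'.symm (hv.trans htp'.symm)
            (by simpa using hne) (by simp) (by simp) hbq
          simp at this
        subst hpp
        rw [(hψ.leftAt hl).2.1, hp0]
      · obtain ⟨d, hd⟩ := h.net.exists_third hv hs ht
        have hdU : d.1 ∉ U := fun hd' =>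
          h.ceil_exit.third_notMem hpb' hd (List.mem_append_left _ hd')
        have hdF : d.1 ∉ F := by
          intro hdF
          have hvd : G.vert d = G.tgt p := hd.elim RightAt.vert_eq LeftAt.vert_eq
          apply hw
          rw [← hvd]
          rcases d with ⟨a, _ | _⟩
          · exact tgt_mem_verts hdF
          · exact h.floor_path.1.src_mem hdF
        rcases hd with hd | hd
        · rw [(hψ.rightAt hd).1, hp0]
        · have := hψ.leftAt hd
          rw [← this.2.2, hψ.flip_none hdF hdU, this.2.1, hp0]
  have hUl : ∀ b ∈ U, ψ (b, true) = 0 := by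
    intro b hb
    obtain ⟨L, M, hLM⟩ := List.append_of_mem hb
    exact key L b M hLM
  refine ⟨ψ, hψ, hb.2, fun b hF hU => ?_, hUl, fun b hU hF => ?_⟩
  · rw [hψ.jump_left hF hU, hbank b hF, zero_add]
  · have := hψ.jump_right hF hU
    rw [hUl b hU] at this
    linarith

/-- The ceiling does not return to the floor before the vertex where it left it. -/
theorem pos_lt_of_jump {U₁ U₃ N : List A} {b₀ : A} {a b : V}
    (hU : U = U₁ ++ ((b₀ :: N) ++ U₃)) (h1 : G.IsWalk s U₁ a) (h2 : G.IsWalk a (b₀ :: N) b)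
    (haF : a ∈ G.verts s F) (hbF : b ∈ G.verts s F) (hint : ∀ e ∈ N, G.src e ∉ G.verts s F) :
    G.pos s F a < G.pos s F b := by
  by_contra hlt
  have hUp := h.ceil_path
  rw [hU] at hUp
  have hN := (hUp.right h1).left h2
  have hab : a ≠ b := by
    rintro rfl
    simpa using hN.eq_nil
  have hlt' : G.pos s F b < G.pos s F a := by
    rcases lt_or_eq_of_le (not_lt.1 hlt) with h' | h'
    · exact h'
    · exact absurd (pos_inj hbF h').symm hab
  have hb₀U : b₀ ∈ U := by rw [hU]; simp
  have hb₀s : G.src b₀ = a := h2.1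
  have hb₀F : b₀ ∉ F := by
    intro hb₀F
    have hpos := h.floor_path.pos_tgt hb₀F
    cases N with
    | nil =>
      have : G.tgt b₀ = b := h2.2
      rw [this, hb₀s] at hpos
      omega
    | cons c N =>
      apply hint c (by simp)
      rw [show G.src c = G.tgt b₀ from h2.2.1]
      exact tgt_mem_verts hb₀F
  have has : a ≠ s := by
    rintro rfl
    exact hb₀F (h.mem_of_src_eq h.floor_path hb₀s)
  have haz : a ≠ z := by
    rintro rfl
    apply h.ceil_path.end_notMem
    rw [← hb₀s]
    exact List.mem_map_of_mem hb₀U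
  obtain ⟨Fa, Fb, hFab, hFa, hFb⟩ := h.floor_path.1.exists_split haF
  have hFp := h.floor_path
  rw [hFab] at hFp
  have hFap := hFp.left hFa
  have hbFa : b ∈ G.verts s Fa := by
    rw [hFp.mem_left_iff hFa, ← hFab]
    omega
  have hFaF : ∀ e ∈ Fa, e ∈ F := fun e he => by rw [hFab]; exact List.mem_append_left _ he
  have hU₁U : ∀ e ∈ U₁, e ∈ U := fun e he => by rw [hU]; exact List.mem_append_left _ he
  have haz' : G.Reaches a z := h.floor_reaches haF
  -- Floor and ceiling are compared up to `a`. They share their last arc, so the jump begins with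
  -- value 0. At the earlier vertex `b` it would arrive on the left of a floor arc not on `U₁`,
  -- where the value is 1, without crossing the curve.
  obtain ⟨φ, hφ⟩ := exists_pot hFa h1 hFap.nodup (hUp.left h1).nodup
  obtain ⟨hbank, -⟩ := h.net.pot_right_bank h.floor_exit hφ
    (fun e he => h.floor_allowed (hFaF e he)) (fun e he => h.ceil_allowed (hU₁U e he))
    (h.free_sink hFa h1 haz' haz')
  have hsrcN : ∀ e ∈ N, G.src e ∉ G.verts s U₁ := by
    intro e he he'
    refine hUp.disjoint he' ?_
    rw [List.map_append]
    exact List.mem_append_left _ (h2.src_mem_tgt he)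
  -- the beginning of the jump
  have h0 : φ (b₀, true) = 0 := by
    obtain ⟨p, q, hpq, hpF, hp, hq, hqF, -⟩ := h.exists_turn h.floor_path haF has
    have hbq : (b₀, true) ≠ (q, true) := by
      rintro hbq
      simp only [Prod.mk.injEq, and_true] at hbq
      exact hb₀F (hbq ▸ hqF haz)
    have hl := h.floor_third hpq hp (d := (b₀, true)) hb₀s (by simp) hbq
      (h.ceil_allowed hb₀U).1
    obtain ⟨U₁', c, hc', -, hc⟩ := h1.exists_concat (h1.ne_nil has.symm)
    have hcp : c = p := by
      by_contra hne
      obtain ⟨hs, ht⟩ := h.net.inner_ne h.floor_exit hpq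
      have := h.net.third_unique (p := p) (q := q) (by rw [hq, hp]) hs ht
        (d := (c, false)) (e := (b₀, true)) (hc.trans hp.symm) (hb₀s.trans hp.symm)
        (by simpa using hne) (by simp) (by simp) hbq
      simp at this
    have hpFa : p ∈ Fa := hFap.last_mem has hFp (by rw [← hFab]; exact hpF) hp
    rw [(hφ.leftAt hl).2.1, hφ.jump_both hpFa (by rw [← hcp, hc']; simp),
      hbank p (List.mem_append_left _ hpF)]
  -- its end
  obtain ⟨N', β, hβ, -, hβb⟩ := h2.exists_concat (by simp)
  have hβN : β ∈ b₀ :: N := by rw [hβ]; simp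
  have hβU : β ∈ U := by rw [hU]; exact List.mem_append_right _ (List.mem_append_left _ hβN)
  have hbs : b ≠ s := hβb ▸ h.net.source_in β
  have hbz : b ≠ z := by
    rintro rfl
    have := h.floor_path.pos_end
    have := pos_le_length haF
    omega
  have h1' : φ (β, false) = 1 := by
    obtain ⟨p, q, hpq, hpF, hp, hq, hqF, -⟩ := h.exists_turn h.floor_path hbF hbs
    have hβF : β ∉ F := by
      rcases List.mem_cons.1 hβN with hβ | hβ
      · rwa [hβ]
      · exact fun hβF => hint β hβ (h.floor_path.1.src_mem hβF)
    have hl := h.floor_third hpq hp (d := (β, false)) hβb (by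
        intro he
        simp only [Prod.mk.injEq, and_true] at he
        exact hβF (he ▸ hpF)) (by simp) (h.ceil_allowed hβU).2
    have hpFa : p ∈ Fa := by
      rcases mem_verts.1 hbFa with hb | hb
      · exact absurd hb hbs
      · obtain ⟨e, he, heb⟩ := List.mem_map.1 hb
        rw [← h.floor_path.eq_of_tgt_eq (hFaF e he) hpF (heb.trans hp.symm)]
        exact he
    have hpU₁ : p ∉ U₁ := by
      intro hpU
      refine hUp.disjoint (tgt_mem_verts hpU) ?_
      rw [hp, ← hβb, List.map_append]
      exact List.mem_append_left _ (List.mem_map_of_mem hβN)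
    rw [(hφ.leftAt hl).2.1, hφ.jump_left hpFa hpU₁, hbank p (List.mem_append_left _ hpF), zero_add]
  have hconst := hφ.const_walk h2 (fun h' => hb₀F (hFaF _ h')) (fun h' => by
      have := hUp.nodup
      rw [List.nodup_append] at this
      exact this.2.2 _ h' b₀ (by simp) rfl) (fun e he =>
        free_of_notMem hFa h1 (fun h' => hint e he (by rw [hFab]; exact verts_subset_append h'))
          (hsrcN e he)) β hβN true false
  rw [h0, h1'] at hconst
  norm_num at hconst

/-- The common vertices of floor and ceiling have the same order on both. -/
theorem floor_pos_lt {a b : V} (haU : a ∈ G.verts s U) (hbU : b ∈ G.verts s U)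
    (haF : a ∈ G.verts s F) (hbF : b ∈ G.verts s F) (hab : G.pos s U a < G.pos s U b) :
    G.pos s F a < G.pos s F b := by
  obtain ⟨U₁, U₂, U₃, hU, h1, h2, -, hne⟩ := h.ceil_path.exists_between haU hbU hab
  clear hab
  induction hn : U₂.length using Nat.strong_induction_on generalizing U₁ U₂ a with
  | _ n ih =>
    obtain ⟨b₀, M, rfl, hb₀, hM⟩ := h2.exists_cons hne
    obtain ⟨M₁, M₂, m, rfl, h3, h4, hm, hint⟩ :=
      hM.exists_first (fun w => w ∈ G.verts s F) ⟨b, hM.end_mem, hbF⟩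
    have hlt := h.pos_lt_of_jump (U₃ := M₂ ++ U₃) (by rw [hU]; simp) h1
      (show G.IsWalk a (b₀ :: M₁) m from ⟨hb₀, h3⟩) haF hm hint
    by_cases hM₂ : M₂ = []
    · subst hM₂
      rwa [show m = b from h4] at hlt
    · refine hlt.trans (ih M₂.length ?_ ?_ hm (U₁ ++ b₀ :: M₁) M₂ (by rw [hU]; simp)
        (h1.append ⟨hb₀, h3⟩) h4 hM₂ rfl)
      · rw [← hn]
        simp
      · have : G.IsWalk s ((U₁ ++ b₀ :: M₁) ++ (M₂ ++ U₃)) z := by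
          have := h.ceil_path.1
          rw [hU] at this
          simpa using this
        rw [hU, show U₁ ++ (b₀ :: (M₁ ++ M₂) ++ U₃) = (U₁ ++ b₀ :: M₁) ++ (M₂ ++ U₃) by simp]
        exact verts_subset_append (IsWalk.end_mem (h1.append ⟨hb₀, h3⟩))

theorem pos_lt_iff {a b : V} (haU : a ∈ G.verts s U) (hbU : b ∈ G.verts s U)
    (haF : a ∈ G.verts s F) (hbF : b ∈ G.verts s F) :
    G.pos s U a < G.pos s U b ↔ G.pos s F a < G.pos s F b := by
  refine ⟨h.floor_pos_lt haU hbU haF hbF, fun hlt => ?_⟩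
  by_contra hge
  rcases lt_or_eq_of_le (not_lt.1 hge) with h' | h'
  · have := h.floor_pos_lt hbU haU hbF haF h'
    omega
  · have := pos_inj hbU h'
    subst this
    omega

/-- A path that leaves the ceiling and returns to it from the left, returns at
an earlier vertex. -/
theorem pos_lt_of_left_jump {j m : V} {a b : A} {N : List A} (hj : j ∈ G.verts s U)
    (hm : m ∈ G.verts s U) (hN : G.IsPath j (a :: N) m)
    (hint : ∀ e ∈ N, G.src e ∉ G.verts s U) (hb : b ∈ a :: N) (hbm : G.tgt b = m) {p q : A}
    (hpq : [p, q] <:+: U ++ X) (hl : G.LeftAt p q (b, false)) :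
    G.pos s U m < G.pos s U j := by
  obtain ⟨ψ, hψ⟩ := h.exists_stripPot
  have hpm : G.tgt p = m := hl.vert_eq.symm.trans hbm
  have hmz := h.ceil_reaches hm
  have hpU : p ∈ U := by
    rcases List.mem_append.1 (mem_of_infix_left hpq) with hp | hp
    · exact hp
    · exact absurd hmz (h.not_reaches (hpm ▸ List.mem_map_of_mem hp))
  have hbUX : b ∉ U ++ X := h.ceil_exit.third_notMem (d := (b, false)) hpq (.inr hl)
  have hbU : b ∉ U := fun h' => hbUX (List.mem_append_left _ h')
  have hreach : ∀ e ∈ a :: N, G.Reaches (G.tgt e) z := fun e he =>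
    (hN.1.reaches_end (tgt_mem_verts he)).trans hmz
  have hlast : ∀ e ∈ a :: N, G.tgt e = m → e = b := fun e he hem =>
    hN.eq_of_tgt_eq he hb (hem.trans hbm.symm)
  have hbF : b ∉ F := by
    intro hbF
    have hmF : m ∈ G.verts s F := hbm ▸ tgt_mem_verts hbF
    have hms : m ≠ s := hbm ▸ h.net.source_in b
    obtain ⟨p', q', hpq', hp'F, hp', hq', -⟩ := h.exists_turn h.floor_path hmF hms
    have : p' = b := h.floor_path.eq_of_tgt_eq hp'F hbF (hp'.trans hbm.symm)
    subst this
    have hl' := h.floor_third hpq' hp' (d := (p, false)) hpm (by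
      intro he
      simp only [Prod.mk.injEq, and_true] at he
      exact hbU (he ▸ hpU)) (by simp) (h.ceil_allowed hpU).2
    have := hl'.2.1.symm.trans hl.2.2
    simp at this
  have hb0 : ψ (b, true) = 0 := by
    rw [hψ.pot.jump_none hbF hbU, (hψ.pot.leftAt hl).2.1, hψ.ceil_left p hpU]
  -- Traced back from its end, the jump keeps the value 0. It cannot meet the floor on the way:
  -- leaving it to the right does not lead to `z`, and leaving it to the left starts with value 1.
  have key : ∀ M e L, a :: N = L ++ e :: M →
      (e ∉ F ∧ e ∉ U ∧ ψ (e, true) = 0) ∧ ∀ e' ∈ M, G.src e' ∉ G.verts s F := by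
    intro M
    induction M with
    | nil =>
      intro e L hL
      have heb : e = b := by
        refine hlast e (by rw [hL]; simp) ?_
        have := hN.1
        rw [hL] at this
        exact (isWalk_concat.1 this).2
      subst heb
      exact ⟨⟨hbF, hbU, hb0⟩, by simp⟩
    | cons e' M ih =>
      intro e L hL
      obtain ⟨⟨h1, h2, h3⟩, h4⟩ := ih e' (L ++ [e]) (by rw [hL]; simp)
      have hee : [e, e'] <:+: a :: N := ⟨L, M, by rw [hL]; simp⟩
      have hv := hN.1.src_eq_of_infix hee
      have he'N : e' ∈ N := by
        cases L with
        | nil =>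
          simp only [List.nil_append, List.cons.injEq] at hL
          rw [hL.2]
          simp
        | cons c L =>
          simp only [List.cons_append, List.cons.injEq] at hL
          rw [hL.2]
          simp
      have hwU := hint e' he'N
      have hwF : G.src e' ∉ G.verts s F := by
        intro hwF
        have hws : G.src e' ≠ s := hv ▸ h.net.source_in e
        have hwz : G.src e' ≠ z := fun hwz => hwU (hwz ▸ h.ceil_path.1.end_mem)
        obtain ⟨p', q', hpq', hp'F, hp', hq', hq'F, -⟩ := h.exists_turn h.floor_path hwF hws
        have hl' := h.floor_third hpq' hp' (d := (e', true)) rfl (by simp) (by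
          intro he
          simp only [Prod.mk.injEq, and_true] at he
          exact h1 (he ▸ hq'F hwz)) (fun hr =>
            h.not_reaches_of_rightOf hr hwF (hreach e' (by simp [he'N])))
        have := (hψ.pot.leftAt hl').2.1
        rw [h3, hψ.floor_left p' hp'F (fun h' => hwU (hp' ▸ tgt_mem_verts h'))] at this
        norm_num at this
      have heF : e ∉ F := fun h' => hwF (hv ▸ tgt_mem_verts h')
      have heU : e ∉ U := fun h' => hwU (hv ▸ tgt_mem_verts h')
      refine ⟨⟨heF, heU, ?_⟩, ?_⟩
      · rw [hψ.pot.jump_none heF heU, ← h3]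
        exact hψ.pot.const_vertex (free_of_notMem h.floor_path.1 h.ceil_path.1 hwF hwU) hv.symm rfl
      · intro f hf
        rcases List.mem_cons.1 hf with rfl | hf
        · exact hwF
        · exact h4 f hf
  obtain ⟨⟨haF, haU, ha0⟩, hNF⟩ := key N a [] rfl
  have has : G.src a = j := hN.1.1
  by_contra hlt
  have hjm : j ≠ m := by
    rintro rfl
    simpa using hN.eq_nil
  have hlt' : G.pos s U j < G.pos s U m := by
    rcases lt_or_eq_of_le (not_lt.1 hlt) with h' | h'
    · exact h'
    · exact absurd (pos_inj hj h') hjm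
  obtain ⟨U₁, U₂, U₃, hU, h1, h2, h3, hne⟩ := h.ceil_path.exists_between hj hm hlt'
  have hjs : j ≠ s := by
    rintro rfl
    exact haF (h.mem_of_src_eq h.floor_path has)
  obtain ⟨U₁, p₁, rfl, h4, h5⟩ := h1.exists_concat (h1.ne_nil hjs.symm)
  obtain ⟨q₁, U₂, rfl, h6, h7⟩ := h2.exists_cons hne
  have hpqU : [p₁, q₁] <:+: U := ⟨U₁, U₂ ++ U₃, by rw [hU]; simp⟩
  have hpq₁ : [p₁, q₁] <:+: U ++ X := hpqU.trans (List.prefix_append _ _).isInfix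
  have hjz : j ≠ z := by
    rintro rfl
    apply h.ceil_path.end_notMem
    rw [← h6]
    exact List.mem_map_of_mem (mem_of_infix_right hpqU)
  obtain ⟨hs, ht⟩ := h.net.inner_ne h.ceil_exit hpq₁
  have hjr : ¬ G.RightOf (F ++ X) (a, true) := by
    intro hr
    by_cases hjF : j ∈ G.verts s F
    · exact h.not_reaches_of_rightOf hr (has ▸ hjF) (hreach a (by simp))
    · obtain ⟨p', q', hpq', hR⟩ := (h.net.rightOf_iff h.floor_exit).1 hr
      have hjW : j ∈ G.verts s (F ++ X) := by
        rw [← has, show G.src a = G.tgt p' from hR.vert_eq]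
        exact tgt_mem_verts (mem_of_infix_left hpq')
      exact hjF (h.mem_of_reaches hjW (h.ceil_reaches hj))
  -- At a departure to the right of the ceiling off the floor the value would be 1; on the floor,
  -- `a` lies directly before the floor arc in the rotation, which contradicts the order on the
  -- right.
  have hleft : G.LeftAt p₁ q₁ (a, true) := by
    rcases h.net.dart_cases (by rw [h5, h6]) hs ht (e := (a, true)) (has.trans h5.symm)
      with h8 | h8 | h8 | h8
    · simp at h8
    · simp only [Prod.mk.injEq, and_true] at h8
      exact absurd (h8 ▸ mem_of_infix_right hpqU) haU
    · exfalso
      by_cases hjF : j ∈ G.verts s F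
      · obtain ⟨p', q', hpq', hp'F, hp', hq', hq'F, -⟩ := h.exists_turn h.floor_path hjF hjs
        have hl' := h.floor_third hpq' hp' (d := (a, true)) has (by simp) (by
          intro he
          simp only [Prod.mk.injEq, and_true] at he
          exact haF (he ▸ hq'F hjz)) hjr
        have := hl'.2.1.symm.trans h8.2.1
        simp at this
      · have := (hψ.pot.rightAt h8).2.1
        rw [dartFlip_mk, Bool.not_true, hψ.ceil_right p₁ (mem_of_infix_left hpqU)
          (fun h' => hjF (h5 ▸ tgt_mem_verts h')), ← hψ.pot.jump_none haF haU, ha0] at this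
        norm_num at this
    · exact h8
  -- The jump is admissible for the ceiling, so a return at a later vertex would give an admissible
  -- path further to the left than the left-most one.
  have hallowed : ∀ e ∈ a :: N,
      ¬ G.RightOf (F ++ X) (e, true) ∧ ¬ G.RightOf (F ++ X) (e, false) := by
    intro e he
    constructor
    · rcases List.mem_cons.1 he with rfl | heN
      · exact hjr
      · intro hr
        obtain ⟨p', q', hpq', hR⟩ := (h.net.rightOf_iff h.floor_exit).1 hr
        apply hNF e heN
        refine h.mem_of_reaches ?_ ((reaches_of_arc e).trans (hreach e he))
        rw [show G.src e = G.tgt p' from hR.vert_eq]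
        exact tgt_mem_verts (mem_of_infix_left hpq')
    · intro hr
      obtain ⟨p', q', hpq', hR⟩ := (h.net.rightOf_iff h.floor_exit).1 hr
      have heF : G.tgt e ∈ G.verts s F := by
        refine h.mem_of_reaches ?_ (hreach e he)
        rw [show G.tgt e = G.tgt p' from hR.vert_eq]
        exact tgt_mem_verts (mem_of_infix_left hpq')
      rcases hN.tgt_cases (List.mem_map_of_mem he) with h8 | h8
      · obtain rfl := hlast e he h8
        have := hR.2.1.symm.trans hl.2.1
        simp at this
      · obtain ⟨e', he', hee'⟩ := List.mem_map.1 h8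
        exact hNF e' he' (hee' ▸ heF)
  have hUp := h.ceil_path
  rw [hU] at hUp
  have hnew := hUp.reroute h1 h2 hN hjm (by
    intro w hw hw'
    rcases hN.tgt_cases hw with h8 | h8
    · exact h8
    · obtain ⟨e', he', hee'⟩ := List.mem_map.1 h8
      exact absurd (by rw [hee', hU]; exact hw') (hint e' he'))
  have hccw := h.ceil.2 U₁ p₁ q₁ a (U₂ ++ U₃) (N ++ U₃) (by rw [hU]; simp) (by simpa using hnew)
    (by
      intro c hc
      have hc' : c ∈ U ∨ c ∈ a :: N := by
        rw [hU]
        simp only [List.mem_append, List.mem_cons] at hc ⊢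
        tauto
      exact hc'.elim (fun hc' => h.ceil_allowed hc') (fun hc' => hallowed c hc'))
    (fun he => haU (he ▸ mem_of_infix_right hpqU))
  obtain ⟨-, h9⟩ := h.net.ccw_eq_rot (d := (p₁, false)) hs ht hccw
  have := hleft.2.1.symm.trans h9
  simp at this

end Setup

/-- A component of a network with floor, ceiling and exit path, and a backward flipped path. -/
structure FlipSetup (G : PlaneDigraph V A) (s t : V) (C : Set V) (F : List A) (z : V)
    (X U : List A) (u : V) (P : List A) (v : V) : Prop extends G.Setup s t C F z X U where
  flipped : G.IsBackwardFlipped s C F (F ++ X) u P v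

/-! ### The flipped path and its sides on floor and ceiling -/

namespace FlipSetup

variable {s t z u v : V} {C : Set V} {F X U P : List A} (h : G.FlipSetup s t C F z X U u P v)
include h

theorem path : G.IsPath u P v := h.flipped.isPath

theorem ne_nil : P ≠ [] := by
  obtain ⟨a, M, rfl, -⟩ := h.flipped.start_left
  simp

theorem ne : u ≠ v := by
  intro huv
  have := h.path
  rw [huv] at this
  exact h.ne_nil this.eq_nil

theorem mem_component {w : V} (hw : w ∈ G.verts u P) : w ∈ C := by
  have h1 := h.path.1.verts_eq
  rcases mem_verts.1 hw with rfl | hw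
  · obtain ⟨a, M, hP, -⟩ := h.flipped.start_left
    have := h.path.1
    rw [hP] at this
    rw [← this.1]
    exact (h.flipped.arcs_mem a (by rw [hP]; simp)).1
  · obtain ⟨e, he, rfl⟩ := List.mem_map.1 hw
    exact (h.flipped.arcs_mem e he).2

theorem reaches {w : V} (hw : w ∈ G.verts u P) : G.Reaches w z :=
  h.scc.reaches (h.mem_component hw) h.exit_mem

theorem ne_source {w : V} (hw : w ∈ G.verts u P) : w ≠ s := by
  rintro rfl
  exact h.inside.1 (h.mem_component hw)

theorem floor_cases {w : V} (hw : w ∈ G.verts u P) (hwF : w ∈ G.verts s F) : w = u ∨ w = v :=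
  h.flipped.minimal w hw hwF

/-- The only floor vertices of `P` are its ends, so a violation of the forward order can only come
from these two. -/
theorem end_before_start : G.pos s F v < G.pos s F u := by
  have hb := h.flipped.backward
  unfold IsForward at hb
  push Not at hb
  obtain ⟨x, y, hxF, hyF, hxP, hyP, h1, h2⟩ := hb
  rw [precedes_iff h.floor_path hxF hyF] at h1
  rw [precedes_iff h.path hxP hyP] at h2
  rcases h.floor_cases hxP hxF with rfl | rfl <;> rcases h.floor_cases hyP hyF with rfl | rfl
  · omega
  · exfalso
    apply h2
    rw [pos_start, h.path.pos_end]
    exact List.length_pos_iff.2 h.ne_nil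
  · exact h1
  · omega

/-- A common arc would have both ends in `{u, v}` and advance on the floor; the only candidate would
start at `v`, where `P` ends. -/
theorem notMem_floor {e : A} (he : e ∈ P) : e ∉ F := by
  intro heF
  have h1 := h.floor_cases (h.path.1.src_mem he) (h.floor_path.1.src_mem heF)
  have h2 := h.floor_cases (tgt_mem_verts he) (tgt_mem_verts heF)
  have h3 := h.floor_path.pos_tgt heF
  have h4 := h.end_before_start
  rcases h1 with h1 | h1
  · rcases h2 with h2 | h2
    · rw [h1, h2] at h3
      omega
    · rw [h1, h2] at h3
      omega
  · exact h.path.end_notMem (h1 ▸ List.mem_map_of_mem he)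

theorem notMem_exit {e : A} (he : e ∈ P) : e ∉ X := fun heX =>
  h.exit.2.2 _ (List.mem_map_of_mem heX) (h.mem_component (tgt_mem_verts he))

theorem src_ne_end {e : A} (he : e ∈ P) : G.src e ≠ v := fun hev =>
  h.path.end_notMem (hev ▸ List.mem_map_of_mem he)

theorem tgt_ne_start {e : A} (he : e ∈ P) : G.tgt e ≠ u := fun heu =>
  h.path.start_notMem (heu ▸ List.mem_map_of_mem he)

theorem start_floor : u ∈ G.verts s F := h.flipped.start_mem

theorem end_floor : v ∈ G.verts s F := h.flipped.end_mem

/-- The last arc enters the floor from the right. -/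
theorem exists_last : ∃ M b, P = M ++ [b] ∧ G.tgt b = v ∧ G.RightOf (F ++ X) (b, false) := by
  obtain ⟨b, M, hP, hb⟩ := h.flipped.end_right
  refine ⟨M, b, hP, ?_, hb⟩
  have := h.path.1
  rw [hP] at this
  exact (isWalk_concat.1 this).2

theorem last_rightOf {b : A} (hb : b ∈ P) (hbv : G.tgt b = v) :
    G.RightOf (F ++ X) (b, false) ∧ b ∉ U := by
  obtain ⟨M, c, hP, hc, hr⟩ := h.exists_last
  have : b = c := h.path.eq_of_tgt_eq hb (by rw [hP]; simp) (hbv.trans hc.symm)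
  subst this
  exact ⟨hr, fun hbU => (h.ceil_allowed hbU).2 hr⟩

variable [Finite A]

/-- The first arc leaves the floor to the left. -/
theorem exists_first_turn : ∃ p q, [p, q] <:+: F ++ X ∧ p ∈ F ∧ G.tgt p = u ∧ G.src q = u ∧
    ∀ e ∈ P, G.src e = u → G.LeftAt p q (e, true) := by
  obtain ⟨a, M, hP, ha⟩ := h.flipped.start_left
  have haP : a ∈ P := by rw [hP]; simp
  have hau : G.src a = u := by
    have := h.path.1
    rw [hP] at this
    exact this.1
  obtain ⟨p, q, hpq, hpF, hp, hq, -⟩ := h.exists_turn h.floor_path h.start_floor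
    (h.ne_source (start_mem_verts _ _))
  refine ⟨p, q, hpq, hpF, hp, hq, fun e he heu => ?_⟩
  have : e = a := h.path.eq_of_src_eq he haP (heu.trans hau.symm)
  subst this
  exact h.net.leftAt_of_leftOf h.floor_exit ha hpq (hau.trans hp.symm)

/-- An arc attached to the prolonged floor on the right must be attached at `u` or `v`, and at `u`
the path leaves to the left. So only the last arc is forbidden for curves to which the right-bank
lemma applies. -/
theorem allowed {e : A} (he : e ∈ P) (hev : G.tgt e ≠ v) :
    ¬ G.RightOf (F ++ X) (e, true) ∧ ¬ G.RightOf (F ++ X) (e, false) := by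
  constructor
  · intro hr
    obtain ⟨p, q, hpq, hR⟩ := (h.net.rightOf_iff h.floor_exit).1 hr
    have hsP := h.path.1.src_mem he
    have hsF : G.src e ∈ G.verts s F := by
      refine h.mem_of_reaches ?_ (h.reaches hsP)
      rw [show G.src e = G.tgt p from hR.vert_eq]
      exact tgt_mem_verts (mem_of_infix_left hpq)
    rcases h.floor_cases hsP hsF with h1 | h1
    · obtain ⟨p', q', hpq', -, hp', -, hl⟩ := h.exists_first_turn
      obtain ⟨rfl, rfl⟩ := h.floor_exit.infix_unique hpq hpq' (by
        rw [hp', ← h1]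
        exact hR.vert_eq.symm)
      exact hR.not_leftAt (hl e he h1)
    · exact h.src_ne_end he h1
  · intro hr
    obtain ⟨p, q, hpq, hR⟩ := (h.net.rightOf_iff h.floor_exit).1 hr
    have hsP : G.tgt e ∈ G.verts u P := tgt_mem_verts he
    have hsF : G.tgt e ∈ G.verts s F := by
      refine h.mem_of_reaches ?_ (h.reaches hsP)
      rw [show G.tgt e = G.tgt p from hR.vert_eq]
      exact tgt_mem_verts (mem_of_infix_left hpq)
    rcases h.floor_cases hsP hsF with h1 | h1
    · exact h.tgt_ne_start he h1
    · exact hev h1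

/-- An arc of the flipped path that leaves the ceiling. -/
theorem ceil_side {ψ : A × Bool → ℝ} (hψ : G.StripPot F X U ψ) {e : A} (he : e ∈ P)
    (heU : e ∉ U) (hs : G.src e ∈ G.verts s U) :
    ∃ p q, [p, q] <:+: U ++ X ∧ p ∈ U ∧ G.tgt p = G.src e ∧ G.src q = G.src e ∧
      (G.LeftAt p q (e, true) ∧ ψ (e, true) = 0 ∨
        G.RightAt p q (e, true) ∧ G.src e ∉ G.verts s F ∧ ψ (e, true) = 1) := by
  obtain ⟨p, q, hpq, hpU, hp, hq, hqU, hqX⟩ := h.exists_turn h.ceil_path hs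
    (h.ne_source (h.path.1.src_mem he))
  refine ⟨p, q, hpq, hpU, hp, hq, ?_⟩
  obtain ⟨h1, h2⟩ := h.net.inner_ne h.ceil_exit hpq
  rcases h.net.dart_cases (by rw [hp, hq]) h1 h2 (e := (e, true)) hp.symm with h3 | h3 | h3 | h3
  · simp at h3
  · simp only [Prod.mk.injEq, and_true] at h3
    subst h3
    by_cases hz : G.src e = z
    · exact absurd (hqX hz) (h.notMem_exit he)
    · exact absurd (hqU hz) heU
  · right
    by_cases hF : G.src e ∈ G.verts s F
    · exfalso
      rcases h.floor_cases (h.path.1.src_mem he) hF with h4 | h4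
      · obtain ⟨p', q', -, -, -, -, hl⟩ := h.exists_first_turn
        have := h3.2.1.symm.trans (hl e he h4).2.1
        simp at this
      · exact h.src_ne_end he h4
    · refine ⟨h3, hF, ?_⟩
      have h4 := (hψ.pot.rightAt h3).2.1
      rw [dartFlip_mk, Bool.not_true, hψ.ceil_right p hpU
        (fun hpF => hF (hp ▸ tgt_mem_verts hpF))] at h4
      rw [hψ.pot.jump_none (h.notMem_floor he) heU, h4]
  · exact .inl ⟨h3, by rw [(hψ.pot.leftAt h3).2.1, hψ.ceil_left p hpU]⟩

/-- An arc of the flipped path that enters the ceiling. -/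
theorem arrive_side {ψ : A × Bool → ℝ} (hψ : G.StripPot F X U ψ) {e : A} (he : e ∈ P)
    (heU : e ∉ U) (hev : G.tgt e ≠ v) (hs : G.tgt e ∈ G.verts s U) :
    ∃ p q, [p, q] <:+: U ++ X ∧ p ∈ U ∧ q ∈ U ∧ G.tgt p = G.tgt e ∧ G.src q = G.tgt e ∧
      (G.LeftAt p q (e, false) ∧ ψ (e, false) = 0 ∨
        G.RightAt p q (e, false) ∧ ψ (e, false) = 1) := by
  have hF : G.tgt e ∉ G.verts s F := fun hF =>
    (h.floor_cases (tgt_mem_verts he) hF).elim (h.tgt_ne_start he) hev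
  obtain ⟨p, q, hpq, hpU, hp, hq, hqU, -⟩ := h.exists_turn h.ceil_path hs
    (h.net.source_in e)
  have hz : G.tgt e ≠ z := fun hz => hF (hz ▸ h.floor_path.1.end_mem)
  refine ⟨p, q, hpq, hpU, hqU hz, hp, hq, ?_⟩
  obtain ⟨h1, h2⟩ := h.net.inner_ne h.ceil_exit hpq
  rcases h.net.dart_cases (by rw [hp, hq]) h1 h2 (e := (e, false)) hp.symm with h3 | h3 | h3 | h3
  · simp only [Prod.mk.injEq, and_true] at h3
    exact absurd (h3 ▸ hpU) heU
  · simp at h3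
  · right
    refine ⟨h3, ?_⟩
    rw [(hψ.pot.rightAt h3).2.2]
    exact hψ.ceil_right q (hqU hz) (fun hqF => hF (hq ▸ h.floor_path.1.src_mem hqF))
  · exact .inl ⟨h3, by rw [(hψ.pot.leftAt h3).2.1, hψ.ceil_left p hpU]⟩

omit [Finite A] in
/-- The tail of a flipped path is on the right bank of the floor. -/
theorem tail_eq_zero {l m : List A} {φ : A × Bool → ℝ} (hφ : G.Pot l m φ)
    (hr : ∀ d, G.RightOf (F ++ X) d → φ d = 0) {w : V} {M T : List A} {f : A}
    (hP : P = M ++ f :: T) (hw : G.IsWalk w (f :: T) v) (hl : f ∉ l) (hm : f ∉ m)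
    (hT : ∀ e ∈ T, G.Free {b | b ∈ l ∨ b ∈ m} (G.src e)) : φ (f, true) = 0 := by
  obtain ⟨L, b, hL, -, hb⟩ := hw.exists_concat (by simp)
  have hbT : b ∈ f :: T := by rw [hL]; simp
  have hbP : b ∈ P := by rw [hP]; exact List.mem_append_right _ hbT
  rw [← hr _ (h.last_rightOf hbP hb).1]
  exact (hφ.const_walk hw hl hm hT b hbT true false).symm

end FlipSetup

/-- The flipped path is `P₁` followed by `o` and `O`, where `k` is its last vertex on the ceiling
before its end. -/
structure DepartSetup (G : PlaneDigraph V A) (s t : V) (C : Set V) (F : List A) (z : V)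
    (X U : List A) (u : V) (P : List A) (v : V) (P₁ : List A) (o : A) (O : List A) (k : V) :
    Prop extends G.FlipSetup s t C F z X U u P v where
  eq : P = P₁ ++ o :: O
  walk₁ : G.IsWalk u P₁ k
  walk₂ : G.IsWalk k (o :: O) v
  mem : k ∈ G.verts s U
  off : ∀ e ∈ O, G.src e ∉ G.verts s U
  turn : ∃ p q, [p, q] <:+: U ++ X ∧ p ∈ U ∧ G.tgt p = k ∧ G.src q = k ∧ G.LeftAt p q (o, true)

/-- Starting with value 1 above the floor and ending with value 0 on its right bank, the path must
meet the ceiling. Its tail after the last such vertex keeps the value 0, whereas a departure to the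
right would start with value 1. -/
theorem FlipSetup.exists_departure {s t z u v : V} {C : Set V} {F X U P : List A}
    (h : G.FlipSetup s t C F z X U u P v) [Finite A] [Finite V] :
    ∃ P₁ o O k, G.DepartSetup s t C F z X U u P v P₁ o O k := by
  obtain ⟨ψ, hψ⟩ := h.exists_stripPot
  obtain ⟨P₀, b, hP, hb, hbr⟩ := h.exists_last
  have hP₀ : G.IsWalk u P₀ (G.src b) := by
    have := h.path.1
    rw [hP] at this
    exact (isWalk_concat.1 this).1
  have hsrc : ∀ e ∈ P, G.src e ∈ G.verts u P₀ := by
    intro e he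
    rw [hP₀.verts_eq]
    rw [hP, List.mem_append, List.mem_singleton] at he
    rcases he with he | rfl
    · exact List.mem_append_left _ (List.mem_map_of_mem he)
    · simp
  -- `P₀` omits the last arc, so the end `v`, which might itself be on the ceiling, does not count.
  have hex : ∃ w ∈ G.verts u P₀, w ∈ G.verts s U := by
    by_contra hno
    push Not at hno
    obtain ⟨a, M, hPa, hau, haM⟩ := h.path.1.exists_cons h.ne_nil
    have haP : a ∈ P := by rw [hPa]; simp
    obtain ⟨p, q, hpq, hpF, hp, hq, hl⟩ := h.exists_first_turn
    have hpU : p ∉ U := fun hpU => hno u (start_mem_verts _ _) (hp ▸ tgt_mem_verts hpU)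
    have haU : a ∉ U := fun haU =>
      hno u (start_mem_verts _ _) (hau ▸ h.ceil_path.1.src_mem haU)
    have h1 := (hψ.pot.leftAt (hl a haP hau)).2.1
    rw [hψ.floor_left p hpF hpU] at h1
    have h2 := h.tail_eq_zero hψ.pot (fun d hd => (hψ.right d hd).1) (M := []) hPa
      (show G.IsWalk u (a :: M) v from ⟨hau, haM⟩) (h.notMem_floor haP) haU (by
        intro e he
        have heP : e ∈ P := by rw [hPa]; simp [he]
        refine free_of_notMem h.floor_path.1 h.ceil_path.1 ?_ (hno _ (hsrc e heP))
        intro heF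
        rcases h.floor_cases (h.path.1.src_mem heP) heF with h3 | h3
        · have h4 := h.path.src_nodup
          rw [hPa, List.map_cons, List.nodup_cons] at h4
          exact h4.1 (by rw [hau, ← h3]; exact List.mem_map_of_mem he)
        · exact h.src_ne_end heP h3)
    rw [h1] at h2
    norm_num at h2
  obtain ⟨P₁, O', k, rfl, h1, h2, hk, hoff⟩ := hP₀.exists_last _ hex
  obtain ⟨o, O, hoO⟩ : ∃ o O, O' ++ [b] = o :: O := List.exists_cons_of_ne_nil (by simp)
  have hPo : P = P₁ ++ o :: O := by rw [hP, ← hoO]; simp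
  have hw : G.IsWalk k (o :: O) v := by
    rw [← hoO]
    exact isWalk_concat.2 ⟨h2, hb⟩
  have hoffO : ∀ e ∈ O, G.src e ∉ G.verts s U := by
    have h3 := h2.verts_eq
    have h4 : (o :: O).map G.src = k :: O'.map G.tgt := by
      rw [← hoO, List.map_append]
      exact h3.symm
    intro e he
    have h5 : G.src e ∈ O'.map G.tgt := by
      simp only [List.map_cons, List.cons.injEq] at h4
      rw [← h4.2]
      exact List.mem_map_of_mem he
    obtain ⟨e', he', he''⟩ := List.mem_map.1 h5
    rw [← he'']
    exact hoff e' he'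
  have hoP : o ∈ P := by rw [hPo]; simp
  have hoU : o ∉ U := by
    intro hoU
    cases O with
    | nil => exact (h.last_rightOf hoP hw.2).2 hoU
    | cons c O =>
      apply hoffO c (by simp)
      rw [show G.src c = G.tgt o from hw.2.1]
      exact tgt_mem_verts hoU
  refine ⟨P₁, o, O, k, h, hPo, h1, hw, hk, hoffO, ?_⟩
  have hok : G.src o = k := hw.1
  obtain ⟨p, q, hpq, hpU, hp, hq, hside⟩ := h.ceil_side hψ hoP hoU (hok.symm ▸ hk)
  refine ⟨p, q, hpq, hpU, hp.trans hok, hq.trans hok, ?_⟩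
  rcases hside with h3 | ⟨-, hF, h4⟩
  · exact h3.1
  · have h5 := h.tail_eq_zero hψ.pot (fun d hd => (hψ.right d hd).1) hPo hw
      (h.notMem_floor hoP) hoU (by
        intro e he
        have heP : e ∈ P := by rw [hPo]; simp [he]
        refine free_of_notMem h.floor_path.1 h.ceil_path.1 ?_ (hoffO e he)
        intro heF
        rcases h.floor_cases (h.path.1.src_mem heP) heF with h6 | h6
        · have hPp := h.path
          rw [hPo] at hPp
          refine hPp.disjoint (start_mem_verts _ _) ?_
          rw [← h6]
          exact hw.src_mem_tgt he
        · exact h.src_ne_end heP h6)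
    rw [h4] at h5
    norm_num at h5

theorem IsPath.mem_mid_iff {x y a b w : V} {L₁ L₂ L₃ : List A}
    (h : G.IsPath x (L₁ ++ (L₂ ++ L₃)) y) (h1 : G.IsWalk x L₁ a) (h2 : G.IsWalk a L₂ b)
    (hw : w ∈ G.verts x (L₁ ++ (L₂ ++ L₃))) :
    w ∈ G.verts a L₂ ↔ G.pos x (L₁ ++ (L₂ ++ L₃)) a ≤ G.pos x (L₁ ++ (L₂ ++ L₃)) w ∧
      G.pos x (L₁ ++ (L₂ ++ L₃)) w ≤ G.pos x (L₁ ++ (L₂ ++ L₃)) b := by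
  have e : L₁ ++ (L₂ ++ L₃) = (L₁ ++ L₂) ++ L₃ := by simp
  have h' : G.IsPath x ((L₁ ++ L₂) ++ L₃) y := e ▸ h
  have k1 := h.mem_right_iff h1 hw
  have k2 := h'.mem_left_iff (a := w) (h1.append h2)
  have k3 := h'.mem_right_iff (a := w) (h1.append h2) (e ▸ hw)
  rw [← e] at k2 k3
  constructor
  · intro hw2
    refine ⟨?_, k2.1 ?_⟩
    · rcases mem_verts.1 hw2 with rfl | hw2
      · exact le_rfl
      · exact (k1.1 (by rw [List.map_append]; exact List.mem_append_left _ hw2)).le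
    · rw [verts_append]
      rcases mem_verts.1 hw2 with rfl | hw2
      · exact List.mem_append_left _ h1.end_mem
      · exact List.mem_append_right _ hw2
  · rintro ⟨h3, h4⟩
    rcases lt_or_eq_of_le h3 with h3 | h3
    · have := k1.2 h3
      rw [List.map_append, List.mem_append] at this
      rcases this with h5 | h5
      · exact mem_verts.2 (.inr h5)
      · have := k3.1 h5
        omega
    · have := pos_inj hw h3.symm
      rw [this]
      exact start_mem_verts _ _

theorem exists_first_not {p : A → Prop} {l : List A} (h : ∃ a ∈ l, ¬ p a) :
    ∃ l₁ a l₂, l = l₁ ++ a :: l₂ ∧ ¬ p a ∧ ∀ b ∈ l₁, p b := by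
  induction l with
  | nil => simp at h
  | cons c l ih =>
    by_cases hc : p c
    · obtain ⟨a, ha, hpa⟩ := h
      have hal : a ∈ l := by
        rcases List.mem_cons.1 ha with rfl | ha
        · exact absurd hc hpa
        · exact ha
      obtain ⟨l₁, b, l₂, rfl, h1, h2⟩ := ih ⟨a, hal, hpa⟩
      refine ⟨c :: l₁, b, l₂, rfl, h1, ?_⟩
      intro d hd
      rcases List.mem_cons.1 hd with rfl | hd
      · exact hc
      · exact h2 d hd
    · exact ⟨[], c, l, rfl, hc, by simp⟩

theorem Pot.bank_left {l m : List A} {φ : A × Bool → ℝ} (h : G.Pot l m φ) {p q : A}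
    {d : A × Bool} (hd : G.RightAt p q d ∨ G.LeftAt p q d) (hl : d.1 ∉ l) (hm : d.1 ∉ m) :
    φ (q, true) = φ (p, true) := by
  rcases hd with hd | hd
  · exact (h.rightAt hd).1
  · have := h.leftAt hd
    rw [← this.2.2, h.flip_none hl hm, this.2.1]

/-- The left bank of a part of a path is connected if no other arcs are attached to it. -/
theorem IsNetwork.left_bank {s t : V} (hG : G.IsNetwork s t) [Finite A] {l m : List A}
    {φ : A × Bool → ℝ} (h : G.Pot l m φ) {Y M : List A} (hY : G.IsPath s Y t) (hM : M <:+: Y)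
    (hoff : ∀ p q, [p, q] <:+: M → ∀ a ∉ Y, (G.src a = G.tgt p ∨ G.tgt a = G.tgt p) →
      a ∉ l ∧ a ∉ m) : ∀ e ∈ M, ∀ f ∈ M, φ (e, true) = φ (f, true) := by
  have key : ∀ N L a, M = L ++ a :: N → ∀ e ∈ N, φ (e, true) = φ (a, true) := by
    intro N
    induction N with
    | nil => simp
    | cons c N ih =>
      intro L a hL e he
      have hac : [a, c] <:+: M := ⟨L, N, by rw [hL]; simp⟩
      have hacY := hac.trans hM
      obtain ⟨hs, ht⟩ := hG.inner_ne hY hacY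
      obtain ⟨d, hd⟩ := hG.exists_third (hY.1.src_eq_of_infix hacY) hs ht
      have hdY : d.1 ∉ Y := hY.third_notMem hacY hd
      have hv : G.vert d = G.tgt a := hd.elim RightAt.vert_eq LeftAt.vert_eq
      have hd' : G.src d.1 = G.tgt a ∨ G.tgt d.1 = G.tgt a := by
        rcases d with ⟨b, _ | _⟩
        · exact .inr hv
        · exact .inl hv
      obtain ⟨h1, h2⟩ := hoff a c hac d.1 hdY hd'
      have h3 := h.bank_left hd h1 h2
      rcases List.mem_cons.1 he with rfl | he
      · exact h3
      · rw [ih (L ++ [a]) c (by rw [hL]; simp) e he, h3]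
  intro e he f hf
  cases M with
  | nil => simp at he
  | cons c M =>
    have h1 : ∀ e ∈ c :: M, φ (e, true) = φ (c, true) := by
      intro e he
      rcases List.mem_cons.1 he with rfl | he
      · rfl
      · exact key M [] c rfl e he
    rw [h1 e he, h1 f hf]

/-! ### The last departure from the ceiling -/

namespace DepartSetup

variable {s t z u v k : V} {C : Set V} {F X U P P₁ O : List A} {o : A}
  (h : G.DepartSetup s t C F z X U u P v P₁ o O k)
include h

theorem path' : G.IsPath u (P₁ ++ o :: O) v := h.eq ▸ h.path

theorem path₁ : G.IsPath u P₁ k := h.path'.left h.walk₁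

theorem path₂ : G.IsPath k (o :: O) v := h.path'.right h.walk₁

theorem mem_left {e : A} (he : e ∈ P₁) : e ∈ P := by
  rw [h.eq]
  exact List.mem_append_left _ he

theorem mem_right {e : A} (he : e ∈ o :: O) : e ∈ P := by
  rw [h.eq]
  exact List.mem_append_right _ he

theorem verts_left {w : V} (hw : w ∈ G.verts u P₁) : w ∈ G.verts u P := by
  rw [h.eq]
  exact verts_subset_append hw

theorem end_mem_right : v ∈ (o :: O).map G.tgt := by
  obtain ⟨L, b, hL, -, hb⟩ := h.walk₂.exists_concat (by simp)
  rw [hL, ← hb]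
  simp

theorem ne_end {w : V} (hw : w ∈ G.verts u P₁) : w ≠ v := by
  rintro rfl
  exact h.path'.disjoint hw h.end_mem_right

theorem eq_start {w : V} (hw : w ∈ G.verts u P₁) (hwF : w ∈ G.verts s F) : w = u :=
  (h.floor_cases (h.verts_left hw) hwF).resolve_right (h.ne_end hw)

theorem tail_notMem {e : A} (he : e ∈ O) : G.src e ∉ G.verts u P₁ := fun hw =>
  h.path'.disjoint hw (h.walk₂.src_mem_tgt he)

theorem tail_floor {e : A} (he : e ∈ O) : G.src e ∉ G.verts s F := by
  intro hF
  have heP := h.mem_right (List.mem_cons_of_mem o he)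
  rcases h.floor_cases (h.path.1.src_mem heP) hF with h1 | h1
  · exact h.tail_notMem he (h1 ▸ start_mem_verts _ _)
  · exact h.src_ne_end heP h1

theorem src_depart : G.src o = k := h.walk₂.1

theorem depart_notMem_ceil : o ∉ U := by
  intro hoU
  obtain ⟨p, q, hpq, -, -, hq, hl⟩ := h.turn
  have : o = q := h.ceil_exit.eq_of_src_eq (List.mem_append_left _ hoU) (mem_of_infix_right hpq)
    (h.src_depart.trans hq.symm)
  exact hl.ne_right (by rw [this])

theorem depart_notMem_left : o ∉ P₁ := by
  intro ho
  have := h.path'.nodup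
  rw [List.nodup_append] at this
  exact this.2.2 _ ho o (by simp) rfl

theorem tgt_left_ne {e : A} (he : e ∈ P₁) : G.tgt e ≠ v := h.ne_end (tgt_mem_verts he)

variable [Finite A]

theorem left_allowed {e : A} (he : e ∈ P₁) :
    ¬ G.RightOf (F ++ X) (e, true) ∧ ¬ G.RightOf (F ++ X) (e, false) :=
  h.allowed (h.mem_left he) (h.tgt_left_ne he)

variable [Finite V]

/-- If `P₁` met the ceiling beyond `k`, the ceiling from `k` to the first such vertex and `P₁` back
to `k` would form a directed cycle. The tail leaves `k` on its left, where the value is 1, and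
reaches the right bank of the floor, of value 0, without crossing it. -/
theorem pos_le {w : V} (hw : w ∈ G.verts u P₁) (hwU : w ∈ G.verts s U) :
    G.pos s U w ≤ G.pos s U k := by
  by_contra hlt
  rw [not_le] at hlt
  obtain ⟨U₁, U₂, hU, h1, h2⟩ := h.ceil_path.1.exists_split h.mem
  have hUp := h.ceil_path
  rw [hU] at hUp hwU hlt
  have hw2 := (hUp.mem_right_iff h1 hwU).2 hlt
  have hwk : w ≠ k := by
    rintro rfl
    exact lt_irrefl _ hlt
  obtain ⟨Ua, Ub, w', rfl, h3, -, ⟨hw'P, hw'k⟩, hfirst⟩ := h2.exists_first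
    (fun w => w ∈ G.verts u P₁ ∧ w ≠ k) ⟨w, mem_verts.2 (.inr hw2), hw, hwk⟩
  obtain ⟨Pa, Pb, hPab, h5, h6⟩ := h.walk₁.exists_split hw'P
  obtain ⟨c, Ua, rfl, hc, hUa⟩ := h3.exists_cons (h3.ne_nil hw'k.symm)
  have hUap : G.IsPath k (c :: Ua) w' := (hUp.right h1).left h3
  have hP₁ := h.path₁
  rw [hPab] at hP₁
  have hPbp := hP₁.right h5
  have hUaU : ∀ e ∈ c :: Ua, e ∈ U := fun e he => by
    rw [hU]
    exact List.mem_append_right _ (List.mem_append_left _ he)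
  have hPbP : ∀ e ∈ Pb, e ∈ P₁ := fun e he => by
    rw [hPab]
    exact List.mem_append_right _ he
  have hZ : G.IsWalk k ((c :: Ua) ++ Pb) k := h3.append h6
  have hnd : (((c :: Ua) ++ Pb).map G.tgt).Nodup := by
    rw [List.map_append, List.nodup_append]
    refine ⟨hUap.tgt_nodup, hPbp.tgt_nodup, ?_⟩
    rintro x hx x' hx' rfl
    rcases hUap.tgt_cases hx with hxw | hxw
    · exact hPbp.start_notMem (hxw ▸ hx')
    · obtain ⟨e, he, hex⟩ := List.mem_map.1 hxw
      refine hfirst e (by simp [he]) ?_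
      rw [hex]
      refine ⟨?_, ?_⟩
      · rw [hPab, verts_append]
        exact List.mem_append_right _ hx'
      · rintro rfl
        exact hUap.start_notMem hx
  have hkz : G.Reaches k z := h.ceil_reaches h.mem
  obtain ⟨φ, hφ, hb⟩ := h.net.cycle_pot hZ (by simp) hnd (fun ht =>
    h.ne_sink_of_reaches ((hZ.reaches_end (mem_verts.2 (.inr ht))).trans hkz) rfl)
  obtain ⟨-, hright⟩ := h.net.pot_right_bank h.floor_exit hφ (by
    intro e he
    rcases List.mem_append.1 he with he | he
    · exact h.ceil_allowed (hUaU e he)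
    · exact h.left_allowed (hPbP e he)) (by simp)
    (h.free_sink hZ (show G.IsWalk k [] k from rfl) hkz hkz)
  have ho := h.tail_eq_zero hφ (fun d hd => (hright d hd).1) h.eq h.walk₂ (by
    intro ho
    rcases List.mem_append.1 ho with ho | ho
    · exact h.depart_notMem_ceil (hUaU o ho)
    · exact h.depart_notMem_left (hPbP o ho)) (by simp) (by
    intro e he
    rintro a (ha | ha)
    · rcases List.mem_append.1 ha with ha | ha
      · exact ⟨fun h7 => h.off e he (h7 ▸ h.ceil_path.1.src_mem (hUaU a ha)),
          fun h7 => h.off e he (h7 ▸ tgt_mem_verts (hUaU a ha))⟩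
      · exact ⟨fun h7 => h.tail_notMem he (h7 ▸ h.walk₁.src_mem (hPbP a ha)),
          fun h7 => h.tail_notMem he (h7 ▸ tgt_mem_verts (hPbP a ha))⟩
    · simp at ha)
  obtain ⟨p, q, hpq, hpU, hp, hq, hl⟩ := h.turn
  obtain ⟨Pb, π, rfl, -, hπ⟩ := h6.exists_concat (h6.ne_nil hw'k)
  -- There are only three darts at `k`, so `P₁` arrives there along the ceiling arc `p`.
  have hπp : π = p := by
    by_contra hne
    obtain ⟨hs, ht⟩ := h.net.inner_ne h.ceil_exit hpq
    have := h.net.third_unique (by rw [hp, hq]) hs ht (d := (π, false)) (e := (o, true))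
      (hπ.trans hp.symm) (h.src_depart.trans hp.symm) (by simpa using hne) (by simp)
      hl.ne_left hl.ne_right
    simp at this
  have h7 := (hφ.leftAt hl).2.1
  rw [ho, (hb p (by rw [← hπp]; simp)).1] at h7
  norm_num at h7

end DepartSetup

/-! ### Before its departure the flipped path stays in the strip -/

namespace DepartSetup

variable {s t z u v k : V} {C : Set V} {F X U P P₁ O : List A} {o : A}
  (h : G.DepartSetup s t C F z X U u P v P₁ o O k)
include h
variable [Finite A] [Finite V]

/-- If the flipped path leaves the ceiling to the right and returns to it, no vertex of the floor
lies on the ceiling in between. -/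
theorem right_jump_facts {ψ : A × Bool → ℝ} (hψ : G.StripPot F X U ψ) {Pc Pf R : List A} {f : A}
    {g g' : V} (hP : P₁ = Pc ++ ((f :: R) ++ Pf)) (h1 : G.IsWalk u Pc g)
    (h2 : G.IsWalk g (f :: R) g') (hgU : g ∈ G.verts s U) (hg'U : g' ∈ G.verts s U)
    (hgF : g ∉ G.verts s F) (hfU : f ∉ U) (hf1 : ψ (f, true) = 1)
    (hint : ∀ e ∈ R, G.src e ∉ G.verts s U) :
    G.pos s U g < G.pos s U g' ∧
      (∀ w ∈ G.verts s U, G.pos s U g < G.pos s U w → G.pos s U w < G.pos s U g' →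
        w ∉ G.verts s F) ∧
      ∃ V₂ χ, G.Pot (f :: R) V₂ χ ∧ (∀ e ∈ V₂, χ (e, false) = 1) ∧
        (∀ e ∈ V₂, e ∈ U ∧ G.pos s U g ≤ G.pos s U (G.src e) ∧
          G.pos s U (G.tgt e) ≤ G.pos s U g') ∧
        (∀ e ∈ U, G.pos s U g ≤ G.pos s U (G.src e) →
          G.pos s U (G.tgt e) ≤ G.pos s U g' → e ∈ V₂) ∧
        (∀ q ∈ F ++ X, χ (q, false) = 0) := by
  have hfRP₁ : ∀ e ∈ f :: R, e ∈ P₁ := fun e he => by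
    rw [hP]
    exact List.mem_append_right _ (List.mem_append_left _ he)
  have hP₁ := h.path₁
  rw [hP] at hP₁
  have hRp : G.IsPath g (f :: R) g' := (hP₁.right h1).left h2
  have hfg : G.src f = g := h2.1
  have hfP := h.mem_left (hfRP₁ f (by simp))
  have hRv : ∀ e ∈ R, G.src e ∈ G.verts u P₁ := fun e he => h.walk₁.src_mem (hfRP₁ e (by simp [he]))
  have hintY : ∀ e ∈ R, G.src e ∉ G.verts s (U ++ X) := fun e he hY =>
    hint e he (h.mem_of_reaches hY (h.reaches (h.verts_left (hRv e he))))
  have hRF : ∀ e ∈ R, G.src e ∉ G.verts s F := by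
    intro e he heF
    have h3 := h.eq_start (hRv e he) heF
    refine hP₁.disjoint (start_mem_verts _ _) (?_ : u ∈ ((f :: R) ++ Pf).map G.tgt)
    rw [List.map_append, ← h3]
    exact List.mem_append_left _ (h2.src_mem_tgt he)
  have hlt : G.pos s U g < G.pos s U g' := by
    obtain ⟨p, q, hpq, -, hp, hq, h3 | h3⟩ := h.ceil_side hψ hfP hfU (hfg.symm ▸ hgU)
    · rw [hf1] at h3
      exact absurd h3.2 one_ne_zero
    · have := h.net.pos_lt_of_right_jump h.ceil_exit hpq h3.1 hRp hintY (verts_subset_append hg'U)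
      rwa [pos_append hgU, pos_append hg'U] at this
  obtain ⟨V₁, V₂, V₃, hU, h3, h4, h5, hne⟩ := h.ceil_path.exists_between hgU hg'U hlt
  have hUp := h.ceil_path
  rw [hU] at hUp
  have hV₂U : ∀ e ∈ V₂, e ∈ U := fun e he => by
    rw [hU]
    exact List.mem_append_right _ (List.mem_append_left _ he)
  have hV₂p : G.IsPath g V₂ g' := (hUp.right h3).left h4
  have hmid : ∀ w ∈ G.verts s U, w ∈ G.verts g V₂ ↔
      G.pos s U g ≤ G.pos s U w ∧ G.pos s U w ≤ G.pos s U g' := by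
    intro w hw
    have := hUp.mem_mid_iff h3 h4 (w := w) (by rwa [← hU])
    rwa [← hU] at this
  have hV₂pos : ∀ e ∈ V₂, e ∈ U ∧ G.pos s U g ≤ G.pos s U (G.src e) ∧
      G.pos s U (G.tgt e) ≤ G.pos s U g' := by
    intro e he
    have heU := hV₂U e he
    exact ⟨heU, ((hmid _ (h.ceil_path.1.src_mem heU)).1 (h4.src_mem he)).1,
      ((hmid _ (tgt_mem_verts heU)).1 (tgt_mem_verts he)).2⟩
  have hV₂mem : ∀ e ∈ U, G.pos s U g ≤ G.pos s U (G.src e) →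
      G.pos s U (G.tgt e) ≤ G.pos s U g' → e ∈ V₂ := by
    intro e he h6 h7
    have h8 := h.ceil_path.pos_tgt he
    have h9 := (hmid _ (h.ceil_path.1.src_mem he)).2 ⟨h6, by omega⟩
    rw [h4.verts_eq, List.mem_append] at h9
    rcases h9 with h9 | h9
    · obtain ⟨e', he', hee'⟩ := List.mem_map.1 h9
      rwa [← h.ceil_path.eq_of_src_eq (hV₂U e' he') he hee']
    · have : G.src e = g' := by simpa using h9
      rw [this] at h8
      omega
  have hgz : G.Reaches g' z := h.ceil_reaches hg'U
  -- `χ` distinguishes the region between the jump and the ceiling part `V₂` above it. The ceiling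
  -- after `g'` leads to the sink off this curve, so its left value is 0.
  obtain ⟨χ, hχ⟩ := exists_pot h2 h4 hRp.nodup hV₂p.nodup
  have hfree := h.free_sink h2 h4 hgz hgz
  obtain ⟨hbank, -⟩ := h.net.pot_right_bank h.floor_exit hχ
    (fun e he => h.left_allowed (hfRP₁ e he)) (fun e he => h.ceil_allowed (hV₂U e he)) hfree
  -- arcs of the jump are not on the ceiling
  have hfRU : ∀ e ∈ f :: R, e ∉ U := by
    intro e he heU
    rcases List.mem_cons.1 he with rfl | he
    · exact hfU heU
    · exact hint e he (h.ceil_path.1.src_mem heU)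
  -- the end of the jump
  obtain ⟨M, b', hM, -, hb'⟩ := h2.exists_concat (by simp)
  have hb'R : b' ∈ f :: R := by rw [hM]; simp
  have hb'P₁ := hfRP₁ b' hb'R
  have hb'1 : ψ (b', false) = 1 := by
    rw [← hf1]
    exact hψ.pot.const_walk h2 (h.notMem_floor hfP) hfU
      (fun e he => free_of_notMem h.floor_path.1 h.ceil_path.1 (hRF e he) (hint e he))
      b' hb'R true false
  obtain ⟨p', q', hpq', hp'U, hq'U, hp', hq', hside⟩ := h.arrive_side hψ (h.mem_left hb'P₁)
    (hfRU b' hb'R) (h.tgt_left_ne hb'P₁) (hb'.symm ▸ hg'U)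
  rw [hb'] at hp' hq'
  have hR : G.RightAt p' q' (b', false) := by
    rcases hside with h6 | h6
    · rw [hb'1] at h6
      exact absurd h6.2 one_ne_zero
    · exact h6.1
  have hp'V₂ : p' ∈ V₂ := by
    refine hV₂mem p' hp'U ?_ (by rw [hp'])
    have := h.ceil_path.pos_tgt hp'U
    rw [hp'] at this
    omega
  have hq'0 : χ (q', true) = 0 := by
    obtain ⟨q, V₃, rfl, hq, h6⟩ := h5.exists_cons (h5.ne_nil (by
      rintro rfl
      apply h.ceil_path.end_notMem
      rw [← hq']
      exact List.mem_map_of_mem hq'U))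
    have hqq : q' = q := h.ceil_path.eq_of_src_eq hq'U (by rw [hU]; simp) (hq'.trans hq.symm)
    subst hqq
    have hw : G.IsWalk g' (q' :: (V₃ ++ X)) t := ⟨hq, h6.append h.exit_path.1⟩
    have hYp := h.ceil_exit
    rw [hU, show V₁ ++ (V₂ ++ q' :: V₃) ++ X = (V₁ ++ V₂) ++ (q' :: (V₃ ++ X)) by simp] at hYp
    have hV₁₂ := h3.append h4
    refine h.net.pot_eq_zero_of_walk hχ hfree hw (fun h7 => hfRU _ h7 hq'U) (fun h7 => ?_)
      (fun e he => ?_) q' (by simp) true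
    · have := (hV₂pos q' h7).2.2
      have h8 := h.ceil_path.pos_tgt hq'U
      rw [hq'] at h8
      omega
    · have h7 := hw.src_mem_tgt he
      have hnot : G.src e ∉ G.verts s (V₁ ++ V₂) := fun h8 => hYp.disjoint h8 h7
      have hVv : ∀ w ∈ G.verts g V₂, w ∈ G.verts s (V₁ ++ V₂) := by
        intro w hw
        rw [verts_append]
        rcases mem_verts.1 hw with rfl | hw
        · exact List.mem_append_left _ h3.end_mem
        · exact List.mem_append_right _ hw
      have hY : G.src e ∈ G.verts s (U ++ X) := by
        rw [hU, show V₁ ++ (V₂ ++ q' :: V₃) ++ X = (V₁ ++ V₂) ++ (q' :: (V₃ ++ X)) by simp,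
          verts_append]
        exact List.mem_append_right _ h7
      refine free_of_notMem h2 h4 ?_ (fun h8 => hnot (hVv _ h8))
      intro h8
      rcases mem_verts.1 h8 with h9 | h9
      · exact hnot (hVv _ (h9 ▸ start_mem_verts _ _))
      · rcases hRp.tgt_cases h9 with h10 | h10
        · exact hnot (hVv _ (h10 ▸ h4.end_mem))
        · obtain ⟨e', he', hee'⟩ := List.mem_map.1 h10
          exact hintY e' he' (hee' ▸ hY)
  -- The jump arrives at `g'` from the right, so the value 0 on the left of `q'` extends to `p'`,
  -- and from there along the left bank of `V₂`.
  have hleft : ∀ e ∈ V₂, χ (e, true) = 0 := by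
    intro e he
    have h6 := h.net.left_bank hχ h.ceil_exit (M := V₂) ⟨V₁, V₃ ++ X, by rw [hU]; simp⟩ (by
      intro p q hpq a haY hap
      have hpV₂ := mem_of_infix_left hpq
      have hqV₂ := mem_of_infix_right hpq
      have hv := h4.src_eq_of_infix hpq
      have k1 := (hV₂pos p hpV₂)
      have k2 := (hV₂pos q hqV₂)
      have k3 := h.ceil_path.pos_tgt k1.1
      have k4 := h.ceil_path.pos_tgt k2.1
      rw [hv] at k2 k4
      have hw : G.tgt p ∈ G.verts s U := tgt_mem_verts k1.1
      have hwR : G.tgt p ∉ G.verts g (f :: R) := by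
        intro h8
        rcases mem_verts.1 h8 with h9 | h9
        · rw [h9] at k3
          omega
        · rcases hRp.tgt_cases h9 with h10 | h10
          · rw [h10] at k2 k4
            omega
          · obtain ⟨e', he', hee'⟩ := List.mem_map.1 h10
            exact hint e' he' (hee' ▸ hw)
      refine ⟨fun haR => hwR ?_, fun haV => haY (List.mem_append_left _ (hV₂U a haV))⟩
      rcases hap with hap | hap
      · exact hap ▸ h2.src_mem haR
      · exact hap ▸ tgt_mem_verts haR) e he p' hp'V₂
    rw [h6, ← (hχ.rightAt hR).1, hq'0]
  have hrightV : ∀ e ∈ V₂, χ (e, false) = 1 := by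
    intro e he
    have := hχ.jump_right (fun h6 => hfRU e h6 (hV₂U e he)) he
    rw [hleft e he] at this
    linarith
  refine ⟨hlt, ?_, V₂, χ, hχ, hrightV, hV₂pos, hV₂mem, hbank⟩
  -- At such a vertex, degree three forces ceiling and floor to share an arc before or after it. Its
  -- right value would be 1 as an arc of `V₂` and 0 as an arc of the floor.
  intro w hw hgw hwg' hwF
  have hws : w ≠ s := by
    rintro rfl
    rw [pos_start] at hgw
    omega
  have hwz : w ≠ z := by
    rintro rfl
    have := pos_le_length hg'U
    rw [h.ceil_path.pos_end] at hwg'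
    omega
  obtain ⟨p, q, hpq, hpF, hp, hq, hqF, -⟩ := h.exists_turn h.floor_path hwF hws
  obtain ⟨c, d, hcd, hcU, hc, hd, hdU, -⟩ := h.exists_turn h.ceil_path hw hws
  have hdV : d ∈ V₂ := by
    refine hV₂mem d (hdU hwz) (by rw [hd]; omega) ?_
    have := h.ceil_path.pos_tgt (hdU hwz)
    rw [hd] at this
    omega
  have hcV : c ∈ V₂ := by
    refine hV₂mem c hcU ?_ (by rw [hc]; omega)
    have := h.ceil_path.pos_tgt hcU
    rw [hc] at this
    omega
  obtain ⟨hs, ht⟩ := h.net.inner_ne h.floor_exit hpq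
  have hdq : d ≠ q := by
    rintro rfl
    have := hbank d (List.mem_append_left _ (hqF hwz))
    rw [hrightV d hdV] at this
    exact one_ne_zero this
  have hcp : c = p := by
    by_contra hne
    have := h.net.third_unique (by rw [hp, hq]) hs ht (d := (c, false)) (e := (d, true))
      (hc.trans hp.symm) (hd.trans hp.symm) (by simpa using hne) (by simp) (by simp)
      (by simpa using hdq)
    simp at this
  have := hbank p (List.mem_append_left _ hpF)
  rw [hrightV p (hcp ▸ hcV)] at this
  exact one_ne_zero this

set_option maxHeartbeats 1000000 in
/-- Up to its last vertex on the ceiling, the flipped path stays in the primary strip. -/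
theorem strip_of_left {ψ : A × Bool → ℝ} (hψ : G.StripPot F X U ψ) {a : A} (ha : a ∈ P₁)
    (haU : a ∉ U) : ψ (a, true) = 1 := by
  -- The first arc `a` outside the strip starts a jump to the left from `k₀` back to an earlier
  -- ceiling vertex `k'`, which closes a directed cycle. To get out of it, the path must later leave
  -- the ceiling part of the cycle to the right, at `g`, and jump to a ceiling vertex `g'` beyond
  -- `k₀`. The region below the ceiling between `g` and `g'` is then cut off from the floor by this
  -- jump, but the path came to `k₀` from the floor before.
  by_contra hbad
  obtain ⟨Pa, a, Pb, hPab, hbad, hgood⟩ := exists_first_not (l := P₁)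
    (p := fun e => e ∉ U → ψ (e, true) = 1) ⟨a, ha, fun h' => hbad (h' haU)⟩
  push Not at hbad
  obtain ⟨haU, ha1⟩ := hbad
  clear ha
  have haP₁ : a ∈ P₁ := by rw [hPab]; simp
  have haP := h.mem_left haP₁
  have hP₁ := h.path₁
  rw [hPab] at hP₁
  obtain ⟨k₀, hPa, hk₀a⟩ := isWalk_append.1 hP₁.1
  have hak₀ : G.src a = k₀ := hk₀a.1
  have hk₀P : k₀ ∈ G.verts u P₁ := hak₀ ▸ h.walk₁.src_mem haP₁
  -- it leaves the ceiling to the left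
  have hk₀U : k₀ ∈ G.verts s U := by
    by_contra hk₀U
    by_cases hPa0 : Pa = []
    · subst hPa0
      obtain ⟨p, q, hpq, hpF, hp, hq, hl⟩ := h.exists_first_turn
      have huk : u = k₀ := hPa
      have h1 := (hψ.pot.leftAt (hl a haP (hak₀.trans huk.symm))).2.1
      rw [hψ.floor_left p hpF (fun hpU => hk₀U (huk ▸ hp ▸ tgt_mem_verts hpU))] at h1
      exact ha1 h1
    · obtain ⟨Pa, c, rfl, -, hc⟩ := hPa.exists_concat hPa0
      have hcU : c ∉ U := fun hcU => hk₀U (hc ▸ tgt_mem_verts hcU)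
      have hcP := h.mem_left (e := c) (by rw [hPab]; simp)
      have h1 := hgood c (by simp) hcU
      have hk₀F : k₀ ∉ G.verts s F := fun hF =>
        h.tgt_ne_start hcP (hc.trans (h.eq_start hk₀P hF))
      have h2 := hψ.pot.const_vertex (free_of_notMem h.floor_path.1 h.ceil_path.1 hk₀F hk₀U)
        (d := (a, true)) (e := (c, false)) hak₀ hc
      rw [h2, ← hψ.pot.jump_none (h.notMem_floor hcP) hcU] at ha1
      exact ha1 h1
  have ha0 : ψ (a, true) = 0 := by
    obtain ⟨p, q, -, -, -, -, h1 | h1⟩ := h.ceil_side hψ haP haU (hak₀.symm ▸ hk₀U)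
    · exact h1.2
    · exact absurd h1.2.2 ha1
  -- the next vertex on the ceiling
  obtain ⟨N, Pc, k', hPb, h1, h2, hk'U, hintN⟩ := hk₀a.2.exists_first
    (fun w => w ∈ G.verts s U) ⟨k, hk₀a.2.end_mem, h.mem⟩
  subst hPb
  have hPsplit : P₁ = Pa ++ ((a :: N) ++ Pc) := by rw [hPab]; simp
  have hP₁' := h.path₁
  rw [hPsplit] at hP₁'
  have hwN : G.IsWalk k₀ (a :: N) k' := ⟨hak₀, h1⟩
  have hNp : G.IsPath k₀ (a :: N) k' := (hP₁'.right hPa).left hwN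
  have hNP₁ : ∀ e ∈ a :: N, e ∈ P₁ := fun e he => by
    rw [hPsplit]
    exact List.mem_append_right _ (List.mem_append_left _ he)
  have hlater : ∀ w ∈ G.verts u Pa, w ∈ ((a :: N) ++ Pc).map G.tgt → False := fun w => hP₁'.disjoint
  have hNF : ∀ e ∈ N, G.src e ∉ G.verts s F := by
    intro e he heF
    have h3 := h.eq_start (h.walk₁.src_mem (hNP₁ e (by simp [he]))) heF
    refine hlater u (start_mem_verts _ _) ?_
    rw [List.map_append, ← h3]
    exact List.mem_append_left _ (hwN.src_mem_tgt he)
  have hNU : ∀ e ∈ a :: N, e ∉ U := by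
    intro e he heU
    rcases List.mem_cons.1 he with rfl | he
    · exact haU heU
    · exact hintN e he (h.ceil_path.1.src_mem heU)
  obtain ⟨M, b, hM, -, hb⟩ := hwN.exists_concat (by simp)
  have hbN : b ∈ a :: N := by rw [hM]; simp
  have hbP₁ := hNP₁ b hbN
  have hk'k₀ : G.pos s U k' < G.pos s U k₀ := by
    have hb0 : ψ (b, false) = 0 := by
      rw [← ha0]
      exact hψ.pot.const_walk hwN (h.notMem_floor haP) haU
        (fun e he => free_of_notMem h.floor_path.1 h.ceil_path.1 (hNF e he) (hintN e he))
        b hbN true false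
    obtain ⟨p, q, hpq, -, -, -, -, h3 | h3⟩ := h.arrive_side hψ (h.mem_left hbP₁) (hNU b hbN)
      (h.tgt_left_ne hbP₁) (hb.symm ▸ hk'U)
    · exact h.pos_lt_of_left_jump hk₀U hk'U hNp hintN hbN hb hpq h3.1
    · rw [hb0] at h3
      exact absurd h3.2 zero_ne_one
  -- the cycle formed by the ceiling and the jump
  obtain ⟨U₁, U₂, U₃, hU, h3, h4, -, hne⟩ := h.ceil_path.exists_between hk'U hk₀U hk'k₀
  have hUp := h.ceil_path
  rw [hU] at hUp
  have hU₂p : G.IsPath k' U₂ k₀ := (hUp.right h3).left h4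
  have hU₂U : ∀ e ∈ U₂, e ∈ U := fun e he => by
    rw [hU]
    exact List.mem_append_right _ (List.mem_append_left _ he)
  have hmid : ∀ w ∈ G.verts s U, w ∈ G.verts k' U₂ ↔
      G.pos s U k' ≤ G.pos s U w ∧ G.pos s U w ≤ G.pos s U k₀ := by
    intro w hw
    have := hUp.mem_mid_iff h3 h4 (w := w) (by rwa [← hU])
    rwa [← hU] at this
  have hU₂v : ∀ w ∈ G.verts k' U₂, w ∈ G.verts s U := by
    intro w hw
    rcases mem_verts.1 hw with rfl | hw
    · exact hk'U
    · obtain ⟨e, he, rfl⟩ := List.mem_map.1 hw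
      exact tgt_mem_verts (hU₂U e he)
  have hZ : G.IsWalk k' (U₂ ++ a :: N) k' := h4.append hwN
  have hnd : ((U₂ ++ a :: N).map G.tgt).Nodup := by
    rw [List.map_append, List.nodup_append]
    refine ⟨hU₂p.tgt_nodup, hNp.tgt_nodup, ?_⟩
    rintro x hx x' hx' rfl
    rcases hNp.tgt_cases hx' with hxk | hxN
    · exact hU₂p.start_notMem (hxk ▸ hx)
    · obtain ⟨e, he, rfl⟩ := List.mem_map.1 hxN
      exact hintN e he (hU₂v _ (mem_verts.2 (.inr hx)))
  have hk'z : G.Reaches k' z := h.ceil_reaches hk'U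
  obtain ⟨φ, hφ, hφb⟩ := h.net.cycle_pot hZ (by simp) hnd (fun ht =>
    h.ne_sink_of_reaches ((hZ.reaches_end (mem_verts.2 (.inr ht))).trans hk'z) rfl)
  obtain ⟨-, hright⟩ := h.net.pot_right_bank h.floor_exit hφ (by
    intro e he
    rcases List.mem_append.1 he with he | he
    · exact h.ceil_allowed (hU₂U e he)
    · exact h.left_allowed (hNP₁ e he)) (by simp)
    (h.free_sink hZ (show G.IsWalk k' [] k' from rfl) hk'z hk'z)
  -- the last vertex of the flipped path on the cycle
  obtain ⟨Pd, Pe, g, hPc, h5, h6, hgU₂, hgl⟩ := h2.exists_last (fun w => w ∈ G.verts k' U₂)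
    ⟨k', start_mem_verts _ _, start_mem_verts _ _⟩
  subst hPc
  have hgU := hU₂v g hgU₂
  have hgtgt : g ∈ ((a :: N) ++ Pd).map G.tgt := by
    have : G.IsWalk k₀ ((a :: N) ++ Pd) g := hwN.append h5
    rcases mem_verts.1 this.end_mem with hg | hg
    · exfalso
      have h7 : G.IsPath k₀ ((a :: N) ++ Pd) g := by
        have := hP₁'.right hPa
        rw [← List.append_assoc] at this
        exact this.left (hwN.append h5)
      rw [hg] at h7
      simpa using h7.eq_nil
    · exact hg
  have hgPc : g ∈ ((a :: N) ++ (Pd ++ Pe)).map G.tgt := by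
    rw [← List.append_assoc, List.map_append]
    exact List.mem_append_left _ hgtgt
  have hgPa : g ∉ G.verts u Pa := fun hg => hlater g hg hgPc
  have hgk₀ : g ≠ k₀ := fun hg => hgPa (hg ▸ hPa.end_mem)
  have hgu : g ≠ u := fun hg => hgPa (hg ▸ start_mem_verts _ _)
  have hgP₁ : g ∈ G.verts u P₁ := by
    rw [hPsplit, verts_append]
    exact List.mem_append_right _ hgPc
  have hgF : g ∉ G.verts s F := fun hF => hgu (h.eq_start hgP₁ hF)
  obtain ⟨f, T, hfT, hfg, -⟩ : ∃ f T, Pe ++ o :: O = f :: T ∧ G.src f = g ∧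
      G.IsWalk (G.tgt f) T v := (h6.append h.walk₂).exists_cons (by simp)
  have hPsplit' : P = (Pa ++ ((a :: N) ++ Pd)) ++ f :: T := by
    rw [h.eq, hPsplit, ← hfT]
    simp
  have hfP : f ∈ P := by rw [hPsplit']; simp
  have hwT : G.IsWalk g (f :: T) v := hfT ▸ h6.append h.walk₂
  have hTU₂ : ∀ e ∈ T, G.src e ∉ G.verts k' U₂ := by
    intro e he
    have h7 := hwT.src_mem_tgt he
    have h8 : G.src e ∈ Pe.map G.tgt ∨ e ∈ O := by
      cases Pe with
      | nil =>
        simp only [List.nil_append, List.cons.injEq] at hfT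
        exact .inr (hfT.2 ▸ he)
      | cons f' Pe =>
        simp only [List.cons_append, List.cons.injEq] at hfT
        rw [← hfT.2, List.mem_append, List.mem_cons] at he
        have h6' : G.IsWalk g (f' :: Pe) k := h6
        rcases he with he | rfl | he
        · exact .inl (h6'.src_mem_tgt he)
        · left
          rw [h.src_depart]
          rcases mem_verts.1 h6'.end_mem with h9 | h9
          · exfalso
            have h10 : G.IsPath g (f' :: Pe) k := by
              have := hP₁'
              rw [show Pa ++ (a :: N ++ (Pd ++ f' :: Pe)) =
                (Pa ++ ((a :: N) ++ Pd)) ++ f' :: Pe by simp] at this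
              exact this.right (hPa.append (hwN.append h5))
            rw [h9] at h10
            simpa using h10.eq_nil
          · exact h9
        · exact .inr he
    rcases h8 with h8 | h8
    · obtain ⟨e', he', hee'⟩ := List.mem_map.1 h8
      rw [← hee']
      exact hgl e' he'
    · exact fun h9 => h.off e h8 (hU₂v _ h9)
  have hPp := h.path
  rw [hPsplit'] at hPp
  have hTN : ∀ e ∈ T, G.src e ∉ G.verts k₀ (a :: N) := by
    intro e he h7
    refine hPp.disjoint (w := G.src e) ?_ (hwT.src_mem_tgt he)
    rw [verts_append, List.map_append]
    rcases mem_verts.1 h7 with h8 | h8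
    · exact List.mem_append_left _ (h8 ▸ hPa.end_mem)
    · exact List.mem_append_right _ (List.mem_append_left _ h8)
  have hfU : f ∉ U := by
    intro hfU
    have h7 : g ∈ U₂.map G.src := by
      have := hgU₂
      rw [h4.verts_eq, List.mem_append, List.mem_singleton] at this
      exact this.resolve_right hgk₀
    obtain ⟨e, he, heg⟩ := List.mem_map.1 h7
    have : e = f := h.ceil_path.eq_of_src_eq (hU₂U e he) hfU (heg.trans hfg.symm)
    subst this
    have h8 : G.tgt e ∈ G.verts k' U₂ := tgt_mem_verts he
    cases T with
    | nil => exact (h.last_rightOf hfP hwT.2).2 hfU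
    | cons c T =>
      apply hTU₂ c (by simp)
      rwa [show G.src c = G.tgt e from hwT.2.1]
  have hfN : f ∉ a :: N := by
    intro hfN
    have := hPp.nodup
    rw [List.nodup_append] at this
    exact this.2.2 f (by simp only [List.mem_append]; exact .inr (.inl hfN)) f (by simp) rfl
  have hφf : φ (f, true) = 0 := h.tail_eq_zero hφ (fun d hd => (hright d hd).1) hPsplit' hwT
    (fun hf => (List.mem_append.1 hf).elim (fun hf => hfU (hU₂U f hf)) hfN) (by simp) (by
      intro e he
      rintro c (hc | hc)
      · rcases List.mem_append.1 hc with hc | hc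
        · exact ⟨fun h7 => hTU₂ e he (h7 ▸ h4.src_mem hc),
            fun h7 => hTU₂ e he (h7 ▸ tgt_mem_verts hc)⟩
        · exact ⟨fun h7 => hTN e he (h7 ▸ hwN.src_mem hc),
            fun h7 => hTN e he (h7 ▸ tgt_mem_verts hc)⟩
      · simp at hc)
  -- there the flipped path leaves the ceiling to the right
  obtain ⟨p, q, hpq, hpU, hp, hq, hside⟩ := h.ceil_side hψ hfP hfU (hfg.symm ▸ hgU)
  rw [hfg] at hp hq hside
  obtain ⟨hs, ht⟩ := h.net.inner_ne h.ceil_exit hpq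
  -- A departure to the left would start inside the cycle, with value 1, against `hφf`.
  have hRight : G.RightAt p q (f, true) ∧ ψ (f, true) = 1 := by
    rcases hside with h7 | h7
    · exfalso
      have h8 := (hφ.leftAt h7.1).2.1
      rw [hφf] at h8
      have hgk' : g ≠ k' := by
        intro hgk'
        have hpb : (b, false) ≠ (p, false) := by
          intro hbp
          simp only [Prod.mk.injEq, and_true] at hbp
          exact hNU b hbN (hbp ▸ hpU)
        have := h.net.third_unique (by rw [hp, hq]) hs ht (d := (b, false)) (e := (f, true))
          (by rw [hp, hgk']; exact hb) (hfg.trans hp.symm) hpb (by simp)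
          h7.1.ne_left h7.1.ne_right
        simp at this
      have hpU₂ : p ∈ U₂ := by
        rcases mem_verts.1 hgU₂ with h9 | h9
        · exact absurd h9 hgk'
        · obtain ⟨e, he, heg⟩ := List.mem_map.1 h9
          rwa [← h.ceil_path.eq_of_tgt_eq (hU₂U e he) hpU (heg.trans hp.symm)]
      rw [(hφb p (List.mem_append_left _ hpU₂)).1] at h8
      exact zero_ne_one h8
    · exact ⟨h7.1, h7.2.2⟩
  obtain ⟨Pe', hPe, hT⟩ : ∃ Pe', Pe = f :: Pe' ∧ T = Pe' ++ o :: O := by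
    cases Pe with
    | nil =>
      exfalso
      have hfo : o = f := by
        simp only [List.nil_append, List.cons.injEq] at hfT
        exact hfT.1
      obtain ⟨p', q', hpq', -, hp', -, hl⟩ := h.turn
      have hgk : g = k := h6
      obtain ⟨rfl, rfl⟩ := h.ceil_exit.infix_unique hpq hpq' (by rw [hp, hp', hgk])
      exact hRight.1.not_leftAt (hfo ▸ hl)
    | cons f' Pe' =>
      simp only [List.cons_append, List.cons.injEq] at hfT
      exact ⟨Pe', by rw [hfT.1], hfT.2.symm⟩
  subst hPe
  obtain ⟨R, Pf, g', rfl, h7, h8, hg'U, hintR⟩ := h6.2.exists_first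
    (fun w => w ∈ G.verts s U) ⟨k, h6.2.end_mem, h.mem⟩
  have hwR : G.IsWalk g (f :: R) g' := ⟨hfg, h7⟩
  have hwPc : G.IsWalk u (Pa ++ ((a :: N) ++ Pd)) g := hPa.append (hwN.append h5)
  obtain ⟨hlt, hnoF, V₂, χ, hχ, hχr, hV₂, hV₂mem, hbank⟩ := h.right_jump_facts hψ
    (Pc := Pa ++ ((a :: N) ++ Pd)) (Pf := Pf) (by rw [hPsplit]; simp) hwPc hwR hgU hg'U hgF hfU
    hRight.2 hintR
  have hg'R : g' ∈ (f :: R).map G.tgt := by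
    obtain ⟨L, c, hL, -, hc⟩ := hwR.exists_concat (by simp)
    rw [hL, ← hc]
    simp
  have hg'U₂ : g' ∉ G.verts k' U₂ := by
    obtain ⟨c, hc, rfl⟩ := List.mem_map.1 hg'R
    refine hgl c ?_
    rw [← List.cons_append]
    exact List.mem_append_left _ hc
  have hgpos := (hmid g hgU).1 hgU₂
  have hgk₀' : G.pos s U g < G.pos s U k₀ := by
    rcases lt_or_eq_of_le hgpos.2 with h9 | h9
    · exact h9
    · exact absurd (pos_inj hgU h9) hgk₀
  have hk₀g' : G.pos s U k₀ < G.pos s U g' := by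
    by_contra h9
    exact hg'U₂ ((hmid g' hg'U).2 ⟨by omega, by omega⟩)
  -- the first vertex between `g` and `g'`
  obtain ⟨Pg, Ph, r, hPgh, h9, -, ⟨hrU, hr1, hr2⟩, hfirst⟩ := hPa.exists_first
    (fun w => w ∈ G.verts s U ∧ G.pos s U g < G.pos s U w ∧ G.pos s U w < G.pos s U g')
    ⟨k₀, hPa.end_mem, hk₀U, hgk₀', hk₀g'⟩
  have hrF := hnoF r hrU hr1 hr2
  have hru : u ≠ r := by
    rintro rfl
    exact hrF h.start_floor
  have hPgPa : ∀ e ∈ Pg, e ∈ Pa := fun e he => by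
    rw [hPgh]
    exact List.mem_append_left _ he
  have hPgP₁ : ∀ e ∈ Pg, e ∈ P₁ := fun e he => by
    rw [hPsplit]
    exact List.mem_append_left _ (hPgPa e he)
  obtain ⟨Pg', c, hPg, -, hc⟩ := h9.exists_concat (h9.ne_nil hru)
  have hcPg : c ∈ Pg := by rw [hPg]; simp
  have hcP := h.mem_left (hPgP₁ c hcPg)
  -- An arc of the ceiling into `r` would start at an admissible vertex before `r`, or at `g`, which
  -- does not lie on `Pa`.
  have hcU : c ∉ U := by
    intro hcU
    have h10 := h.ceil_path.pos_tgt hcU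
    rw [hc] at h10
    have h11 : G.src c ∈ G.verts s U := h.ceil_path.1.src_mem hcU
    have h12 : G.src c = g := by
      by_contra h12
      have h13 : G.pos s U g ≠ G.pos s U (G.src c) := fun h13 => h12 (pos_inj hgU h13).symm
      exact hfirst c hcPg ⟨h11, by omega, by omega⟩
    exact hgPa (h12 ▸ hPa.src_mem (hPgPa c hcPg))
  have hc1 := hgood c (hPgPa c hcPg) hcU
  obtain ⟨p₁, q₁, hpq₁, -, hq₁U, hp₁, hq₁, hside₁⟩ := h.arrive_side hψ hcP hcU
    (h.tgt_left_ne (hPgP₁ c hcPg)) (hc.symm ▸ hrU)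
  have hχc : χ (c, false) = 1 := by
    rcases hside₁ with h10 | h10
    · rw [← hψ.pot.jump_none (h.notMem_floor hcP) hcU, hc1] at h10
      exact absurd h10.2 one_ne_zero
    · rw [(hχ.rightAt h10.1).2.2]
      apply hχr
      have h11 := h.ceil_path.pos_tgt hq₁U
      rw [hq₁, hc] at h11
      refine hV₂mem q₁ hq₁U ?_ (by omega)
      rw [hq₁, hc]
      omega
  -- go back to the start
  obtain ⟨a₁, Pg'', hPg₁, ha₁u, -⟩ := h9.exists_cons (h9.ne_nil hru)
  have ha₁Pg : a₁ ∈ Pg := by rw [hPg₁]; simp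
  have hjoin : ∀ w ∈ G.verts u Pa, w ∉ G.verts g (f :: R) := by
    intro w hw hwR'
    refine hlater w hw ?_
    rcases mem_verts.1 hwR' with h10 | h10
    · exact h10 ▸ hgPc
    · simp only [List.map_append, List.mem_append, List.map_cons, List.mem_cons] at h10 ⊢
      tauto
  have hV₂notMem : ∀ e ∈ V₂, G.src e ∈ G.verts u Pa → G.src e ∈ G.verts s U ∧
      G.pos s U g < G.pos s U (G.src e) ∧ G.pos s U (G.src e) < G.pos s U g' := by
    intro e he hs
    obtain ⟨h10, h11, h12⟩ := hV₂ e he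
    have h13 := h.ceil_path.pos_tgt h10
    have h14 := h.ceil_path.1.src_mem h10
    have h15 : G.pos s U g ≠ G.pos s U (G.src e) := fun h15 =>
      hgPa ((pos_inj hgU h15).symm ▸ hs)
    exact ⟨h14, by omega, by omega⟩
  have hV₂notMem' : ∀ e ∈ V₂, G.tgt e ∈ G.verts u Pa → G.tgt e ∈ G.verts s U ∧
      G.pos s U g < G.pos s U (G.tgt e) ∧ G.pos s U (G.tgt e) < G.pos s U g' := by
    intro e he hs
    obtain ⟨h10, h11, h12⟩ := hV₂ e he
    have h13 := h.ceil_path.pos_tgt h10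
    have h14 : G.tgt e ∈ G.verts s U := tgt_mem_verts h10
    have h15 : G.pos s U (G.tgt e) ≠ G.pos s U g' := fun h15 =>
      hjoin _ hs ((pos_inj h14 h15) ▸ hwR.end_mem)
    exact ⟨h14, by omega, by omega⟩
  have hconst : χ (c, false) = χ (a₁, true) := by
    have hw : G.IsWalk u (a₁ :: Pg'') r := hPg₁ ▸ h9
    refine hχ.const_walk hw ?_ ?_ ?_ c (hPg₁ ▸ hcPg) true false
    · exact fun h10 => hjoin u (start_mem_verts _ _) (ha₁u ▸ hwR.src_mem h10)
    · intro h10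
      exact hfirst a₁ ha₁Pg (hV₂notMem a₁ h10 (hPa.src_mem (hPgPa _ ha₁Pg)))
    · intro e he
      have hePg : e ∈ Pg := by rw [hPg₁]; simp [he]
      have hsPa := hPa.src_mem (hPgPa e hePg)
      rintro d (hd | hd)
      · exact ⟨fun h10 => hjoin _ hsPa (h10 ▸ hwR.src_mem hd),
          fun h10 => hjoin _ hsPa (h10 ▸ tgt_mem_verts hd)⟩
      · refine ⟨fun h10 => hfirst e hePg ?_, fun h10 => hfirst e hePg ?_⟩
        · exact h10 ▸ hV₂notMem d hd (h10 ▸ hsPa)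
        · exact h10 ▸ hV₂notMem' d hd (h10 ▸ hsPa)
  obtain ⟨p₂, q₂, hpq₂, hp₂F, hp₂, hq₂, hl₂⟩ := h.exists_first_turn
  -- The floor arc `p₂` into `u` is neither on the jump nor on `V₂`, so its left value equals its
  -- right value 0, while the walk to `r` transports the value 1 back to `u`.
  have h10 := (hχ.leftAt (hl₂ a₁ (h.mem_left (hPgP₁ a₁ ha₁Pg)) ha₁u)).2.1
  have huPa : u ∈ G.verts u Pa := start_mem_verts _ _
  rw [hχ.jump_none (fun h11 => hjoin u huPa (hp₂ ▸ tgt_mem_verts h11)) (fun h11 => by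
    obtain ⟨h12, h13, h14⟩ := hV₂notMem' p₂ h11 (hp₂.symm ▸ huPa)
    exact hnoF _ h12 h13 h14 (hp₂.symm ▸ h.start_floor)),
    hbank p₂ (List.mem_append_left _ hp₂F), ← hconst, hχc] at h10
  exact one_ne_zero h10

end DepartSetup

/-- The ceiling borders the unbounded region of a closed curve that it does not meet again. -/
theorem Setup.ceil_eq_zero {s t z : V} {C : Set V} {F X U : List A} (h : G.Setup s t C F z X U)
    {φ : A × Bool → ℝ} {l m : List A} {x y x' y' : V} (hφ : G.Pot l m φ) (hl : G.IsWalk x l y)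
    (hm : G.IsWalk x' m y') (hy : G.Reaches y z) (hy' : G.Reaches y' z) {U₁ N : List A} {b : A}
    (hU : U = U₁ ++ b :: N) (hbl : b ∉ l) (hbm : b ∉ m)
    (hN : ∀ w ∈ (b :: N).map G.tgt, w ∉ G.verts x l ∧ w ∉ G.verts x' m) : φ (b, true) = 0 := by
  have hUz := h.ceil_path
  rw [hU] at hUz
  obtain ⟨w, h1, h2⟩ := isWalk_append.1 hUz.1
  have hw : G.IsWalk w (b :: (N ++ X)) t := h2.append h.exit_path.1
  have hfree : ∀ e ∈ N ++ X, G.Free {c | c ∈ l ∨ c ∈ m} (G.src e) := by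
    intro e he
    have := hw.src_mem_tgt he
    have h3 : G.src e ∈ (b :: N).map G.tgt ∨ G.src e ∈ X.map G.tgt := by
      rw [← List.cons_append, List.map_append, List.mem_append] at this
      exact this
    rcases h3 with h3 | h3
    · exact free_of_notMem hl hm (hN _ h3).1 (hN _ h3).2
    · refine free_of_notMem hl hm ?_ ?_
      · exact fun h4 => h.not_reaches h3 ((hl.reaches_end h4).trans hy)
      · exact fun h4 => h.not_reaches h3 ((hm.reaches_end h4).trans hy')
  refine h.net.pot_eq_zero_of_walk hφ ?_ hw hbl hbm hfree b (by simp) true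
  exact free_of_notMem hl hm (fun h4 => h.not_reaches h.sink_mem ((hl.reaches_end h4).trans hy))
    (fun h4 => h.not_reaches h.sink_mem ((hm.reaches_end h4).trans hy'))

/-! ### The departure vertex compared with common vertices of floor and ceiling -/

namespace DepartSetup

variable {s t z u v k : V} {C : Set V} {F X U P P₁ O : List A} {o : A}
  (h : G.DepartSetup s t C F z X U u P v P₁ o O k)
include h

theorem end_reaches : G.Reaches k z := h.ceil_reaches h.mem

variable [Finite A] [Finite V]

/-- A floor vertex of the ceiling up to the start of the flipped path comes before its last
vertex on the ceiling. -/
theorem pos_le_of_floor {w : V} (hwF : w ∈ G.verts s F) (hwU : w ∈ G.verts s U)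
    (hwu : G.pos s F w ≤ G.pos s F u) : G.pos s U w ≤ G.pos s U k := by
  have hFp := h.floor_path
  have hUp := h.ceil_path
  by_cases huU : u ∈ G.verts s U
  · refine le_trans ?_ (h.pos_le (start_mem_verts _ _) huU)
    by_contra hlt
    have := (h.pos_lt_iff huU hwU h.start_floor hwF).1 (by omega)
    omega
  obtain ⟨F₁, F₂, hF, hF₁, hF₂⟩ := hFp.1.exists_split h.start_floor
  obtain ⟨Fa, Fc, g, hF₁', hFa, hFc, hgU, hlast⟩ := hF₁.exists_last (· ∈ G.verts s U)
    ⟨s, start_mem_verts _ _, start_mem_verts _ _⟩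
  have hFsplit : F = Fa ++ (Fc ++ F₂) := by rw [hF, hF₁']; simp
  have hFp' := hFp
  rw [hFsplit] at hFp'
  have hgF : g ∈ G.verts s F := by
    rw [hFsplit]
    exact verts_subset_append hFa.end_mem
  have hcommon : ∀ w ∈ G.verts s U, w ∈ G.verts s F₁ → G.pos s U w ≤ G.pos s U g := by
    intro w hw hw₁
    have hwF : w ∈ G.verts s F := by
      rw [hF]
      exact verts_subset_append hw₁
    rw [hF₁', verts_append, List.mem_append] at hw₁
    rcases hw₁ with h1 | h1
    · have h2 := (hFp'.mem_left_iff hFa).1 h1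
      rw [← hFsplit] at h2
      by_contra hlt
      have := (h.pos_lt_iff hgU hw hgF hwF).1 (by omega)
      omega
    · obtain ⟨e, he, rfl⟩ := List.mem_map.1 h1
      exact absurd hw (hlast e he)
  have hwF₁ : w ∈ G.verts s F₁ := by
    have := hFp
    rw [hF] at this hwu
    exact (this.mem_left_iff hF₁).2 hwu
  refine (hcommon w hwU hwF₁).trans ?_
  -- Suppose the last common vertex `g` before `u` lay beyond `k` on the ceiling, and compare the
  -- curve floor, then `P₁`, with the ceiling up to `k`. The ceiling leaves `g` to the left of a
  -- floor arc of left value 1, but after `g` it avoids the curve and leads to the sink, so the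
  -- value is 0.
  by_contra! hlt
  have hgu : g ≠ u := fun h1 => huU (h1 ▸ hgU)
  obtain ⟨q, Fd, rfl, hqg, -⟩ := hFc.exists_cons (hFc.ne_nil hgu)
  have hqF : q ∈ F := by rw [hFsplit]; simp
  have hqU : q ∉ U := fun h1 => hlast q (by simp) (tgt_mem_verts h1)
  have hgs : g ≠ s := by
    rintro rfl
    exact hqU (h.mem_of_src_eq hUp hqg)
  have hgz : g ≠ z := by
    rintro rfl
    exact hFp.end_notMem (List.mem_map.2 ⟨q, hqF, hqg⟩)
  obtain ⟨Fe, p, rfl, hFe, hpg⟩ := hFa.exists_concat (hFa.ne_nil hgs.symm)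
  have hpq : [p, q] <:+: F ++ X := by
    rw [hFsplit]
    exact ⟨Fe, Fd ++ F₂ ++ X, by simp⟩
  obtain ⟨U₁, U₂, hU, hU₁, hU₂⟩ := hUp.1.exists_split hgU
  obtain ⟨b, N, rfl, hbg, hN⟩ := hU₂.exists_cons (hU₂.ne_nil hgz)
  have hbU : b ∈ U := by rw [hU]; simp
  have hbF : b ∉ F := by
    intro h1
    have : b = q := hFp.eq_of_src_eq h1 hqF (hbg.trans hqg.symm)
    exact hqU (this ▸ hbU)
  have hleft : G.LeftAt p q (b, true) := by
    refine h.floor_third hpq hpg (by rw [vert_true, hbg]) (by simp) ?_ (h.ceil_allowed hbU).1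
    intro h1
    have h2 : b = q := congrArg Prod.fst h1
    exact hqU (h2 ▸ hbU)
  obtain ⟨Ua, Ub, hUk, hUa, hUb⟩ := hUp.1.exists_split h.mem
  have hl : G.IsWalk s (F₁ ++ P₁) k := hF₁.append h.walk₁
  have hUak : G.IsPath s (Ua ++ Ub) z := hUk ▸ hUp
  have hUag : ∀ w ∈ G.verts s U, G.pos s U k < G.pos s U w → w ∉ G.verts s Ua := by
    intro w _ hw hwa
    have := (hUak.mem_left_iff hUa).1 hwa
    rw [← hUk] at this
    omega
  have hP₁k : ∀ w ∈ G.verts s U, G.pos s U k < G.pos s U w → w ∉ G.verts u P₁ := by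
    intro w hw hwk hwP
    have := h.pos_le hwP hw
    omega
  have hpathl : G.IsPath s (F₁ ++ P₁) k := by
    have h1 : G.IsPath s F₁ u := IsPath.left (hF ▸ hFp) hF₁
    refine h1.append h.path₁ ?_
    intro w hw hwP
    have : w = u := h.eq_start (mem_verts.2 (.inr hwP)) (by rw [hF]; exact verts_subset_append hw)
    exact h.path₁.start_notMem (this ▸ hwP)
  obtain ⟨φ, hφ⟩ := exists_pot hl hUa hpathl.nodup (hUak.left hUa).nodup
  have hbank := (h.net.pot_right_bank h.floor_exit hφ
    (by
      intro a ha
      rcases List.mem_append.1 ha with h1 | h1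
      · exact h.floor_allowed (by rw [hF]; exact List.mem_append_left _ h1)
      · exact h.left_allowed h1)
    (fun a ha => h.ceil_allowed (by rw [hUk]; exact List.mem_append_left _ ha))
    (h.free_sink hl hUa h.end_reaches h.end_reaches)).1
  have hp1 : φ (p, true) = 1 := by
    have h1 : p ∈ F₁ ++ P₁ := by rw [hF₁']; simp
    have h2 : p ∉ Ua := fun h2 => hUag g hgU hlt (hpg ▸ tgt_mem_verts h2)
    rw [hφ.jump_left h1 h2, hbank p (mem_of_infix_left hpq), zero_add]
  have hb0 : φ (b, true) = 0 := by
    refine h.ceil_eq_zero hφ hl hUa h.end_reaches h.end_reaches hU ?_ ?_ ?_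
    · intro h1
      rcases List.mem_append.1 h1 with h1 | h1
      · exact hbF (by rw [hF]; exact List.mem_append_left _ h1)
      · exact hP₁k g hgU hlt (hbg ▸ h.walk₁.src_mem h1)
    · exact fun h1 => hUag g hgU hlt (hbg ▸ hUa.src_mem h1)
    · intro w hw
      have hwU : w ∈ G.verts s U := by
        rw [hU, verts_append]
        exact List.mem_append_right _ hw
      have hgw : G.pos s U g < G.pos s U w := by
        have := hUp
        rw [hU] at this hwU ⊢
        exact (this.mem_right_iff hU₁ hwU).1 hw
      refine ⟨?_, hUag w hwU (hlt.trans hgw)⟩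
      rw [verts_append, List.mem_append]
      rintro (h1 | h1)
      · have := hcommon w hwU h1
        omega
      · exact hP₁k w hwU (hlt.trans hgw) (mem_verts.2 (.inr h1))
  have := (hφ.leftAt hleft).2.1
  rw [hb0, hp1] at this
  exact zero_ne_one this

/-- If the flipped path starts off the ceiling, its last vertex on the ceiling precedes every
later floor vertex of the ceiling. -/
theorem lt_pos_of_floor (huU : u ∉ G.verts s U) {w : V} (hwF : w ∈ G.verts s F)
    (hwU : w ∈ G.verts s U) (hwu : G.pos s F u < G.pos s F w) : G.pos s U k < G.pos s U w := by
  -- If `w` came before `k` on the ceiling, `P₁` would have a first ceiling vertex `r` beyond `w`.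
  -- The curve floor to `u`, then `P₁` to `r`, is compared with the ceiling up to `r`: its potential
  -- is -1 on the left of the ceiling between `w` and `r`, and 0 after `r`, although `P₁` reaches
  -- `r` from the right and leaves the left bank intact.
  by_contra! hle
  have hFp := h.floor_path
  have hUp := h.ceil_path
  have hlt : G.pos s U w < G.pos s U k := by
    refine lt_of_le_of_ne hle fun h1 => ?_
    have hwk : w = k := pos_inj hwU h1
    exact huU (h.eq_start h.walk₁.end_mem (hwk ▸ hwF) ▸ h.mem)
  obtain ⟨ψ, hψ⟩ := h.exists_stripPot
  obtain ⟨Pa, Pb, r, hP₁, hPa, hPb, ⟨hrU, hwr⟩, hfirst⟩ := h.walk₁.exists_first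
    (fun y => y ∈ G.verts s U ∧ G.pos s U w < G.pos s U y) ⟨k, h.walk₁.end_mem, h.mem, hlt⟩
  have hPaP : ∀ e ∈ Pa, e ∈ P₁ := fun e he => by rw [hP₁]; exact List.mem_append_left _ he
  have hrP : r ∈ G.verts u P₁ := by rw [hP₁]; exact verts_subset_append hPa.end_mem
  have hru : u ≠ r := fun h1 => huU (h1 ▸ hrU)
  have hrF : r ∉ G.verts s F := fun h1 => hru (h.eq_start hrP h1).symm
  have hPap : G.IsPath u Pa r := IsPath.left (hP₁ ▸ h.path₁) hPa
  have hafter : ∀ y ∈ G.verts s U, G.pos s U w < G.pos s U y → y ∈ G.verts u Pa → y = r := by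
    intro y hy hwy hyP
    rw [hPa.verts_eq, List.mem_append] at hyP
    rcases hyP with h1 | h1
    · obtain ⟨e, he, rfl⟩ := List.mem_map.1 h1
      exact absurd ⟨hy, hwy⟩ (hfirst e he)
    · exact List.mem_singleton.1 h1
  obtain ⟨Pc, e, hPc, hPc', her⟩ := hPa.exists_concat (hPa.ne_nil hru)
  have hePa : e ∈ Pa := by rw [hPc]; simp
  have heP₁ := hPaP e hePa
  have heP := h.mem_left heP₁
  have heU : e ∉ U := by
    intro h1
    have h2 := hUp.pos_tgt h1
    rw [her] at h2
    have h3 : G.src e ∈ G.verts s U := hUp.1.src_mem h1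
    have h4 : G.pos s U w = G.pos s U (G.src e) := by
      by_contra h4
      exact hfirst e hePa ⟨h3, by omega⟩
    have h5 : w = G.src e := pos_inj hwU h4
    have h6 : w ∈ G.verts u P₁ := h5 ▸ h.walk₁.src_mem heP₁
    exact huU (h.eq_start h6 hwF ▸ hwU)
  obtain ⟨Fa, Fb, hF, hFa, hFb⟩ := hFp.1.exists_split h.start_floor
  obtain ⟨Ur, Us, hU, hUr, hUs⟩ := hUp.1.exists_split hrU
  have hUrs : G.IsPath s (Ur ++ Us) z := hU ▸ hUp
  have hFab : G.IsPath s (Fa ++ Fb) z := hF ▸ hFp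
  have hFa_after : ∀ y ∈ G.verts s U, G.pos s U w ≤ G.pos s U y → y ∉ G.verts s Fa := by
    intro y hy hwy hyF
    have h1 := (hFab.mem_left_iff hFa).1 hyF
    rw [← hF] at h1
    have hyF' : y ∈ G.verts s F := by rw [hF]; exact verts_subset_append hyF
    have := (h.pos_lt_iff hy hwU hyF' hwF).2 (by omega)
    omega
  have hl : G.IsWalk s (Fa ++ Pa) r := hFa.append hPa
  have hpathl : G.IsPath s (Fa ++ Pa) r := by
    refine (hFab.left hFa).append hPap ?_
    intro y hy hyP
    have hyu : y = u := h.eq_start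
      (by rw [hP₁]; exact verts_subset_append (mem_verts.2 (.inr hyP)))
      (by rw [hF]; exact verts_subset_append hy)
    exact hPap.start_notMem (hyu ▸ hyP)
  have hrz := h.ceil_reaches hrU
  obtain ⟨χ, hχ⟩ := exists_pot hl hUr hpathl.nodup (hUrs.left hUr).nodup
  have hbank := (h.net.pot_right_bank h.floor_exit hχ
    (by
      intro a ha
      rcases List.mem_append.1 ha with h1 | h1
      · exact h.floor_allowed (by rw [hF]; exact List.mem_append_left _ h1)
      · exact h.left_allowed (hPaP a h1))
    (fun a ha => h.ceil_allowed (by rw [hU]; exact List.mem_append_left _ ha))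
    (h.free_sink hl hUr hrz hrz)).1
  have hws : w ≠ s := by
    rintro rfl
    rw [pos_start] at hwu
    omega
  have hwz : w ≠ z := by
    rintro rfl
    rw [hUp.pos_end] at hlt
    have := pos_le_length h.mem
    omega
  obtain ⟨p, q, hpq, hpF, hpw, hqw, hqF, -⟩ := h.exists_turn hFp hwF hws
  obtain ⟨p', q', hpq', hpU', hpw', hqw', hqU', -⟩ := h.exists_turn hUp hwU hws
  replace hqF := hqF hwz
  replace hqU' := hqU' hwz
  have hqr : q' ∈ Ur := by
    have h1 := hUp.pos_tgt hqU'
    rw [hqw'] at h1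
    rw [hU, List.mem_append] at hqU'
    refine hqU'.resolve_right fun h2 => ?_
    have h3 : G.src q' ∈ G.verts r Us := hUs.src_mem h2
    rw [hqw'] at h3
    rcases mem_verts.1 h3 with h3 | h3
    · rw [h3] at hwr
      omega
    · have hwU2 := hwU
      rw [hU] at hwU2 hwr
      have := (hUrs.mem_right_iff hUr hwU2).1 h3
      omega
  have hnotl : ∀ a ∈ F, (G.src a = w ∨ G.tgt a = w) → a ∉ Fa ++ Pa := by
    intro a haF haw h1
    rcases List.mem_append.1 h1 with h1 | h1
    · have hwFa := hFa_after w hwU le_rfl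
      rcases haw with h2 | h2
      · exact hwFa (h2 ▸ hFa.src_mem h1)
      · exact hwFa (h2 ▸ tgt_mem_verts h1)
    · exact h.notMem_floor (h.mem_left (hPaP a h1)) haF
  -- Only the ceiling contributes a jump at `w`, and the right bank of the floor has value 0. If the
  -- ceiling leaves the floor at `w`, the value is read off the arc into `w` that both share.
  have hq' : χ (q', true) = -1 := by
    by_cases hqq : q' = q
    · rw [hqq] at hqr ⊢
      rw [hχ.jump_right (hnotl q hqF (.inl hqw)) hqr, hbank q (mem_of_infix_right hpq), zero_sub]
    · have hleft : G.LeftAt p q (q', true) :=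
        h.floor_third hpq hpw (by rw [vert_true, hqw']) (by simp) (by simpa using hqq)
          (h.ceil_allowed hqU').1
      have hpp : p' = p := by
        by_contra hne
        obtain ⟨hs, ht⟩ := h.net.inner_ne h.floor_exit hpq
        have := h.net.third_unique (hqw.trans hpw.symm) hs ht (d := (q', true)) (e := (p', false))
          (hqw'.trans hpw.symm) (hpw'.trans hpw.symm) (by simp) (by simpa using hqq)
          (by simpa using hne) (by simp)
        simp at this
      have hpr : p ∈ Ur := by
        rw [← hpp]
        rw [hU, List.mem_append] at hpU'
        refine hpU'.resolve_right fun h2 => ?_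
        have hwU2 := hwU
        rw [hU] at hwU2 hwr
        have := (hUrs.mem_right_iff hUr hwU2).1 (List.mem_map.2 ⟨p', h2, hpw'⟩)
        omega
      rw [(hχ.leftAt hleft).2.1, hχ.jump_right (hnotl p hpF (.inr hpw)) hpr,
        hbank p (mem_of_infix_left hpq), zero_sub]
  obtain ⟨Ua, Ub, hUab, hUa, hUb⟩ := (hUrs.left hUr).1.exists_split (w := w) (by
    have := (hUrs.mem_left_iff (a := w) hUr).2 (by rw [← hU]; omega)
    exact this)
  have hUabs : U = Ua ++ (Ub ++ Us) := by rw [hU, hUab]; simp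
  have hUabp : G.IsPath s (Ua ++ (Ub ++ Us)) z := hUabs ▸ hUp
  have hq'b : q' ∈ Ub := by
    rw [hUab, List.mem_append] at hqr
    refine hqr.resolve_left fun h1 => ?_
    exact (hUabp.left hUa).end_notMem (List.mem_map.2 ⟨q', h1, hqw'⟩)
  have hUbpos : ∀ y ∈ Ub.map G.tgt, y ∈ G.verts s U ∧ G.pos s U w < G.pos s U y := by
    intro y hy
    have h1 : y ∈ G.verts s U := by
      rw [hUabs, verts_append, List.map_append]
      exact List.mem_append_right _ (List.mem_append_left _ hy)
    refine ⟨h1, ?_⟩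
    rw [hUabs] at h1 ⊢
    exact (hUabp.mem_right_iff hUa h1).1 (by rw [List.map_append]; exact List.mem_append_left _ hy)
  have hUbr : G.IsPath w Ub r := (hUab ▸ hUrs.left hUr).right hUa
  have hbankU := h.net.left_bank hχ h.ceil_exit (M := Ub) ⟨Ua, Us ++ X, by rw [hUabs]; simp⟩ (by
    intro p₂ q₂ hpq₂ a haY ha
    have hp₂ := hUbpos _ (List.mem_map.2 ⟨p₂, mem_of_infix_left hpq₂, rfl⟩)
    have hp₂r : G.tgt p₂ ≠ r := by
      intro h1
      have h2 := hUb.src_eq_of_infix hpq₂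
      exact hUbr.end_notMem (List.mem_map.2 ⟨q₂, mem_of_infix_right hpq₂, h2.trans h1⟩)
    refine ⟨?_, fun h1 => haY (List.mem_append_left _ (by rw [hU]; exact List.mem_append_left _ h1))⟩
    rw [List.mem_append]
    rintro (h1 | h1)
    · have := hFa_after _ hp₂.1 hp₂.2.le
      rcases ha with h2 | h2
      · exact this (h2 ▸ hFa.src_mem h1)
      · exact this (h2 ▸ tgt_mem_verts h1)
    · have := hafter _ hp₂.1 hp₂.2
      rcases ha with h2 | h2
      · exact hp₂r (this (h2 ▸ hPa.src_mem h1))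
      · exact hp₂r (this (h2 ▸ tgt_mem_verts h1)))
  -- By `strip_of_left` the arc `e` runs in the strip, so it arrives at the ceiling from below.
  have he1 : ψ (e, false) = 1 := by
    have := hψ.pot.jump_none (h.notMem_floor heP) heU
    rw [← this, h.strip_of_left hψ heP₁ heU]
  obtain ⟨p₁, q₁, hpq₁, hp₁U, hq₁U, hp₁, hq₁, hside⟩ :=
    h.arrive_side hψ heP heU (h.tgt_left_ne heP₁) (her ▸ hrU)
  rw [her] at hp₁ hq₁
  have hright : G.RightAt p₁ q₁ (e, false) := by
    rcases hside with h1 | h1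
    · rw [he1] at h1
      exact absurd h1.2 one_ne_zero
    · exact h1.1
  have hp₁b : p₁ ∈ Ub := by
    obtain ⟨Ud, p₃, hUd, -, hp₃⟩ := hUb.exists_concat
      (hUb.ne_nil (fun h1 => by rw [h1] at hwr; omega))
    have hp₃b : p₃ ∈ Ub := by rw [hUd]; simp
    have : p₁ = p₃ := hUp.eq_of_tgt_eq hp₁U (by rw [hUabs]; simp [hp₃b]) (hp₁.trans hp₃.symm)
    rw [this]
    exact hp₃b
  have hrz' : r ≠ z := fun h1 => hrF (h1 ▸ hFp.1.end_mem)
  obtain ⟨q₃, N, hUsq, hq₃, -⟩ := hUs.exists_cons (hUs.ne_nil hrz')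
  have hqq₃ : q₁ = q₃ :=
    hUp.eq_of_src_eq hq₁U (by rw [hU, hUsq]; simp) (hq₁.trans hq₃.symm)
  rw [← hqq₃] at hUsq
  have hq0 : χ (q₁, true) = 0 := by
    refine h.ceil_eq_zero hχ hl hUr hrz hrz (U₁ := Ur) (N := N) (by rw [hU, hUsq]) ?_ ?_ ?_
    · exact fun h1 => hpathl.end_notMem (List.mem_map.2 ⟨q₁, h1, hq₁⟩)
    · exact fun h1 => (hUrs.left hUr).end_notMem (List.mem_map.2 ⟨q₁, h1, hq₁⟩)
    · intro y hy
      rw [← hUsq] at hy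
      have hyU : y ∈ G.verts s U := by
        rw [hU, verts_append]
        exact List.mem_append_right _ hy
      have hry : G.pos s U r < G.pos s U y := by
        rw [hU] at hyU ⊢
        exact (hUrs.mem_right_iff hUr hyU).1 hy
      constructor
      · rw [verts_append, List.mem_append]
        rintro (h1 | h1)
        · exact hFa_after y hyU (hwr.trans hry).le h1
        · have := hafter y hyU (hwr.trans hry) (mem_verts.2 (.inr h1))
          rw [this] at hry
          omega
      · exact fun h1 => hUrs.disjoint h1 hy
  have := (hχ.rightAt hright).1
  rw [hq0, hbankU p₁ hp₁b q' hq'b, hq'] at this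
  norm_num at this

end DepartSetup

/-! ### Humps -/

namespace Setup

variable {s t z h x : V} {C : Set V} {F X U L K : List A} (hS : G.Setup s t C F z X U)
include hS

theorem hump_floor (hH : G.IsHump s F U h x L K) :
    h ∈ G.verts s F ∧ x ∈ G.verts s F ∧ G.pos s F h < G.pos s F x ∧
      ∀ w ∈ G.verts s F, w ∈ G.verts h L ↔ G.pos s F h ≤ G.pos s F w ∧ G.pos s F w ≤ G.pos s F x := by
  obtain ⟨F₁, F₂, hF, hF₁⟩ := hH.floor_sub
  rw [List.append_assoc] at hF
  have hFp := hS.floor_path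
  rw [hF] at hFp ⊢
  have hh : h ∈ G.verts s (F₁ ++ (L ++ F₂)) := verts_subset_append hF₁.end_mem
  have hx : x ∈ G.verts s (F₁ ++ (L ++ F₂)) := by
    rw [← List.append_assoc]
    exact verts_subset_append (hF₁.append hH.floor_walk).end_mem
  have hmid : ∀ w ∈ G.verts s (F₁ ++ (L ++ F₂)), _ := fun w hw =>
    hFp.mem_mid_iff hF₁ hH.floor_walk hw
  refine ⟨hh, hx, ?_, hmid⟩
  have := (hmid x hx).1 hH.floor_walk.end_mem
  refine lt_of_le_of_ne this.1 fun h1 => hH.ends_ne (pos_inj hh h1)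

theorem hump_ceil (hH : G.IsHump s F U h x L K) :
    h ∈ G.verts s U ∧ x ∈ G.verts s U ∧
      ∀ w ∈ G.verts s U, w ∈ G.verts h K ↔ G.pos s U h ≤ G.pos s U w ∧ G.pos s U w ≤ G.pos s U x := by
  obtain ⟨U₁, U₂, hU, hU₁⟩ := hH.ceiling_sub
  rw [List.append_assoc] at hU
  have hUp := hS.ceil_path
  rw [hU] at hUp ⊢
  refine ⟨verts_subset_append hU₁.end_mem, ?_, fun w hw =>
    hUp.mem_mid_iff hU₁ hH.ceiling_walk hw⟩
  rw [← List.append_assoc]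
  exact verts_subset_append (hU₁.append hH.ceiling_walk).end_mem

/-- Where the floor and the ceiling meet again, no other arcs are attached. -/
theorem merge [Finite A] {w : V} {p p' : A} (hp : p ∈ F) (hpU : p ∉ U) (hp' : p' ∈ U)
    (hpw : G.tgt p = w) (hpw' : G.tgt p' = w) :
    (∀ a, G.src a = w → a ∈ F ++ X) ∧ ∀ a, G.tgt a = w → a ∈ F ∨ a ∈ U := by
  have hwF : w ∈ G.verts s F := hpw ▸ tgt_mem_verts hp
  have hws : w ≠ s := hpw ▸ hS.net.source_in p
  obtain ⟨p₁, q, hpq, hp₁, hp₁w, hqw, -, -⟩ := hS.exists_turn hS.floor_path hwF hws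
  have : p₁ = p := hS.floor_path.eq_of_tgt_eq hp₁ hp (hp₁w.trans hpw.symm)
  subst this
  obtain ⟨hs, ht⟩ := hS.net.inner_ne hS.floor_exit hpq
  have hne : p' ≠ p₁ := fun h1 => hpU (h1 ▸ hp')
  have key : ∀ d, G.vert d = w → d ≠ (p₁, false) → d ≠ (q, true) → d = (p', false) :=
    fun d hd h1 h2 => hS.net.third_unique (hqw.trans hp₁w.symm) hs ht (hd.trans hp₁w.symm)
      (hpw'.trans hp₁w.symm) h1 h2 (by simpa using hne) (by simp)
  constructor
  · intro a ha
    by_contra haF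
    have := key (a, true) ha (by simp) (by
      intro h1
      have h2 : a = q := congrArg Prod.fst h1
      exact haF (h2 ▸ mem_of_infix_right hpq))
    simp at this
  · intro a ha
    by_contra! haFU
    have := key (a, false) ha (by
      intro h1
      have h2 : a = p₁ := congrArg Prod.fst h1
      exact haFU.1 (h2 ▸ hp)) (by simp)
    have h2 : a = p' := congrArg Prod.fst this
    exact haFU.2 (h2 ▸ hp')

theorem hump_end [Finite A] (hH : G.IsHump s F U h x L K) :
    (∀ a, G.src a = x → a ∈ F ++ X) ∧ ∀ a, G.tgt a = x → a ∈ F ∨ a ∈ U := by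
  obtain ⟨L', p, hL, -, hp⟩ := hH.floor_walk.exists_concat (hH.floor_walk.ne_nil hH.ends_ne)
  obtain ⟨K', p', hK, -, hp'⟩ := hH.ceiling_walk.exists_concat (hH.ceiling_walk.ne_nil hH.ends_ne)
  have hpL : p ∈ L := by rw [hL]; simp
  have hpK : p' ∈ K := by rw [hK]; simp
  obtain ⟨F₁, F₂, hF, -⟩ := hH.floor_sub
  obtain ⟨U₁, U₂, hU, -⟩ := hH.ceiling_sub
  have hpU : p' ∈ U := by rw [hU]; simp [hpK]
  refine hS.merge (by rw [hF]; simp [hpL]) (fun h1 => ?_) hpU hp hp'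
  have : p = p' := hS.ceil_path.eq_of_tgt_eq h1 hpU (hp.trans hp'.symm)
  exact hH.arc_disjoint p hpL (this ▸ hpK)

variable [Finite A] [Finite V]

/-- The inner vertices of the floor of a hump are not on the ceiling. -/
theorem hump_inner (hH : G.IsHump s F U h x L K) {w : V} (hw : w ∈ G.verts h L)
    (hwF : w ∈ G.verts s F) (hh : w ≠ h) (hx : w ≠ x) : w ∉ G.verts s U := by
  intro hwU
  obtain ⟨h1, h2, -, h3⟩ := hS.hump_floor hH
  obtain ⟨h4, h5, h6⟩ := hS.hump_ceil hH
  have h7 := (h3 w hwF).1 hw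
  have h8 := hS.pos_lt_iff hwU h4 hwF h1
  have h9 := hS.pos_lt_iff h5 hwU h2 hwF
  rcases hH.inner_disjoint w hw ((h6 w hwU).2 ⟨by omega, by omega⟩) with h10 | h10
  · exact hh h10
  · exact hx h10

/-- The floor vertices in a hump are on the floor of the hump. -/
theorem mem_floor_of_mem_strip (hH : G.IsHump s F U h x L K) {w : V} (hw : w ∈ G.stripVerts h L K)
    (hwF : w ∈ G.verts s F) : w ∈ G.verts h L := by
  obtain ⟨h1, h2, -, h3⟩ := hS.hump_floor hH
  obtain ⟨h4, h5, h6⟩ := hS.hump_ceil hH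
  rcases hw with hw | hw | hw
  · exact hw
  · obtain ⟨U₁, U₂, hU, hU₁⟩ := hH.ceiling_sub
    have hwU : w ∈ G.verts s U := by
      rw [hU]
      refine verts_subset_append ?_
      rw [verts_append, List.mem_append]
      rcases mem_verts.1 hw with rfl | hw
      · exact .inl hU₁.end_mem
      · exact .inr hw
    have h7 := (h6 w hwU).1 hw
    have h8 := hS.pos_lt_iff hwU h4 hwF h1
    have h9 := hS.pos_lt_iff h5 hwU h2 hwF
    exact (h3 w hwF).2 ⟨by omega, by omega⟩
  -- Every floor vertex is the start of an arc of `F ++ X`, whose right bank is connected to the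
  -- unbounded face, so the vertex is not enclosed.
  · exfalso
    obtain ⟨F₁, F₂, hF, hF₁⟩ := hH.floor_sub
    obtain ⟨U₁, U₂, hU, hU₁⟩ := hH.ceiling_sub
    have hxz := hS.floor_reaches h2
    have hbank := (hS.net.right_bank hS.floor_exit (S := {b | b ∈ L ∨ b ∈ K})
      (by
        rintro a (ha | ha)
        · exact hS.floor_allowed (by rw [hF]; simp [ha])
        · exact hS.ceil_allowed (by rw [hU]; simp [ha]))
      (hS.free_sink hH.floor_walk hH.ceiling_walk hxz hxz)).1
    obtain ⟨q, hq, hqw⟩ : ∃ q ∈ F ++ X, G.src q = w := by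
      have h7 : w ∈ G.verts s (F ++ X) := verts_subset_append hwF
      rw [hS.floor_exit.1.verts_eq, List.mem_append] at h7
      rcases h7 with h7 | h7
      · exact List.mem_map.1 h7
      · exact absurd (List.mem_singleton.1 h7) (hS.ne_sink_of_reaches (hS.floor_reaches hwF))
    obtain ⟨d, hd⟩ := G.rot.surjective (q, true)
    have hface := sameRegion_face (G := G) {b | b ∈ L ∨ b ∈ K} d
    rw [hd, dartFlip_mk] at hface
    refine hw d ?_ (hface.symm.trans (hbank q hq))
    rw [← vert_rot, hd, vert_true, hqw]

/-- A floor vertex off the ceiling lies in a hump. -/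
theorem exists_hump {v : V} {Fa Fm Fc : List A} (hF : F = Fa ++ (Fm ++ Fc)) (hFa : G.IsWalk s Fa v)
    (hFm : G.IsWalk v Fm x) (hvU : v ∉ G.verts s U) (hxU : x ∈ G.verts s U)
    (hfirst : ∀ e ∈ Fm, G.src e ∉ G.verts s U) :
    ∃ h L K, G.IsHump s F U h x L K ∧ v ∈ G.verts h L ∧ v ≠ h := by
  -- The hump extends from the last ceiling vertex before `v` to `x`. Its ceiling exists because the
  -- common vertices have the same order on both paths.
  obtain ⟨F₁, L₁, h, hFa', hF₁, hL₁, hhU, hlast⟩ := hFa.exists_last (· ∈ G.verts s U)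
    ⟨s, start_mem_verts _ _, start_mem_verts _ _⟩
  have hFe : F = F₁ ++ (L₁ ++ Fm) ++ Fc := by rw [hF, hFa']; simp
  have hF₁p : G.IsWalk s (F₁ ++ (L₁ ++ Fm)) x := hF₁.append (hL₁.append hFm)
  have hFp := hS.floor_path
  have hne : L₁ ≠ [] := hL₁.ne_nil fun h1 => hvU (h1 ▸ hhU)
  have hFx : G.IsPath s (F₁ ++ (L₁ ++ Fm)) x := (hFe ▸ hFp).left hF₁p
  have hxL : x ∈ (L₁ ++ Fm).map G.tgt := by
    obtain ⟨M, p, hM, -, hp⟩ := (hL₁.append hFm).exists_concat (by simp [hne])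
    rw [hM, ← hp]
    simp
  have hhF : h ∈ G.verts s F := by rw [hFe, List.append_assoc]; exact verts_subset_append hF₁.end_mem
  have hxF : x ∈ G.verts s F := by rw [hFe]; exact verts_subset_append hF₁p.end_mem
  have hhx : G.pos s F h < G.pos s F x := by
    have h1 := hFp
    rw [hFe, List.append_assoc] at h1 hxF ⊢
    exact (h1.mem_right_iff hF₁ hxF).1 (by rw [List.map_append]; exact List.mem_append_left _ hxL)
  obtain ⟨U₁, K, U₂, hU, hU₁, hK, hU₂, -⟩ :=
    hS.ceil_path.exists_between hhU hxU ((hS.pos_lt_iff hhU hxU hhF hxF).2 hhx)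
  refine ⟨h, L₁ ++ Fm, K, ⟨⟨F₁, Fc, hFe, hF₁⟩, ⟨U₁, U₂, by rw [hU]; simp, hU₁⟩, hL₁.append hFm, hK,
    ?_, ?_, ?_⟩, ?_, ?_⟩
  · rintro rfl
    omega
  · intro a ha haK
    have haU : a ∈ U := by rw [hU]; simp [haK]
    rcases List.mem_append.1 ha with h1 | h1
    · exact hlast a h1 (tgt_mem_verts haU)
    · exact hfirst a h1 (hS.ceil_path.1.src_mem haU)
  · intro y hy hyK
    have hyU : y ∈ G.verts s U := by
      rw [hU, ← List.append_assoc]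
      refine verts_subset_append ?_
      rw [verts_append, List.mem_append]
      rcases mem_verts.1 hyK with rfl | h1
      · exact .inl hU₁.end_mem
      · exact .inr h1
    rw [verts_append, List.mem_append] at hy
    rcases hy with hy | hy
    · rcases mem_verts.1 hy with rfl | hy
      · exact .inl rfl
      · obtain ⟨e, he, rfl⟩ := List.mem_map.1 hy
        exact absurd hyU (hlast e he)
    · have hy' : y ∈ G.verts v Fm := mem_verts.2 (.inr hy)
      rw [hFm.verts_eq, List.mem_append] at hy'
      rcases hy' with hy' | hy'
      · obtain ⟨e, he, rfl⟩ := List.mem_map.1 hy'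
        exact absurd hyU (hfirst e he)
      · exact .inr (List.mem_singleton.1 hy')
  · exact verts_subset_append hL₁.end_mem
  · exact fun h1 => hvU (h1 ▸ hhU)

end Setup

namespace FlipSetup

variable {s t z u v h x : V} {C : Set V} {F X U P L K : List A}
  (hS : G.FlipSetup s t C F z X U u P v)
include hS
variable [Finite A]

/-- The flipped path does not end at the first or the last vertex of a hump. -/
theorem end_ne_hump (hH : G.IsHump s F U h x L K) : v ≠ h ∧ v ≠ x := by
  obtain ⟨M, b, hP, hb, hbr⟩ := hS.exists_last
  have hbP : b ∈ P := by rw [hP]; simp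
  have hbU := (hS.last_rightOf hbP hb).2
  constructor
  -- The first vertex of a hump already has three darts: the floor arc into it and the first arcs of
  -- both boundary paths.
  · rintro rfl
    obtain ⟨p, q, hpq, hp, hpv, hqv, hq, -⟩ := hS.exists_turn hS.floor_path hS.end_floor
      (hS.ne_source hS.path.1.end_mem)
    obtain ⟨a, L', hL, ha, -⟩ := hH.floor_walk.exists_cons (hH.floor_walk.ne_nil hH.ends_ne)
    obtain ⟨c, K', hK, hc, -⟩ := hH.ceiling_walk.exists_cons (hH.ceiling_walk.ne_nil hH.ends_ne)
    have haL : a ∈ L := by rw [hL]; simp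
    have hcK : c ∈ K := by rw [hK]; simp
    obtain ⟨F₁, F₂, hF, -⟩ := hH.floor_sub
    have haF : a ∈ F := by rw [hF]; simp [haL]
    have haq : a = q := hS.floor_exit.eq_of_src_eq (List.mem_append_left _ haF)
      (mem_of_infix_right hpq) (ha.trans hqv.symm)
    obtain ⟨hs, ht⟩ := hS.net.inner_ne hS.floor_exit hpq
    have := hS.net.third_unique (hqv.trans hpv.symm) hs ht (d := (b, false)) (e := (c, true))
      (hb.trans hpv.symm) (hc.trans hpv.symm)
      (by
        intro h1
        have h2 : b = p := congrArg Prod.fst h1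
        exact hS.notMem_floor hbP (h2 ▸ hp))
      (by simp) (by simp)
      (by
        intro h1
        have h2 : c = q := congrArg Prod.fst h1
        exact hH.arc_disjoint a haL (haq ▸ h2 ▸ hcK))
    simp at this
  · rintro rfl
    rcases (hS.hump_end hH).2 b hb with h1 | h1
    · exact hS.notMem_floor hbP h1
    · exact hbU h1

/-- The flipped path does not start at the last vertex of a hump. -/
theorem start_ne_hump (hH : G.IsHump s F U h x L K) : u ≠ x := by
  rintro rfl
  obtain ⟨a, M, hP, ha, -⟩ := hS.path.1.exists_cons hS.ne_nil
  have haP : a ∈ P := by rw [hP]; simp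
  rcases List.mem_append.1 ((hS.hump_end hH).1 a ha) with h1 | h1
  · exact hS.notMem_floor haP h1
  · exact hS.notMem_exit haP h1

end FlipSetup

/-! ### Sufficiency: construction of a useful path -/

namespace DepartSetup

variable {s t z u v k : V} {C : Set V} {F X U P P₁ O : List A} {o : A}
  (h : G.DepartSetup s t C F z X U u P v P₁ o O k)
include h
variable [Finite A] [Finite V]

/-- In the open strip, the flipped path runs along the ceiling up to its last vertex there. -/
theorem mem_of_mem_openStrip {Ua Ub : List A} (hU : U = Ua ++ Ub) (hUa : G.IsWalk s Ua k) {a : A}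
    (ha : a ∈ P) (haC : a ∈ G.openStrip C F U) : a ∈ Ua ∨ a ∈ o :: O := by
  rw [h.eq, List.mem_append] at ha
  refine ha.imp_left fun ha => ?_
  have hUp := h.ceil_path
  by_cases haU : a ∈ U
  · have h1 := h.pos_le (mem_verts.2 (.inr (List.mem_map_of_mem ha))) (tgt_mem_verts haU)
    have h2 : G.tgt a ∈ G.verts s U := tgt_mem_verts haU
    rw [hU] at h1 h2 hUp
    rw [hU, List.mem_append] at haU
    refine haU.resolve_right fun h3 => ?_
    have := (hUp.mem_right_iff hUa h2).1 (List.mem_map_of_mem h3)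
    omega
  · obtain ⟨ψ, hψ⟩ := h.exists_stripPot
    have h1 := h.strip_of_left hψ ha haU
    refine absurd ⟨h.notMem_floor (h.mem_left ha), haU, fun h2 => ?_⟩ haC.2
    rw [hψ.pot.eq_zero_of_outside (fun b hb => .inl hb) (fun b hb => .inr hb) h2] at h1
    exact zero_ne_one h1

/-- The witness is the ceiling up to `k`, the tail of `P`, the floor from `v` to `y`, and `T`. By
`mem_of_mem_openStrip` it contains all of `P` in the open strip; the two disjointness hypotheses are
what the choice of `y` and `T` must provide. -/
theorem isUseful_of_path {Ua Ub Fa Fm Fc T : List A} {y : V} (hU : U = Ua ++ Ub)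
    (hUa : G.IsWalk s Ua k) (hF : F = Fa ++ (Fm ++ Fc)) (hFa : G.IsWalk s Fa v)
    (hFm : G.IsWalk v Fm y) (hT : G.IsPath y T t) (hvU : v ∉ G.verts s U)
    (hFU : ∀ w ∈ Fm.map G.tgt, w ∉ G.verts s Ua)
    (hTU : ∀ w ∈ T.map G.tgt, w ∉ G.verts s Ua ∧ w ∉ (o :: O).map G.tgt ∧ w ∉ G.verts v Fm) :
    G.IsUseful s t {a | a ∈ P ∧ a ∈ G.openStrip C F U} := by
  have hUap : G.IsPath s Ua k := (hU ▸ h.ceil_path).left hUa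
  have hFmp : G.IsPath v Fm y := ((hF ▸ h.floor_path).right hFa).left hFm
  have hsubU : ∀ w ∈ G.verts s Ua, w ∈ G.verts s U := fun w hw => by
    rw [hU]
    exact verts_subset_append hw
  have hO : ∀ w ∈ (o :: O).map G.tgt, w ∉ G.verts s Ua ∧ w ∉ Fm.map G.tgt := by
    intro w hw
    rcases h.path₂.tgt_cases hw with rfl | h1
    · exact ⟨fun h1 => hvU (hsubU _ h1), hFmp.start_notMem⟩
    · obtain ⟨e, he, rfl⟩ := List.mem_map.1 h1
      refine ⟨fun h1 => h.off e he (hsubU _ h1), fun h1 => h.tail_floor he ?_⟩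
      rw [hF, verts_append, List.map_append]
      exact List.mem_append_right _ (List.mem_append_left _ h1)
  refine ⟨Ua ++ ((o :: O) ++ (Fm ++ T)), ?_, fun a ha => ?_⟩
  · refine hUap.append (h.path₂.append (hFmp.append hT ?_) ?_) ?_
    · exact fun w h1 h2 => (hTU w h2).2.2 h1
    · intro w h1 h2
      rw [List.map_append, List.mem_append] at h2
      rcases mem_verts.1 h1 with rfl | h1
      · rcases h2 with h2 | h2
        · exact hFU _ h2 hUa.end_mem
        · exact (hTU _ h2).1 hUa.end_mem
      · rcases h2 with h2 | h2
        · exact (hO w h1).2 h2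
        · exact (hTU _ h2).2.1 h1
    · intro w h1 h2
      rw [List.map_append, List.map_append, List.mem_append, List.mem_append] at h2
      rcases h2 with h2 | h2 | h2
      · exact (hO w h2).1 h1
      · exact hFU _ h2 h1
      · exact (hTU _ h2).1 h1
  · rcases h.mem_of_mem_openStrip hU hUa ha.1 ha.2 with h1 | h1
    · exact List.mem_append_left _ h1
    · exact List.mem_append_right _ (List.mem_append_left _ h1)

variable {g x : V} {L K : List A}

/-- The floor is followed to the end `x` of the hump, then the ceiling and the exit path. As `u`
strictly precedes `x` on the floor, `lt_pos_of_floor` puts `k` before `x`, so the two ceiling pieces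
are disjoint. -/
theorem isUseful_of_start_mem (hH : G.IsHump s F U g x L K) (hv : v ∈ G.stripVerts g L K)
    (hu : u ∈ G.stripVerts g L K) : G.IsUseful s t {a | a ∈ P ∧ a ∈ G.openStrip C F U} := by
  obtain ⟨hgF, hxF, hgx, hL⟩ := h.hump_floor hH
  obtain ⟨hgU, hxU, -⟩ := h.hump_ceil hH
  obtain ⟨hvg, hvx⟩ := h.end_ne_hump hH
  have hvL := h.mem_floor_of_mem_strip hH hv h.end_floor
  have huL := h.mem_floor_of_mem_strip hH hu h.start_floor
  have hvU := h.hump_inner hH hvL h.end_floor hvg hvx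
  have hvL' := (hL v h.end_floor).1 hvL
  have huL' := (hL u h.start_floor).1 huL
  have hvu := h.end_before_start
  have hux : G.pos s F u < G.pos s F x :=
    lt_of_le_of_ne huL'.2 fun h1 => h.start_ne_hump hH (pos_inj h.start_floor h1)
  have huU := h.hump_inner hH huL h.start_floor (by rintro rfl; omega) (h.start_ne_hump hH)
  have hkx := h.lt_pos_of_floor huU hxF hxU hux
  obtain ⟨Fa, Fm, Fc, hF, hFa, hFm, -, -⟩ :=
    h.floor_path.exists_between h.end_floor hxF (hvu.trans hux)
  obtain ⟨Ua, Um, Uc, hU, hUa, hUm, hUc, -⟩ := h.ceil_path.exists_between h.mem hxU hkx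
  have hUp : G.IsPath s ((Ua ++ Um) ++ Uc) z := by
    have := h.ceil_path
    rw [hU, ← List.append_assoc] at this
    exact this
  have hFmid : ∀ w ∈ Fm.map G.tgt, w = x ∨ w ∉ G.verts s U := by
    intro w hw
    have hwF : w ∈ G.verts s F := by
      rw [hF, verts_append, List.map_append]
      exact List.mem_append_right _ (List.mem_append_left _ hw)
    have hFp := h.floor_path
    have hwF2 := hwF
    rw [hF] at hFp hwF2
    have h1 := (hFp.mem_mid_iff hFa hFm hwF2).1 (mem_verts.2 (.inr hw))
    rw [← hF] at h1
    by_cases hwx : w = x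
    · exact .inl hwx
    · refine .inr (h.hump_inner hH ((hL w hwF).2 ⟨by omega, h1.2⟩) hwF ?_ hwx)
      rintro rfl
      have := pos_inj h.end_floor (show G.pos s F v = G.pos s F w by omega)
      exact hvg this
  have hxUa : x ∉ G.verts s Ua := by
    intro h1
    have h2 : G.IsPath s (Ua ++ (Um ++ Uc)) z := hU ▸ h.ceil_path
    have h3 := (h2.mem_left_iff hUa).1 h1
    rw [← hU] at h3
    omega
  have hUcp := hUp.right (hUa.append hUm)
  have hT : G.IsPath x (Uc ++ X) t := by
    have h1 := h.ceil_exit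
    rw [hU, ← List.append_assoc, List.append_assoc] at h1
    exact h1.right (hUa.append hUm)
  refine h.isUseful_of_path hU hUa hF hFa hFm hT hvU ?_ ?_
  · intro w hw h1
    rcases hFmid w hw with rfl | h2
    · exact hxUa h1
    · exact h2 (by rw [hU]; exact verts_subset_append h1)
  · intro w hw
    rw [List.map_append, List.mem_append] at hw
    rcases hw with hw | hw
    · have hwU : w ∈ G.verts s U := by
        rw [hU, ← List.append_assoc, verts_append]
        exact List.mem_append_right _ hw
      refine ⟨fun h1 => hUp.disjoint (verts_subset_append h1) hw, fun h1 => ?_, fun h1 => ?_⟩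
      · rcases h.path₂.tgt_cases h1 with rfl | h1
        · exact hvU hwU
        · obtain ⟨e, he, rfl⟩ := List.mem_map.1 h1
          exact h.off e he hwU
      · rcases mem_verts.1 h1 with rfl | h1
        · exact hvU hwU
        · rcases hFmid w h1 with rfl | h2
          · exact hUcp.start_notMem hw
          · exact h2 hwU
    · have hwz := h.not_reaches hw
      refine ⟨fun h1 => hwz ((hUa.reaches_end h1).trans h.end_reaches),
        fun h1 => hwz (h.reaches ?_), fun h1 => hwz ((hFm.reaches_end h1).trans
          (h.floor_reaches hxF))⟩
      obtain ⟨e, he, rfl⟩ := List.mem_map.1 h1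
      exact tgt_mem_verts (h.mem_right he)

/-- The floor is followed only to the exit `e`, strictly inside the hump and thus off the ceiling,
so the order of `k` and `x` does not matter. The exit path leaves the component and meets nothing
that leads to `z`. -/
theorem isUseful_of_exit (hH : G.IsHump s F U g x L K) (hv : v ∈ G.stripVerts g L K)
    (hu : u ∉ G.stripVerts g L K) {e : V} (he : G.IsExit C t e) (heL : e ∈ G.stripVerts g L K)
    (hve : G.pos s F v < G.pos s F e) :
    G.IsUseful s t {a | a ∈ P ∧ a ∈ G.openStrip C F U} := by
  obtain ⟨hgF, hxF, hgx, hL⟩ := h.hump_floor hH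
  obtain ⟨hvg, hvx⟩ := h.end_ne_hump hH
  obtain ⟨_, _, _, _, -, -, -, -, -, -, -, hexits⟩ := h.floor
  have heF := hexits e he
  have heL' := (hL e heF).1 (h.mem_floor_of_mem_strip hH heL heF)
  have hvL := h.mem_floor_of_mem_strip hH hv h.end_floor
  have hvU := h.hump_inner hH hvL h.end_floor hvg hvx
  have hvL' := (hL v h.end_floor).1 hvL
  have hvu := h.end_before_start
  have hxu : G.pos s F x < G.pos s F u := by
    by_contra! h1
    exact hu (.inl ((hL u h.start_floor).2 ⟨by omega, h1⟩))
  obtain ⟨Y, heC, hY, hYC⟩ := he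
  -- All arcs out of `x` belong to `F ++ X`. One on the floor stays in the component, and one on `X`
  -- would force `e = z`, which cannot precede `u`.
  have hex : e ≠ x := by
    rintro rfl
    have het : e ≠ t := h.ne_sink_of_reaches (h.floor_reaches heF)
    obtain ⟨a, M, rfl, ha, -⟩ := hY.1.exists_cons (hY.1.ne_nil het)
    rcases List.mem_append.1 ((h.hump_end hH).1 a ha) with h1 | h1
    · have h2 := h.floor_reaches (tgt_mem_verts h1)
      exact hYC (G.tgt a) (by simp)
        (h.scc.mem_of_reaches heC h.exit_mem (ha ▸ reaches_of_arc a) h2)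
    · have h2 : G.src a ∈ G.verts z X := h.exit_path.1.src_mem h1
      have h3 : e = z := by
        rw [ha] at h2
        rcases mem_verts.1 h2 with h3 | h3
        · exact h3
        · exact absurd (h.floor_reaches heF) (h.not_reaches h3)
      have h4 := pos_le_length h.start_floor
      rw [h3, h.floor_path.pos_end] at hxu
      omega
  obtain ⟨Fa, Fm, Fc, hF, hFa, hFm, -, -⟩ := h.floor_path.exists_between h.end_floor heF hve
  obtain ⟨Ua, Ub, hU, hUa, hUb⟩ := h.ceil_path.1.exists_split h.mem
  have hexpos : G.pos s F e < G.pos s F x :=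
    lt_of_le_of_ne heL'.2 fun h1 => hex (pos_inj heF h1)
  refine h.isUseful_of_path hU hUa hF hFa hFm hY hvU ?_ ?_
  · intro w hw h1
    have hwF : w ∈ G.verts s F := by
      rw [hF, verts_append, List.map_append]
      exact List.mem_append_right _ (List.mem_append_left _ hw)
    have hFp := h.floor_path
    have hwF2 := hwF
    rw [hF] at hFp hwF2
    have h2 := (hFp.mem_mid_iff hFa hFm hwF2).1 (mem_verts.2 (.inr hw))
    rw [← hF] at h2
    refine h.hump_inner hH ((hL w hwF).2 ⟨by omega, by omega⟩) hwF ?_ ?_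
      (by rw [hU]; exact verts_subset_append h1)
    · rintro rfl
      exact hvg (pos_inj h.end_floor (by omega))
    · rintro rfl
      omega
  · intro w hw
    have hnot : ¬ G.Reaches w z := fun h1 => hYC w hw
      (h.scc.mem_of_reaches heC h.exit_mem (hY.1.reaches_of_mem (mem_verts.2 (.inr hw))) h1)
    refine ⟨fun h1 => hnot ((hUa.reaches_end h1).trans h.end_reaches),
      fun h1 => hnot (h.reaches ?_), fun h1 => hnot ((hFm.reaches_end h1).trans
        (h.floor_reaches heF))⟩
    obtain ⟨e, he, rfl⟩ := List.mem_map.1 h1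
    exact tgt_mem_verts (h.mem_right he)

end DepartSetup

theorem forall_of_step {p : A → Prop} {a : A} {M : List A} (h0 : p a)
    (step : ∀ e e', [e, e'] <:+: a :: M → e' ∈ M → p e → p e') : ∀ e ∈ a :: M, p e := by
  induction M generalizing a with
  | nil =>
    intro e he
    rw [List.mem_singleton.1 he]
    exact h0
  | cons c M ih =>
    intro e he
    rcases List.mem_cons.1 he with rfl | he
    · exact h0
    · refine ih (step a c ⟨[], M, by simp⟩ (by simp) h0) ?_ e he
      exact fun e e' hi he' => step e e' (hi.trans (List.suffix_cons _ _).isInfix)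
        (List.mem_cons_of_mem c he')

/-- The floor from the end `v` of the flipped path to the first vertex `x` on the ceiling, the
ceiling from `x` to the vertex `k` where the flipped path departs from it for the last time, and
the rest of the flipped path form a directed cycle with potential `φ`. -/
structure ReturnCycle (G : PlaneDigraph V A) (s t : V) (C : Set V) (F : List A) (z : V)
    (X U : List A) (u : V) (P : List A) (v : V) (P₁ : List A) (o : A) (O : List A) (k : V)
    (Fa Fm Fc Ua Um Uc : List A) (x : V) (φ : A × Bool → ℝ) : Prop
    extends G.DepartSetup s t C F z X U u P v P₁ o O k where
  floor_eq : F = Fa ++ (Fm ++ Fc)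
  floor_walk₁ : G.IsWalk s Fa v
  floor_walk₂ : G.IsWalk v Fm x
  floor_off : ∀ e ∈ Fm, G.src e ∉ G.verts s U
  ceil_eq : U = Ua ++ (Um ++ Uc)
  ceil_walk₁ : G.IsWalk s Ua x
  ceil_walk₂ : G.IsWalk x Um k
  ceil_ne : Um ≠ []
  pot : G.Pot ((Fm ++ Um) ++ o :: O) [] φ
  bank : ∀ b ∈ (Fm ++ Um) ++ o :: O, φ (b, true) = 1 ∧ φ (b, false) = 0

theorem DepartSetup.exists_returnCycle {s t z u v k : V} {C : Set V} {F X U P P₁ O : List A} {o : A}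
    (h : G.DepartSetup s t C F z X U u P v P₁ o O k) [Finite A] [Finite V] {x : V}
    {Fa Fm Fc : List A} (hF : F = Fa ++ (Fm ++ Fc)) (hFa : G.IsWalk s Fa v)
    (hFm : G.IsWalk v Fm x) (hoff : ∀ e ∈ Fm, G.src e ∉ G.verts s U) (hxU : x ∈ G.verts s U)
    (hxk : G.pos s U x < G.pos s U k) :
    ∃ Ua Um Uc φ, G.ReturnCycle s t C F z X U u P v P₁ o O k Fa Fm Fc Ua Um Uc x φ := by
  obtain ⟨Ua, Um, Uc, hU, hUa, hUm, -, hne⟩ := h.ceil_path.exists_between hxU h.mem hxk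
  have hFmp : G.IsPath v Fm x := ((hF ▸ h.floor_path).right hFa).left hFm
  have hUmp : G.IsPath x Um k := ((hU ▸ h.ceil_path).right hUa).left hUm
  have hUmU : ∀ w ∈ Um.map G.tgt, w ∈ G.verts s U := by
    intro w hw
    rw [hU, verts_append, List.map_append]
    exact List.mem_append_right _ (List.mem_append_left _ hw)
  have hvx : v ∈ G.verts s U → v = x := by
    intro hv
    cases Fm with
    | nil => exact hFm
    | cons f M => exact absurd (hFm.1.symm ▸ hv) (hoff f (by simp))
  have h1 : G.IsPath v (Fm ++ Um) k := by
    refine hFmp.append hUmp ?_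
    intro w hw hwm
    rw [hFm.verts_eq, List.mem_append] at hw
    rcases hw with hw | hw
    · obtain ⟨e, he, rfl⟩ := List.mem_map.1 hw
      exact hoff e he (hUmU _ hwm)
    · rw [List.mem_singleton.1 hw] at hwm
      exact hUmp.start_notMem hwm
  have hn : (((Fm ++ Um) ++ o :: O).map G.tgt).Nodup := by
    rw [List.map_append]
    refine h1.tgt_nodup.append h.path₂.tgt_nodup ?_
    intro w hw hwo
    rcases h.path₂.tgt_cases hwo with rfl | hwo
    · exact h1.start_notMem hw
    · obtain ⟨e, he, rfl⟩ := List.mem_map.1 hwo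
      rw [List.map_append, List.mem_append] at hw
      rcases hw with hw | hw
      · refine h.tail_floor he ?_
        rw [hF, verts_append, List.map_append]
        exact List.mem_append_right _ (List.mem_append_left _ hw)
      · exact h.off e he (hUmU _ hw)
  have hZ : G.IsWalk v ((Fm ++ Um) ++ o :: O) v := h1.1.append h.walk₂
  have ht : t ∉ ((Fm ++ Um) ++ o :: O).map G.tgt := by
    intro ht
    exact h.ne_sink_of_reaches
      ((hZ.reaches_end (mem_verts.2 (.inr ht))).trans (h.floor_reaches h.end_floor)) rfl
  obtain ⟨φ, hφ, hb⟩ := h.net.cycle_pot hZ (by simp) hn ht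
  exact ⟨Ua, Um, Uc, φ, ⟨h, hF, hFa, hFm, hoff, hU, hUa, hUm, hne, hφ, hb⟩⟩

/-! ### The return cycle and what it separates -/

namespace ReturnCycle

variable {s t z u v k x : V} {C : Set V} {F X U P P₁ O Fa Fm Fc Ua Um Uc : List A} {o : A}
  {φ : A × Bool → ℝ}
  (h : G.ReturnCycle s t C F z X U u P v P₁ o O k Fa Fm Fc Ua Um Uc x φ)
include h

theorem floor_sub {e : A} (he : e ∈ Fm) : e ∈ F := by
  rw [h.floor_eq]
  simp [he]

theorem verts_floor_sub {w : V} (hw : w ∈ G.verts v Fm) : w ∈ G.verts s F := by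
  rw [h.floor_eq, verts_append, List.map_append]
  rcases mem_verts.1 hw with rfl | hw
  · exact List.mem_append_left _ h.floor_walk₁.end_mem
  · exact List.mem_append_right _ (List.mem_append_left _ hw)

theorem ceil_sub {e : A} (he : e ∈ Um) : e ∈ U := by
  rw [h.ceil_eq]
  simp [he]

theorem tgt_mem_ceil {w : V} (hw : w ∈ Um.map G.tgt) : w ∈ G.verts s U := by
  obtain ⟨e, he, rfl⟩ := List.mem_map.1 hw
  exact tgt_mem_verts (h.ceil_sub he)

theorem floor_path₂ : G.IsPath v Fm x :=
  ((h.floor_eq ▸ h.floor_path).right h.floor_walk₁).left h.floor_walk₂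

theorem ceil_path₂ : G.IsPath x Um k :=
  ((h.ceil_eq ▸ h.ceil_path).right h.ceil_walk₁).left h.ceil_walk₂

theorem walk : G.IsWalk v ((Fm ++ Um) ++ o :: O) v :=
  (h.floor_walk₂.append h.ceil_walk₂).append h.walk₂

theorem turn_mem_ceil : x ∈ G.verts s U := by
  rw [h.ceil_eq]
  exact verts_subset_append h.ceil_walk₁.end_mem

theorem turn_mem_floor : x ∈ G.verts s F := by
  rw [h.floor_eq, ← List.append_assoc]
  exact verts_subset_append (h.floor_walk₁.append h.floor_walk₂).end_mem

theorem depart_mem : k ∈ Um.map G.tgt := by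
  obtain ⟨M, p, hM, -, hp⟩ := h.ceil_walk₂.exists_concat h.ceil_ne
  rw [hM, ← hp]
  simp

theorem eq_turn (hv : v ∈ G.verts s U) : v = x := by
  have hw := h.floor_walk₂
  have hoff := h.floor_off
  cases Fm with
  | nil => exact hw
  | cons f M => exact absurd (hw.1.symm ▸ hv) (hoff f (by simp))

theorem pos_lt {w : V} (hw : w ∈ Um.map G.tgt) : G.pos s U x < G.pos s U w := by
  have hwU := h.tgt_mem_ceil hw
  have hUp := h.ceil_path
  rw [h.ceil_eq] at hwU hUp ⊢
  exact (hUp.mem_right_iff h.ceil_walk₁ hwU).1 (by rw [List.map_append]; simp [hw])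

theorem pos_iff {w : V} (hwU : w ∈ G.verts s U) :
    w ∈ G.verts x Um ↔ G.pos s U x ≤ G.pos s U w ∧ G.pos s U w ≤ G.pos s U k := by
  have hUp := h.ceil_path
  rw [h.ceil_eq] at hwU hUp ⊢
  exact hUp.mem_mid_iff h.ceil_walk₁ h.ceil_walk₂ hwU

theorem free {w : V} (h1 : ∀ e ∈ Fm, G.src e ≠ w) (h2 : w ≠ x) (h3 : w ∉ Um.map G.tgt)
    (h4 : w ∉ (o :: O).map G.tgt) : G.Free {b | b ∈ (Fm ++ Um) ++ o :: O ∨ b ∈ []} w := by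
  have hwv : w ≠ v := fun h5 => h4 (h5 ▸ h.end_mem_right)
  refine free_of_notMem h.walk (y' := v) (x' := v) rfl ?_ (by simpa [verts] using hwv)
  intro h5
  rw [verts_append, verts_append, List.mem_append, List.mem_append] at h5
  rcases h5 with (h5 | h5) | h5
  · rw [h.floor_walk₂.verts_eq, List.mem_append] at h5
    rcases h5 with h5 | h5
    · obtain ⟨e, he, hew⟩ := List.mem_map.1 h5
      exact h1 e he hew
    · exact h2 (List.mem_singleton.1 h5)
  · exact h3 h5
  · exact h4 h5

theorem reaches_of_mem {w : V} (hw : w ∈ G.verts v ((Fm ++ Um) ++ o :: O)) : G.Reaches w z :=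
  (h.walk.reaches_end hw).trans (h.floor_reaches h.end_floor)

theorem mem_floor_of_mem {e : A} (he : e ∈ (Fm ++ Um) ++ o :: O) (h1 : G.src e ∉ Um.map G.tgt)
    (h2 : G.src e ≠ x) (h3 : G.src e ∉ (o :: O).map G.tgt) : e ∈ Fm := by
  rw [List.mem_append, List.mem_append] at he
  rcases he with (he | he) | he
  · exact he
  · rcases mem_verts.1 (h.ceil_walk₂.src_mem he) with h4 | h4
    · exact absurd h4 h2
    · exact absurd h4 h1
  · rcases mem_verts.1 (h.walk₂.src_mem he) with h4 | h4
    · exact absurd (h4 ▸ h.depart_mem) h1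
    · exact absurd h4 h3

theorem notMem_of_source {a : A} (ha : G.src a = s) : a ∉ (Fm ++ Um) ++ o :: O := by
  intro h1
  have h2 := h.walk.src_mem h1
  rw [ha] at h2
  rcases mem_verts.1 h2 with h2 | h2
  · exact h.ne_source h.path.1.end_mem h2.symm
  · obtain ⟨b, -, hb⟩ := List.mem_map.1 h2
    exact h.net.source_in b hb

/-- Beyond the departure of the flipped path, the ceiling is outside of the cycle. -/
theorem ceil_out {j : V} (hj : j ∈ G.verts s U) (hkj : G.pos s U k < G.pos s U j) {d : A × Bool}
    (hd : G.vert d = j) : φ d = 0 := by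
  have hxk := h.pos_lt h.depart_mem
  have hUp := h.ceil_path
  have hfree : ∀ w ∈ G.verts s U, G.pos s U k < G.pos s U w →
      G.Free {b | b ∈ (Fm ++ Um) ++ o :: O ∨ b ∈ []} w := by
    intro w hw hkw
    refine h.free ?_ ?_ ?_ ?_
    · rintro e he rfl
      exact h.floor_off e he hw
    · rintro rfl
      omega
    · intro h1
      have := (h.pos_iff hw).1 (mem_verts.2 (.inr h1))
      omega
    · intro h1
      rcases h.path₂.tgt_cases h1 with rfl | h1
      · rw [h.eq_turn hw] at hkw
        omega
      · obtain ⟨e, he, rfl⟩ := List.mem_map.1 h1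
        exact h.off e he hw
  have hfree' : ∀ w ∈ X.map G.tgt, G.Free {b | b ∈ (Fm ++ Um) ++ o :: O ∨ b ∈ []} w := by
    intro w hw
    refine free_of_notMem h.walk (x' := v) (y' := v) rfl
      (fun h1 => h.not_reaches hw (h.reaches_of_mem h1)) ?_
    intro h1
    have : w = v := by simpa [verts] using h1
    exact h.not_reaches hw (this ▸ h.floor_reaches h.end_floor)
  obtain ⟨U₁, U₂, hU, hU₁, hU₂⟩ := hUp.1.exists_split hj
  have hW : G.IsWalk j (U₂ ++ X) t := hU₂.append h.exit_path.1
  obtain ⟨b, M, hbM, hb, -⟩ := hW.exists_cons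
    (hW.ne_nil (h.ne_sink_of_reaches (h.ceil_reaches hj)))
  rw [hbM] at hW
  have hbZ : b ∉ {b | b ∈ (Fm ++ Um) ++ o :: O ∨ b ∈ []} := fun h1 => (hfree j hj hkj b h1).1 hb
  have h0 := h.net.pot_eq_zero_of_walk h.pot (hfree' t h.sink_mem) hW
    (fun h1 => hbZ (.inl h1)) (by simp) (by
      intro e he
      have h1 := hW.src_mem_tgt he
      rw [← hbM, List.map_append, List.mem_append] at h1
      rcases h1 with h1 | h1
      · have h2 : G.src e ∈ G.verts s U := by
          rw [hU, verts_append]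
          exact List.mem_append_right _ h1
        refine hfree _ h2 (hkj.trans ?_)
        rw [hU] at h2 hUp ⊢
        exact (hUp.mem_right_iff hU₁ h2).1 h1
      · exact hfree' _ h1) b (by simp) true
  rw [← h0]
  exact h.pot.const_vertex (hfree j hj hkj) hd hb

variable [Finite A]

/-- The floor enters the cycle from the inside. -/
theorem floor_in {p : A} (hp : p ∈ F) (hpv : G.tgt p = v) : φ (p, true) = 1 := by
  obtain ⟨M, b, hP, hb, hbr⟩ := h.exists_last
  have hbP : b ∈ P := by rw [hP]; simp
  have hbO : b ∈ o :: O := by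
    have := hbP
    rw [h.eq, List.mem_append] at this
    exact this.resolve_left fun h1 => h.tgt_left_ne h1 hb
  obtain ⟨p', q, hpq, hp', hpv', hqv, -, -⟩ :=
    h.exists_turn h.floor_path h.end_floor (h.ne_source h.path.1.end_mem)
  have hpp : p' = p := h.floor_path.eq_of_tgt_eq hp' hp (hpv'.trans hpv.symm)
  rw [hpp] at hpq
  -- Since `b` enters `v` from the right, its left face is the right face of `p`; that face is
  -- inside the cycle, and `p` itself is not on the cycle.
  have hr := h.net.rightAt_of_rightOf h.floor_exit hbr hpq (hb.trans hpv.symm)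
  have h1 := (h.pot.rightAt hr).2.1
  rw [dartFlip_mk, Bool.not_false, (h.bank b (List.mem_append_right _ hbO)).1] at h1
  rw [h.pot.jump_none ?_ (by simp), ← h1]
  rw [List.mem_append, List.mem_append]
  rintro ((h2 | h2) | h2)
  · exact h.floor_path₂.start_notMem (hpv ▸ List.mem_map_of_mem h2)
  · have h3 : v ∈ Um.map G.tgt := hpv ▸ List.mem_map_of_mem h2
    rw [h.eq_turn (h.tgt_mem_ceil h3)] at h3
    exact h.ceil_path₂.start_notMem h3
  · exact h.notMem_floor (h.mem_right h2) hp

/-- A walk that starts inside the cycle stays inside or on the floor part of the cycle. -/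
theorem inside_of_walk {w m : V} {a : A} {M : List A} (hT : G.IsWalk w (a :: M) m)
    (ha : a ∈ Fm ∨ φ (a, true) = 1 ∧ a ∉ (Fm ++ Um) ++ o :: O)
    (hU : ∀ e ∈ M, G.src e ∉ Um.map G.tgt) (hx : ∀ e ∈ M, G.src e ≠ x)
    (hO : ∀ e ∈ M, G.src e ∉ (o :: O).map G.tgt)
    (hR : ∀ e ∈ M, G.src e ∈ G.verts v Fm → ¬ G.RightOf (F ++ X) (e, true)) :
    ∀ e ∈ a :: M, e ∈ Fm ∨ φ (e, true) = 1 ∧ e ∉ (Fm ++ Um) ++ o :: O := by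
  refine forall_of_step ha fun e e' hee he' hpe => ?_
  have hv := hT.src_eq_of_infix hee
  have hmem : e' ∈ (Fm ++ Um) ++ o :: O → e' ∈ Fm := fun h1 =>
    h.mem_floor_of_mem h1 (hU e' he') (hx e' he') (hO e' he')
  -- At a floor vertex of the cycle an arc not on the floor goes to the left by `hR`, hence to the
  -- inside. At any other vertex the walk is off the cycle and the value is transported.
  by_cases hF : ∃ f ∈ Fm, G.src f = G.src e'
  · obtain ⟨f, hf, hfe⟩ := hF
    have hwv : G.src e' ≠ v := fun h1 => hO e' he' (h1 ▸ h.end_mem_right)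
    obtain ⟨p, q, hpq, hp, hq⟩ := h.floor_walk₂.exists_infix (w := G.src e')
      (hfe ▸ h.floor_walk₂.src_mem hf) hwv (hx e' he')
    by_cases he'F : e' ∈ Fm
    · exact .inl he'F
    · refine .inr ⟨?_, fun h1 => he'F (hmem h1)⟩
      have hpq' : [p, q] <:+: F ++ X := hpq.trans ⟨Fa, Fc ++ X, by rw [h.floor_eq]; simp⟩
      have hpF : p ∈ Fm := mem_of_infix_left hpq
      have hwF : G.src e' ∈ G.verts v Fm := hp ▸ tgt_mem_verts hpF
      have hl := h.floor_third hpq' hp (d := (e', true)) rfl (by simp)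
        (by
          intro h1
          have h2 : e' = q := congrArg Prod.fst h1
          exact he'F (h2 ▸ mem_of_infix_right hpq)) (hR e' he' hwF)
      rw [(h.pot.leftAt hl).2.1]
      exact (h.bank p (by simp [hpF])).1
  · push Not at hF
    have hfree := h.free hF (hx e' he') (hU e' he') (hO e' he')
    have heF : e ∉ Fm := by
      intro h1
      have h2 : G.tgt e ∈ G.verts v Fm := tgt_mem_verts h1
      rw [← hv, h.floor_walk₂.verts_eq, List.mem_append] at h2
      rcases h2 with h2 | h2
      · obtain ⟨f, hf, hfe⟩ := List.mem_map.1 h2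
        exact hF f hf hfe
      · exact hx e' he' (List.mem_singleton.1 h2)
    obtain ⟨h1, h2⟩ := hpe.resolve_left heF
    refine .inr ⟨?_, fun h3 => hF e' (hmem h3) rfl⟩
    rw [h.pot.const_vertex hfree (d := (e', true)) (e := (e, false)) rfl hv.symm,
      ← h.pot.jump_none h2 (by simp), h1]

/-- An arc inside the cycle that ends on the ceiling part of the cycle arrives there from the left. -/
theorem arrive_left {e : A} (he : e ∈ Fm ∨ φ (e, true) = 1 ∧ e ∉ (Fm ++ Um) ++ o :: O)
    (hm : G.tgt e ∈ Um.map G.tgt) :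
    ∃ p q, [p, q] <:+: U ++ X ∧ p ∈ U ∧ G.tgt p = G.tgt e ∧ G.src q = G.tgt e ∧
      G.LeftAt p q (e, false) := by
  have hmU := h.tgt_mem_ceil hm
  have heF : e ∉ Fm := by
    intro h1
    have h2 : G.tgt e ∈ G.verts v Fm := tgt_mem_verts h1
    rw [h.floor_walk₂.verts_eq, List.mem_append] at h2
    rcases h2 with h2 | h2
    · obtain ⟨f, hf, hfe⟩ := List.mem_map.1 h2
      exact h.floor_off f hf (hfe ▸ hmU)
    · rw [List.mem_singleton.1 h2] at hm
      exact h.ceil_path₂.start_notMem hm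
  obtain ⟨h1, h2⟩ := he.resolve_left heF
  obtain ⟨p, q, hpq, hp, hpm, hqm, -, -⟩ := h.exists_turn h.ceil_path hmU (h.net.source_in e)
  obtain ⟨c, hc, hcm⟩ := List.mem_map.1 hm
  have hcp : c = p := h.ceil_path.eq_of_tgt_eq (h.ceil_sub hc) hp (hcm.trans hpm.symm)
  rw [hcp] at hc
  obtain ⟨hs, ht⟩ := h.net.inner_ne h.ceil_exit hpq
  refine ⟨p, q, hpq, hp, hpm, hqm, ?_⟩
  rcases h.net.dart_cases (hqm.trans hpm.symm) hs ht (e := (e, false)) hpm.symm with h3 | h3 | h3 | h3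
  · have h4 : e = p := congrArg Prod.fst h3
    exact absurd (by rw [h4]; simp [hc]) h2
  · simp at h3
  · have h4 := (h.pot.rightAt h3).2.1
    rw [dartFlip_mk, Bool.not_false, h1, (h.bank p (by simp [hc])).2] at h4
    exact absurd h4 one_ne_zero
  · exact h3

variable [Finite V]

/-- The floor from `s` first meets the cycle at `v`, and it enters `v` from the inside. That it
avoids the ceiling part follows from the common order of floor and ceiling. -/
theorem source_in {a : A} (ha : G.src a = s) : φ (a, true) = 1 := by
  have hvs := h.ne_source h.path.1.end_mem
  obtain ⟨b, M, hFa, hb, -⟩ := h.floor_walk₁.exists_cons (h.floor_walk₁.ne_nil hvs.symm)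
  have hab : a = b := h.net.source_out.unique ha hb
  obtain ⟨M', p, hFa', -, hp⟩ := h.floor_walk₁.exists_concat (h.floor_walk₁.ne_nil hvs.symm)
  have hpFa : p ∈ Fa := by rw [hFa']; simp
  have hFp := h.floor_path
  rw [h.floor_eq] at hFp
  have hFap := hFp.left h.floor_walk₁
  have hw := h.floor_walk₁
  rw [hFa] at hw
  have hZ := h.notMem_of_source hb
  have h1 := h.pot.const_walk hw hZ (by simp) (by
    intro e he
    have heFa : e ∈ Fa := by rw [hFa]; simp [he]
    have hmem : G.src e ∈ G.verts s Fa := h.floor_walk₁.src_mem heFa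
    have hev : G.src e ≠ v := fun h1 => hFap.end_notMem (List.mem_map.2 ⟨e, heFa, h1⟩)
    have hmF : G.src e ∈ G.verts s F := by rw [h.floor_eq]; exact verts_subset_append hmem
    have hnot : G.src e ∉ G.verts v Fm := by
      intro h1
      rcases mem_verts.1 h1 with h1 | h1
      · exact hev h1
      · exact hFp.disjoint hmem (by rw [List.map_append]; exact List.mem_append_left _ h1)
    refine h.free ?_ ?_ ?_ ?_
    · exact fun f hf h1 => hnot (h1 ▸ h.floor_walk₂.src_mem hf)
    · exact fun h1 => hnot (h1 ▸ h.floor_walk₂.end_mem)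
    · intro h1
      have h2 := (h.pos_lt_iff h.turn_mem_ceil (h.tgt_mem_ceil h1) h.turn_mem_floor hmF).1
        (h.pos_lt h1)
      have h3 := (hFp.mem_left_iff h.floor_walk₁).1 hmem
      have hx := h.turn_mem_floor
      rw [h.floor_eq] at h2 hx
      have h4 := (hFp.mem_mid_iff h.floor_walk₁ h.floor_walk₂ hx).1 h.floor_walk₂.end_mem
      omega
    · intro h1
      rcases h.path₂.tgt_cases h1 with h1 | h1
      · exact hev h1
      · obtain ⟨f, hf, hfe⟩ := List.mem_map.1 h1
        exact h.tail_floor hf (hfe ▸ hmF)) p (by rw [← hFa]; exact hpFa) true true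
  rw [hab, ← h1]
  exact h.floor_in (by rw [h.floor_eq]; simp [hpFa]) hp

/-- A path that starts inside the cycle and reaches the ceiling part of the cycle without passing
through `x`, does so from the left, and has no earlier vertex on the ceiling. -/
theorem separation {w m : V} {a : A} {M : List A} (hT : G.IsPath w (a :: M) m)
    (ha : a ∈ Fm ∨ φ (a, true) = 1 ∧ a ∉ (Fm ++ Um) ++ o :: O) (hm : m ∈ Um.map G.tgt)
    (hU : ∀ e ∈ a :: M, G.src e ∉ Um.map G.tgt) (hx : ∀ e ∈ a :: M, G.src e ≠ x)
    (hO : ∀ e ∈ M, G.src e ∉ (o :: O).map G.tgt) :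
    (∀ e ∈ a :: M, G.src e ∉ G.verts s U) ∧ ∃ e ∈ a :: M, ∃ p q, [p, q] <:+: U ++ X ∧ p ∈ U ∧
      G.tgt e = m ∧ G.tgt p = m ∧ G.src q = m ∧ G.LeftAt p q (e, false) := by
  have hmU := h.tgt_mem_ceil hm
  have hin := h.inside_of_walk hT.1 ha (fun e he => hU e (by simp [he]))
    (fun e he => hx e (by simp [he])) hO (fun e he hF hr => h.not_reaches_of_rightOf hr
      (h.verts_floor_sub hF)
      ((hT.1.reaches_end (tgt_mem_verts (by simp [he]))).trans (h.ceil_reaches hmU)))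
  obtain ⟨T', e, hT', -, hem⟩ := hT.1.exists_concat (by simp)
  have he : e ∈ a :: M := by rw [hT']; simp
  obtain ⟨p, q, hpq, hp, hpm, hqm, hl⟩ := h.arrive_left (hin e he) (hem.symm ▸ hm)
  refine ⟨?_, e, he, p, q, hpq, hp, hem, hpm.trans hem, hqm.trans hem, hl⟩
  intro c hc hcU
  obtain ⟨T₁, T₂, j, hT₁₂, hT₁, hT₂, ⟨hjU, hjm⟩, hlast⟩ := hT.1.exists_last
    (fun y => y ∈ G.verts s U ∧ y ≠ m) ⟨G.src c, hT.1.src_mem hc, hcU,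
      fun h1 => hT.end_notMem (List.mem_map.2 ⟨c, hc, h1⟩)⟩
  obtain ⟨b, N, rfl, hbj, -⟩ := hT₂.exists_cons (hT₂.ne_nil hjm)
  have hTp := hT
  rw [hT₁₂] at hTp
  have hN : G.IsPath j (b :: N) m := hTp.right hT₁
  have hbM : b ∈ a :: M := by rw [hT₁₂]; simp
  have heN : e ∈ b :: N := by
    obtain ⟨N', e', hN', -, he'⟩ := hT₂.exists_concat (by simp)
    have h1 : e' ∈ b :: N := by rw [hN']; simp
    have : e = e' := hT.eq_of_tgt_eq he (by rw [hT₁₂]; exact List.mem_append_right _ h1)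
      (hem.trans he'.symm)
    rw [this]
    exact h1
  -- From the last earlier ceiling vertex `j` the path makes a jump ending on the left of the
  -- ceiling, so `m` precedes `j`. Not being on the ceiling part, `j` lies beyond `k`, where the
  -- value is 0, while the path is inside with value 1.
  have hlt := h.pos_lt_of_left_jump hjU hmU hN (by
    intro f hf hfU
    obtain ⟨f', hf', hff⟩ := List.mem_map.1 (hT₂.src_mem_tgt hf)
    refine hlast f' hf' ⟨hff.symm ▸ hfU, fun h1 => hN.end_notMem (List.mem_map.2
      ⟨f, by simp [hf], hff.symm.trans h1⟩)⟩) heN hem hpq hl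
  have hxm := h.pos_lt hm
  have hkj : G.pos s U k < G.pos s U j := by
    by_contra h1
    have h2 := (h.pos_iff hjU).2 ⟨by omega, by omega⟩
    rw [← hbj] at h2
    rcases mem_verts.1 h2 with h2 | h2
    · exact hx b hbM h2
    · exact hU b hbM h2
  have h0 := h.ceil_out hjU hkj (d := (b, true)) hbj
  rcases hin b hbM with h1 | h1
  · exact h.floor_off b h1 (hbj ▸ hjU)
  · rw [h1.1] at h0
    exact one_ne_zero h0

end ReturnCycle

/-! ### Necessity: the tail inside a useful path -/

namespace DepartSetup

variable {s t z u v k : V} {C : Set V} {F X U P P₁ O : List A} {o : A}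
  (h : G.DepartSetup s t C F z X U u P v P₁ o O k)
include h
variable [Finite A]

/-- The last part of the flipped path lies in the open strip. -/
theorem tail_mem_openStrip {e : A} (he : e ∈ o :: O) : e ∈ G.openStrip C F U := by
  refine ⟨h.flipped.arcs_mem e (h.mem_right he), fun hin => hin.2.2 ?_⟩
  obtain ⟨M, b, hP, hb, hbr⟩ := h.exists_last
  have hbP : b ∈ P := by rw [hP]; simp
  have hbO : b ∈ o :: O := by
    have := hbP
    rw [h.eq, List.mem_append] at this
    exact this.resolve_left fun h1 => h.tgt_left_ne h1 hb
  have hbank := ((h.net.right_bank h.floor_exit (S := {b | b ∈ F ∨ b ∈ U})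
    (fun a ha => ha.elim h.floor_allowed h.ceil_allowed)
    (h.free_sink h.floor_path.1 h.ceil_path.1 (.refl z) (.refl z))).2 _ hbr).1
  have hw := h.walk₂.sameRegion (S := {b | b ∈ F ∨ b ∈ U})
    (fun h1 => h1.elim (h.notMem_floor (h.mem_right (by simp))) h.depart_notMem_ceil)
    (fun f hf => free_of_notMem h.floor_path.1 h.ceil_path.1 (h.tail_floor hf) (h.off f hf))
  exact ((hw e he true true).symm.trans (hw b hbO true false)).trans hbank

/-- The whole tail lies in the open strip, and a walk made of arcs of a simple path is a contiguous
piece of it. -/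
theorem exists_decomposition (hQ : G.IsUseful s t {a | a ∈ P ∧ a ∈ G.openStrip C F U}) :
    ∃ S₁ S₂, G.IsPath s (S₁ ++ ((o :: O) ++ S₂)) t ∧ G.IsWalk s S₁ k ∧ G.IsWalk v S₂ t := by
  obtain ⟨Q, hQp, hQ⟩ := hQ
  obtain ⟨S₁, S₂, rfl, h1, h2⟩ := hQp.exists_of_subset h.walk₂ (by simp)
    (fun a ha => hQ a ⟨h.mem_right ha, h.tail_mem_openStrip ha⟩)
  exact ⟨S₁, S₂, hQp, h1, h2⟩

end DepartSetup

/-- A path that leaves the floor before it meets the ceiling arrives at the ceiling from the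
right. -/
theorem Setup.not_arrive_left {s t z : V} {C : Set V} {F X U : List A}
    (h : G.Setup s t C F z X U) [Finite A] [Finite V] {w m : V} {a : A} {M : List A}
    (hT : G.IsWalk w (a :: M) m) (ha : a ∈ F) (hU : ∀ e ∈ a :: M, G.src e ∉ G.verts s U)
    (hm : m ∈ G.verts s U) {e p q : A} (he : e ∈ a :: M) (hpq : [p, q] <:+: U ++ X) (hp : p ∈ U)
    (hem : G.tgt e = m) (hpm : G.tgt p = m) (hqm : G.src q = m) : ¬ G.LeftAt p q (e, false) := by
  intro hl
  obtain ⟨ψ, hψ⟩ := h.exists_stripPot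
  have heU : e ∉ U := fun h1 => hU e he (h.ceil_path.1.src_mem h1)
  -- An arc leaving the floor to the right does not lead to `z`, so the walk leaves it into the
  -- strip and stays there until it meets the ceiling.
  have hin : ∀ e ∈ a :: M, e ∈ F ∨ ψ (e, true) = 1 := by
    refine forall_of_step (.inl ha) fun e e' hee he' hpe => ?_
    have hv := hT.src_eq_of_infix hee
    have hwU := hU e' (by simp [he'])
    have heU : e ∉ U := fun h1 => hwU (hv ▸ tgt_mem_verts h1)
    by_cases hwF : G.src e' ∈ G.verts s F
    · obtain ⟨p, q, hpq, hp, hpw, hqw, hq, -⟩ := h.exists_turn h.floor_path hwF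
        (fun h1 => hwU (h1 ▸ start_mem_verts _ _))
      have hqF := hq fun h1 => hwU (h1 ▸ h.ceil_path.1.end_mem)
      by_cases hqe : e' = q
      · exact .inl (hqe ▸ hqF)
      · have hl := h.floor_third hpq hpw (d := (e', true)) rfl (by simp) (by simpa using hqe)
          (fun hr => h.not_reaches_of_rightOf hr hwF
            ((hT.reaches_end (tgt_mem_verts (by simp [he']))).trans (h.ceil_reaches hm)))
        right
        rw [(hψ.pot.leftAt hl).2.1]
        exact hψ.floor_left p hp fun h1 => hwU (hpw ▸ tgt_mem_verts h1)
    · have heF : e ∉ F := fun h1 => hwF (hv ▸ tgt_mem_verts h1)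
      right
      rw [hψ.pot.const_vertex (free_of_notMem h.floor_path.1 h.ceil_path.1 hwF hwU)
        (d := (e', true)) (e := (e, false)) rfl hv.symm, ← hψ.pot.jump_none heF heU]
      exact hpe.resolve_left heF
  by_cases heF : e ∈ F
  · obtain ⟨p₁, q₁, hpq₁, hp₁, hpm₁, hqm₁, -, -⟩ := h.exists_turn h.floor_path
      (tgt_mem_verts heF) (h.net.source_in e)
    have hpe : p₁ = e := h.floor_path.eq_of_tgt_eq hp₁ heF hpm₁
    rw [hpe] at hpq₁
    obtain ⟨hs, ht⟩ := h.net.inner_ne h.ceil_exit hpq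
    have hqq : q₁ = q := by
      by_contra hne
      have := h.net.third_unique (hqm.trans hpm.symm) hs ht (d := (q₁, true)) (e := (e, false))
        (hqm₁.trans (hem.trans hpm.symm)) (hem.trans hpm.symm) (by simp) (by simpa using hne)
        (fun h1 => heU ((show e = p from congrArg Prod.fst h1) ▸ hp)) (by simp)
      simp at this
    rw [hqq] at hpq₁
    -- If the last arc is a floor arc on the left of the ceiling arc `p`, then `p` is on the right
    -- of the floor, which is forbidden for the ceiling.
    have hr : G.RightAt e q (p, false) := ⟨hl.2.1, hl.2.2, hl.1⟩
    exact (h.ceil_allowed hp).2 ⟨e, q, hpq₁, hr.ccw⟩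
  · have h1 := (hin e he).resolve_left heF
    have h2 := (hψ.pot.leftAt hl).2.1
    rw [hψ.ceil_left p hp, ← hψ.pot.jump_none heF heU, h1] at h2
    exact one_ne_zero h2

/-! ### Necessity: passage through the return cycle -/

namespace ReturnCycle

variable {s t z u v k x : V} {C : Set V} {F X U P P₁ O Fa Fm Fc Ua Um Uc S₁ S₂ : List A} {o : A}
  {φ : A × Bool → ℝ}
  (h : G.ReturnCycle s t C F z X U u P v P₁ o O k Fa Fm Fc Ua Um Uc x φ)
include h
variable [Finite A] [Finite V]

/-- `S₁` starts inside the cycle and ends on its ceiling part. Avoiding `x`, it could have no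
ceiling vertex before by `separation`, but `s` is one. -/
theorem turn_mem_left (hQ : G.IsPath s (S₁ ++ ((o :: O) ++ S₂)) t) (h₁ : G.IsWalk s S₁ k) :
    x ∈ G.verts s S₁ := by
  by_contra hx
  have hsrc : ∀ e, G.tgt e ≠ s := h.net.source_in
  obtain ⟨T, T', m, hS₁, hT, -, hm, hfirst⟩ := h₁.exists_first (· ∈ Um.map G.tgt)
    ⟨k, h₁.end_mem, h.depart_mem⟩
  have hTp : G.IsPath s T m := IsPath.left (hS₁ ▸ hQ.left h₁) hT
  have hms : s ≠ m := by
    rintro rfl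
    obtain ⟨e, -, he⟩ := List.mem_map.1 hm
    exact hsrc e he
  obtain ⟨a, M, rfl, ha, -⟩ := hT.exists_cons (hT.ne_nil hms)
  have hmem : ∀ e ∈ a :: M, G.src e ∈ G.verts s S₁ := fun e he =>
    h₁.src_mem (by rw [hS₁]; exact List.mem_append_left _ he)
  have := (h.separation hTp (.inr ⟨h.source_in ha, h.notMem_of_source ha⟩) hm hfirst
    (fun e he h1 => hx (h1 ▸ hmem e he)) (fun e he h1 => hQ.disjoint (hmem e (by simp [he]))
      (by rw [List.map_append]; exact List.mem_append_left _ h1))).1 a (by simp)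
  exact this (ha ▸ start_mem_verts _ _)

/-- Otherwise `v = x`, and the simple path would visit it both on `S₁` and at the end of the tail.
-/
theorem end_notMem_ceil (hQ : G.IsPath s (S₁ ++ ((o :: O) ++ S₂)) t) (h₁ : G.IsWalk s S₁ k) :
    v ∉ G.verts s U := by
  intro hv
  have hx := h.turn_mem_left hQ h₁
  rw [← h.eq_turn hv] at hx
  exact hQ.disjoint hx (by rw [List.map_append]; exact List.mem_append_left _ h.end_mem_right)

/-- A path that continues from the end of the flipped path leaves the cycle at an exit. -/
theorem exists_exit (hQ : G.IsPath s (S₁ ++ ((o :: O) ++ S₂)) t) (h₁ : G.IsWalk s S₁ k)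
    (h₂ : G.IsWalk v S₂ t) : ∃ e, G.IsExit C t e ∧ e ∈ G.verts v Fm ∧ e ≠ v := by
  by_contra! hno
  have hxS := h.turn_mem_left hQ h₁
  have hvU := h.end_notMem_ceil hQ h₁
  have hvx : v ≠ x := fun h1 => hvU (h1 ▸ h.turn_mem_ceil)
  have hvs := h.ne_source h.path.1.end_mem
  obtain ⟨a, M, rfl, ha, -⟩ := h₂.exists_cons (h₂.ne_nil (h.ne_sink_of_reaches
    (h.floor_reaches h.end_floor)))
  have hQ₂ : G.IsPath k ((o :: O) ++ a :: M) t := hQ.right h₁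
  have hSp : G.IsPath v (a :: M) t := hQ₂.right h.walk₂
  have hx : ∀ e ∈ M, G.src e ≠ x := by
    intro e he h1
    refine hQ.disjoint hxS ?_
    rw [List.map_append]
    exact List.mem_append_right _ (h1 ▸ h₂.src_mem_tgt he)
  have hO : ∀ e ∈ M, G.src e ∉ (o :: O).map G.tgt := by
    intro e he h1
    exact hQ₂.disjoint (mem_verts.2 (.inr h1)) (h₂.src_mem_tgt he)
  obtain ⟨f, Fd, hFm, hf, -⟩ := h.floor_walk₂.exists_cons (h.floor_walk₂.ne_nil hvx)
  have hfF : f ∈ Fm := by rw [hFm]; simp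
  -- At `v` the floor and the flipped path both enter, so the only arc out is the floor arc.
  have haF : a ∈ Fm := by
    obtain ⟨L, b, hP, hb, -⟩ := h.exists_last
    have hbP : b ∈ P := by rw [hP]; simp
    obtain ⟨p, q, hpq, hp, hpv, hqv, -, -⟩ := h.exists_turn h.floor_path h.end_floor hvs
    obtain ⟨hs, ht⟩ := h.net.inner_ne h.floor_exit hpq
    have hqf : f = q := h.floor_exit.eq_of_src_eq (List.mem_append_left _ (h.floor_sub hfF))
      (mem_of_infix_right hpq) (hf.trans hqv.symm)
    by_contra haF
    have := h.net.third_unique (hqv.trans hpv.symm) hs ht (d := (a, true)) (e := (b, false))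
      (ha.trans hpv.symm) (hb.trans hpv.symm) (by simp)
      (fun h1 => haF ((show a = q from congrArg Prod.fst h1) ▸ hqf ▸ hfF))
      (fun h1 => h.notMem_floor hbP ((show b = p from congrArg Prod.fst h1) ▸ hp)) (by simp)
    simp at this
  have hUa : G.src a ∉ Um.map G.tgt := fun h1 => hvU (ha ▸ h.tgt_mem_ceil h1)
  -- Meeting the ceiling part would have to happen from the left by `separation`, which
  -- `not_arrive_left` excludes for a walk starting on the floor. Otherwise, without an exit to the
  -- right, the walk stays in the cycle up to `t`, which lies outside.
  by_cases hcm : ∃ m ∈ G.verts v (a :: M), m ∈ Um.map G.tgt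
  · obtain ⟨T, T', m, hTT, hT, -, hm, hfirst⟩ := h₂.exists_first (· ∈ Um.map G.tgt) hcm
    have hvm : v ≠ m := fun h1 => hvU (h1 ▸ h.tgt_mem_ceil hm)
    obtain ⟨a', M', rfl, -, -⟩ := hT.exists_cons (hT.ne_nil hvm)
    obtain ⟨rfl, rfl⟩ : a = a' ∧ M = M' ++ T' := by simpa using hTT
    have hTp : G.IsPath v (a :: M') m := IsPath.left (L := a :: M') hSp hT
    obtain ⟨h3, e, he, p, q, hpq, hp, hem, hpm, hqm, hl⟩ := h.separation hTp (.inl haF) hm hfirst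
      (by
        intro e he
        rcases List.mem_cons.1 he with rfl | he
        · exact fun h1 => hvx (ha.symm.trans h1)
        · exact hx e (List.mem_append_left _ he))
      (fun e he => hO e (List.mem_append_left _ he))
    exact h.not_arrive_left hT (h.floor_sub haF) h3 (h.tgt_mem_ceil hm) he hpq hp hem hpm hqm hl
  · push Not at hcm
    have hU : ∀ e ∈ M, G.src e ∉ Um.map G.tgt := fun e he =>
      hcm _ (h₂.src_mem (List.mem_cons_of_mem a he))
    have hin := h.inside_of_walk h₂ (.inl haF) hU hx hO (by
      intro e he hF hr
      have h3 : G.src e ∈ (a :: M).map G.tgt := h₂.src_mem_tgt he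
      have h4 := (h.exit_of_rightOf hr (h.verts_floor_sub hF)
        (h₂.reaches_end (tgt_mem_verts (List.mem_cons_of_mem a he)))).1
      exact hSp.start_notMem (hno _ h4 hF ▸ h3))
    obtain ⟨T, e, hT, -, het⟩ := h₂.exists_concat (by simp)
    have htz := fun h3 => h.ne_sink_of_reaches h3 rfl
    rcases hin e (by rw [hT]; simp) with h3 | ⟨h3, h4⟩
    · exact htz (h.floor_reaches (het ▸ tgt_mem_verts (h.floor_sub h3)))
    · have hfree : G.Free {b | b ∈ (Fm ++ Um) ++ o :: O ∨ b ∈ []} t :=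
        h.free_sink h.walk (x' := v) (y' := v) rfl (h.floor_reaches h.end_floor)
          (h.floor_reaches h.end_floor)
      have h5 := h.pot.eq_zero_of_outside (fun b hb => .inl hb) (fun b hb => .inr hb)
        (h.net.outside_of_vert_sink hfree (d := (e, false)) het)
      rw [← h.pot.jump_none h4 (by simp), h3] at h5
      exact one_ne_zero h5

end ReturnCycle

/-! ### Necessity: the hump of the end of the flipped path -/

namespace DepartSetup

variable {s t z u v k : V} {C : Set V} {F X U P P₁ O : List A} {o : A}
  (h : G.DepartSetup s t C F z X U u P v P₁ o O k)
include h
variable [Finite A]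

/-- The first vertex `x` of the ceiling on the floor after the end of the flipped path is not
the vertex where the flipped path departs from the ceiling. -/
theorem turn_ne {x : V} {Fa Fm Fc : List A} (hF : F = Fa ++ (Fm ++ Fc)) (hFm : G.IsWalk v Fm x)
    (hoff : ∀ e ∈ Fm, G.src e ∉ G.verts s U) (hxF : x ∈ G.verts s F) : x ≠ k := by
  rintro rfl
  have hxu : x = u := h.eq_start h.walk₁.end_mem hxF
  -- The floor would join the ceiling at `u`, leaving no dart for the arc `o` of the flipped path.
  subst hxu
  obtain ⟨M, p, hM, -, hp⟩ := hFm.exists_concat (hFm.ne_nil h.ne.symm)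
  have hpFm : p ∈ Fm := by rw [hM]; simp
  obtain ⟨p', -, -, hp', hpw', -, -, -⟩ := h.exists_turn h.ceil_path h.mem
    (h.ne_source (start_mem_verts _ _))
  have hm := (h.merge (by rw [hF]; simp [hpFm])
    (fun h1 => hoff p hpFm (h.ceil_path.1.src_mem h1)) hp' hp hpw').1
  have hoP := h.mem_right (List.mem_cons_self (a := o) (l := O))
  rcases List.mem_append.1 (hm o h.src_depart) with h1 | h1
  · exact h.notMem_floor hoP h1
  · exact h.notMem_exit hoP h1

variable [Finite V]

/-- The order of `x` and `k` on the ceiling decides. If `x` comes first, the return cycle exists and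
the useful path reveals an exit on the floor between `v` and `x`. If `k` comes first, `u` lies on
the floor between `v` and `x`, in the hump itself. -/
theorem exists_hump_of_isUseful (hQ : G.IsUseful s t {a | a ∈ P ∧ a ∈ G.openStrip C F U}) :
    ∃ g x L K, G.IsHump s F U g x L K ∧ v ∈ G.stripVerts g L K ∧
      ((u ∈ G.stripVerts g L K ∧ v ≠ g) ∨
        (u ∉ G.stripVerts g L K ∧ ∃ e, G.IsExit C t e ∧ e ∈ G.stripVerts g L K ∧
          Precedes (G.verts s F) v e)) := by
  obtain ⟨S₁, S₂, hS, hS₁, hS₂⟩ := h.exists_decomposition hQ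
  obtain ⟨Fa, Fb, hFab, hFa, hFb⟩ := h.floor_path.1.exists_split h.end_floor
  obtain ⟨Fm, Fc, x, hFb', hFm, hFc, hxU, hoff⟩ := hFb.exists_first (· ∈ G.verts s U)
    ⟨z, hFb.end_mem, h.ceil_path.1.end_mem⟩
  have hF : F = Fa ++ (Fm ++ Fc) := by rw [hFab, hFb']
  have hxF : x ∈ G.verts s F := by
    rw [hF, ← List.append_assoc]
    exact verts_subset_append (hFa.append hFm).end_mem
  have hvu := h.end_before_start
  have hmid : ∀ w ∈ G.verts s F, _ := fun w hw => (hF ▸ h.floor_path).mem_mid_iff hFa hFm (hF ▸ hw)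
  rw [← hF] at hmid
  have hvx := (hmid x hxF).1 hFm.end_mem
  have hxk := h.turn_ne hF hFm hoff hxF
  rcases lt_trichotomy (G.pos s U x) (G.pos s U k) with hlt | heq | hlt
  · obtain ⟨Ua, Um, Uc, φ, hR⟩ := h.exists_returnCycle hF hFa hFm hoff hxU hlt
    have hvU := hR.end_notMem_ceil hS hS₁
    obtain ⟨g, L, K, hH, hvL, hvg⟩ := h.exists_hump hF hFa hFm hvU hxU hoff
    refine ⟨g, x, L, K, hH, .inl hvL, ?_⟩
    by_cases hu : u ∈ G.stripVerts g L K
    · exact .inl ⟨hu, hvg⟩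
    · obtain ⟨e, he, heFm, hev⟩ := hR.exists_exit hS hS₁ hS₂
      have heF := hR.verts_floor_sub heFm
      have hpe := (hmid e heF).1 heFm
      obtain ⟨-, -, -, hL⟩ := h.hump_floor hH
      have hpv := (hL v h.end_floor).1 hvL
      refine .inr ⟨hu, e, he, .inl ((hL e heF).2 ⟨by omega, hpe.2⟩),
        (precedes_iff h.floor_path h.end_floor heF).2 (lt_of_le_of_ne hpe.1 ?_)⟩
      exact fun h1 => hev (pos_inj h.end_floor h1).symm
  · exact absurd (pos_inj hxU heq) hxk
  · have hux : G.pos s F u < G.pos s F x := by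
      by_contra h1
      have := h.pos_le_of_floor hxF hxU (by omega)
      omega
    have hvU : v ∉ G.verts s U := by
      intro hv
      cases Fm with
      | nil =>
        have : v = x := hFm
        rw [← this] at hux
        omega
      | cons f M => exact hoff f (by simp) (hFm.1.symm ▸ hv)
    obtain ⟨g, L, K, hH, hvL, hvg⟩ := h.exists_hump hF hFa hFm hvU hxU hoff
    obtain ⟨-, -, -, hL⟩ := h.hump_floor hH
    have hpv := (hL v h.end_floor).1 hvL
    exact ⟨g, x, L, K, hH, .inl hvL,
      .inl ⟨.inl ((hL u h.start_floor).2 ⟨by omega, hux.le⟩), hvg⟩⟩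

end DepartSetup

end PlaneDigraph

theorem mainTheorem7 {V A : Type*} [Finite V] [Finite A] (G : PlaneDigraph V A) (s t : V)
    (hG : G.IsNetwork s t) (C : Set V) (hC : G.IsSCC C) (hin : G.IsInsideCase C s t)
    (F : List A) (z : V) (hF : G.IsLowestFloor s t C F z)
    (X : List A) (hX : G.IsExitPath C t z X)
    (U : List A) (hU : G.IsTopmostCeiling s (F ++ X) U z)
    (u v : V) (P : List A) (hP : G.IsBackwardFlipped s C F (F ++ X) u P v) :
    G.IsUseful s t {a | a ∈ P ∧ a ∈ G.openStrip C F U} ↔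
      ∃ h x L K, G.IsHump s F U h x L K ∧ v ∈ G.stripVerts h L K ∧
        ((u ∈ G.stripVerts h L K ∧ v ≠ h) ∨
          (u ∉ G.stripVerts h L K ∧ ∃ e, G.IsExit C t e ∧ e ∈ G.stripVerts h L K ∧
            PlaneDigraph.Precedes (G.verts s F) v e)) := by
  have hflip : G.FlipSetup s t C F z X U u P v := ⟨⟨hG, hC, hin, hF, hX, hU⟩, hP⟩
  obtain ⟨P₁, o, O, k, h⟩ := hflip.exists_departure
  refine ⟨h.exists_hump_of_isUseful, ?_⟩
  rintro ⟨g, x, L, K, hH, hv, ⟨hu, -⟩ | ⟨hu, e, he, heL, hve⟩⟩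
  · exact h.isUseful_of_start_mem hH hv hu
  · obtain ⟨_, _, _, _, -, -, -, -, -, -, -, hexits⟩ := hF
    exact h.isUseful_of_exit hH hv hu he heL
      ((PlaneDigraph.precedes_iff h.floor_path h.end_floor (hexits e he)).1 hve)
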